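/- Let $a_j$, $j\in\frac12\mathbb Z$, be the generators of the Heisenberg algebra with $[a_i,a_j]=i\,\delta_{i+j,0}$. For $k\in\mathbb Z$ let $\overline{\mathrm F}(k)=\mathbb C[a_{-1/2},a_{-1},a_{-3/2},\dots]\,|\varnothing,k\rangle$ be its Fock module, with $a_j|\varnothing,k\rangle=0$ for $j>0$ and with $a_0$ acting on $\overline{\mathrm F}(k)$ as the number $k/\sqrt2$. Let $\mathrm F=\mathbb C[a_{-1/2},a_{-3/2},a_{-5/2},\dots]\,|\varnothing,0\rangle\subset\overline{\mathrm F}(0)$ be the Fock module of the subalgebra generated by the $a_r$, $r\in\mathbb Z+\frac12$, with the action of the Virasoro algebra of central charge $1$ given by $$L_n=\frac12\sum_{r\in\mathbb Z+\frac12}:\!a_{n-r}a_r\!:+\frac1{16}\delta_{n,0},\qquad n\in\mathbb Z .$$ Let $S\colon\overline{\mathrm F}(k)\to\overline{\mathrm F}(k+1)$ be given by $S|\varnothing,k\rangle=|\varnothing,k+1\rangle$ and $[S,a_j]=0$ for $j\ne0$. Define operators $\tilde\psi_r,\tilde\psi^*_r$, $r\in\frac12\mathbb Z+\frac14$, on $\bigoplus_{k\in\mathbb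 Z}\overline{\mathrm F}(k)$ by $$\sum_{r}\tilde\psi_r z^{-r-1/4}=S\,z^{a_0/\sqrt2}\exp\Big(\sum_{2j\in\mathbb Z_{>0}}\frac{z^j}{j\sqrt2}a_{-j}\Big)\exp\Big(-\sum_{2j\in\mathbb Z_{>0}}\frac{z^{-j}}{j\sqrt2}a_{j}\Big),$$ $$\sum_{r}\tilde\psi^*_r z^{-r-1/4}=S^{-1}z^{-a_0/\sqrt2}\exp\Big(-\sum_{2j\in\mathbb Z_{>0}}\frac{z^j}{j\sqrt2}a_{-j}\Big)\exp\Big(\sum_{2j\in\mathbb Z_{>0}}\frac{z^{-j}}{j\sqrt2}a_{j}\Big).$$ For $n\in\mathbb Z$ put $$v_n=\prod_{k=1}^{n}\tilde\psi_{-k+1/4}\tilde\psi^*_{-k+1/4}\,|\varnothing,0\rangle\quad(n\ge0),\qquad v_n=\prod_{k=1}^{-n}\tilde\psi_{-k+3/4}\tilde\psi^*_{-k+3/4}\,|\varnothing,0\rangle\quad(n<0).$$ A nonzero vector $v$ is called a highest weight vector of weight $\Delta\in\mathbb C$ if $L_kv=0$ for all $k>0$ and $L_0v=\Delta v$. Then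 the highest weight vectors of the Virasoro algebra in $\mathrm F$ are, up to scalar factors, exactly the vectors $v_n$, $n\in\mathbb Z$. That is: for every $n\in\mathbb Z$ the vector $v_n$ lies in $\mathrm F$ and is a (nonzero) highest weight vector of weight $(n+\frac14)^2$; and if $v\in\mathrm F$ is a highest weight vector of some weight $\Delta\in\mathbb C$, then there is $n\in\mathbb Z$ with $\Delta=(n+\frac14)^2$ and $v\in\mathbb C\,v_n$. -/

import Mathlib

open scoped BigOperators

noncomputable section

namespace VirFock

/-! ### Locally finite sums and formal exponentials of operators -/

/-- The operator `∑ᵢ Tᵢ` for a family of operators such that for each vector `v` only finitely many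
`Tᵢ v` are nonzero. -/
def locSum {ι V : Type*} [AddCommGroup V] [Module ℂ V] (T : ι → Module.End ℂ V)
    (h : ∀ v, (Function.support fun i => T i v).Finite) : Module.End ℂ V where
  toFun v := ∑ᶠ i, T i v
  map_add' v w := by
    simp only [map_add]
    exact finsum_add_distrib (h v) (h w)
  map_smul' c v := by
    simp only [map_smul, RingHom.id_apply]
    exact (smul_finsum' c (h v)).symm

/-- The coefficient of `t ^ N` in the formal exponential `exp (∑_{p ≥ 1} B p t ^ p)`.
The value `B 0` is not used. Only the powers `k ≤ N` of the exponent contribute. -/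
def expCoeff {V : Type*} [AddCommGroup V] [Module ℂ V] (B : ℕ → Module.End ℂ V) (N : ℕ) :
    Module.End ℂ V :=
  ∑ k ∈ Finset.range (N + 1), (k.factorial : ℂ)⁻¹ •
    PowerSeries.coeff N ((PowerSeries.mk fun p => if p = 0 then 0 else B p) ^ k)

/-! ### The Fock modules and the Heisenberg algebra

The Heisenberg generator `a_j`, `j ∈ ½ℤ`, is labelled by the integer `m = 2j`. -/

/-- The space underlying each Fock module `F̄(k)`: polynomials in the creation operators, where the
variable `X i` stands for `a_{-(i+1)/2}`, `i = 0, 1, 2, …`; the polynomial `1` is the vacuum. -/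
abbrev Pol : Type := MvPolynomial ℕ ℂ

/-- The direct sum `⊕_{k ∈ ℤ} F̄(k)`. -/
abbrev FockSum : Type := ℤ →₀ Pol

/-- The action of `a_{m/2}` on `F̄(k)`: for `j > 0`, `a_{-j}` is multiplication by the corresponding
variable, `a_j` is `j` times the derivative with respect to the variable `a_{-j}`, and `a_0` is the
number `k / √2`. Thus `[a_i, a_j] = i δ_{i+j,0}`. -/
def bos (k : ℤ) : ℤ → Module.End ℂ Pol
  | Int.ofNat 0 => ((k : ℂ) / ((Real.sqrt 2 : ℝ) : ℂ)) • (1 : Module.End ℂ Pol)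
  | Int.ofNat (i + 1) => (((i : ℂ) + 1) / 2) • (MvPolynomial.pderiv i).toLinearMap
  | Int.negSucc i => LinearMap.mulLeft ℂ (MvPolynomial.X i)

/-- The operator on `⊕ F̄(k)` that acts on `F̄(k)` by `T k`. -/
def onSectors (T : ℤ → Module.End ℂ Pol) : Module.End ℂ FockSum :=
  Finsupp.lsum ℂ fun k => Finsupp.lsingle k ∘ₗ T k

/-- The operator `a_{m/2}` on `⊕ F̄(k)`. -/
def heis (m : ℤ) : Module.End ℂ FockSum := onSectors fun k => bos k m

/-- The vacuum vector `|∅, k⟩`. -/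
def vac (k : ℤ) : FockSum := Finsupp.single k 1

/-- The shift `S : F̄(k) → F̄(k + 1)`, with `S |∅, k⟩ = |∅, k + 1⟩` and `[S, a_j] = 0`, `j ≠ 0`. -/
def shiftS : FockSum ≃ₗ[ℂ] FockSum := Finsupp.domLCongr (Equiv.addRight (1 : ℤ))

/-- The Fock module `F` over the Heisenberg algebra with generators `a_r`, `r ∈ ℤ + 1/2`, as a
subspace of `F̄(0)`: polynomials in the operators `a_{-r}`, `r = 1/2, 3/2, …` (that is, in
the variables `X i` with `i` even), applied to the vacuum `|∅⟩ = |∅, 0⟩`. -/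
def fockF : Submodule ℂ FockSum :=
  (Subalgebra.toSubmodule (MvPolynomial.supported ℂ {i : ℕ | Even i})).map
    (Finsupp.lsingle (0 : ℤ))

/-! ### The Virasoro action -/

/-- The normally ordered product `:a_{p/2} a_{q/2}:` (larger index to the right). -/
def normalOrd (p q : ℤ) : Module.End ℂ FockSum :=
  if p ≤ q then heis p * heis q else heis q * heis p

lemma exists_heis_eq_zero (v : FockSum) : ∃ b : ℤ, ∀ m, b ≤ m → heis m v = 0 := by
  induction v using Finsupp.induction_linear with
  | zero => exact ⟨0, fun m _ => map_zero _⟩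
  | add f g hf hg =>
    obtain ⟨b, hb⟩ := hf
    obtain ⟨c, hc⟩ := hg
    refine ⟨max b c, fun m hm => ?_⟩
    rw [map_add, hb m (le_trans (le_max_left _ _) hm), hc m (le_trans (le_max_right _ _) hm),
      add_zero]
  | single k f =>
    refine ⟨(f.vars.sup id : ℕ) + 2, fun m hm => ?_⟩
    obtain ⟨i, rfl⟩ : ∃ i : ℕ, m = Int.ofNat (i + 1) :=
      ⟨(m - 1).toNat, by simp only [Int.ofNat_eq_natCast]; omega⟩
    have hi : i ∉ f.vars := fun h => by
      have := Finset.le_sup (f := id) h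
      simp only [id, Int.ofNat_eq_natCast] at this hm
      omega
    simp [heis, onSectors, bos, MvPolynomial.pderiv_eq_zero_of_notMem_vars hi]

lemma normalOrd_finite (n : ℤ) (v : FockSum) :
    (Function.support fun s : ℤ => normalOrd (2 * n - (2 * s + 1)) (2 * s + 1) v).Finite := by
  obtain ⟨b, hb⟩ := exists_heis_eq_zero v
  refine (Set.finite_Icc (n - |b| - |n| - 2) (|b| + 2)).subset fun s hs => ?_
  by_contra hcon
  apply hs
  rw [Set.mem_Icc, not_and_or] at hcon
  have hb1 := le_abs_self b
  have hb2 := neg_abs_le b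
  have hn1 := le_abs_self n
  have hn2 := neg_abs_le n
  have hn0 := abs_nonneg n
  have hb0 := abs_nonneg b
  simp only [normalOrd]
  split_ifs with h
  · rw [Module.End.mul_apply, hb _ (by omega), map_zero]
  · rw [Module.End.mul_apply, hb _ (by omega), map_zero]

/-- The Virasoro generator
`L_n = ½ ∑_{r ∈ ℤ + 1/2} :a_{n-r} a_r: + (1/16) δ_{n,0}` of central charge `1`
(summation index `r = s + 1/2`, `s ∈ ℤ`). -/
def virL (n : ℤ) : Module.End ℂ FockSum :=
  (1 / 2 : ℂ) •
      locSum (fun s : ℤ => normalOrd (2 * n - (2 * s + 1)) (2 * s + 1)) (normalOrd_finite n) +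
    (if n = 0 then (1 / 16 : ℂ) else 0) • (1 : Module.End ℂ FockSum)

/-- `v` is a highest weight vector of the Virasoro algebra, of weight `Δ`. -/
def IsVirHighestWeight (Δ : ℂ) (v : FockSum) : Prop :=
  v ≠ 0 ∧ (∀ n : ℤ, 0 < n → virL n v = 0) ∧ virL 0 v = Δ • v

/-! ### The fermions -/

/-- The coefficient of `z ^ (M/2)` in
`exp (ε ∑_{j} z ^ j / (j √2) a_{-j})` on `F̄(k)`, the sum over `j = p/2`, `p = 1, 2, …`. -/
def creExp (ε k : ℤ) (M : ℕ) : Module.End ℂ Pol :=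
  expCoeff (fun p => ((ε : ℂ) * (((p : ℂ) / 2) * ((Real.sqrt 2 : ℝ) : ℂ))⁻¹) • bos k (-(p : ℤ))) M

/-- The coefficient of `z ^ (-N/2)` in
`exp (ε ∑_{j} z ^ (-j) / (-j √2) a_j)` on `F̄(k)`, the sum over `j = p/2`, `p = 1, 2, …`. -/
def annExp (ε k : ℤ) (N : ℕ) : Module.End ℂ Pol :=
  expCoeff (fun p => ((ε : ℂ) * (-((p : ℂ) / 2) * ((Real.sqrt 2 : ℝ) : ℂ))⁻¹) • bos k (p : ℤ)) N

/-- Polynomials of weight less than `D`, where `a_{-p/2}` has weight `p`. -/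
def lowWeight (D : ℕ) : Submodule ℂ Pol :=
  Submodule.span ℂ {f | ∃ s : ℕ →₀ ℕ, s.sum (fun i c => c * (i + 1)) < D ∧
    f = MvPolynomial.monomial s 1}

lemma lowWeight_zero : lowWeight 0 = ⊥ := by
  simp [lowWeight]

lemma exists_mem_lowWeight (f : Pol) : ∃ D, f ∈ lowWeight D := by
  refine ⟨(f.support.sup fun s => s.sum (fun i c => c * (i + 1))) + 1, ?_⟩
  rw [f.as_sum]
  refine Submodule.sum_mem _ fun s hs => ?_
  rw [← mul_one (f.coeff s), ← smul_eq_mul, ← MvPolynomial.smul_monomial]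
  refine Submodule.smul_mem _ _ (Submodule.subset_span ⟨s, ?_, rfl⟩)
  rw [← f.as_sum]
  exact Nat.lt_succ_of_le
    (Finset.le_sup (f := fun s : ℕ →₀ ℕ => s.sum (fun i c => c * (i + 1))) hs)

lemma pderiv_mem_lowWeight (i D : ℕ) {f : Pol} (hf : f ∈ lowWeight D) :
    MvPolynomial.pderiv i f ∈ lowWeight (D - (i + 1)) := by
  induction hf using Submodule.span_induction with
  | zero => simp
  | add x y _ _ hx hy => rw [map_add]; exact add_mem hx hy
  | smul c x _ hx => rw [Derivation.map_smul]; exact Submodule.smul_mem _ _ hx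
  | mem x hx =>
    obtain ⟨s, hs, rfl⟩ := hx
    rw [MvPolynomial.pderiv_monomial]
    by_cases h0 : s i = 0
    · simp [h0]
    · rw [← mul_one (1 * (s i : ℂ)), ← smul_eq_mul, ← MvPolynomial.smul_monomial]
      refine Submodule.smul_mem _ _ (Submodule.subset_span ⟨_, ?_, rfl⟩)
      have hle : Finsupp.single i 1 ≤ s := by
        rw [Finsupp.single_le_iff]; omega
      have h1 : (s - Finsupp.single i 1 + Finsupp.single i 1).sum (fun i c => c * (i + 1))
          = (s - Finsupp.single i 1).sum (fun i c => c * (i + 1)) + (i + 1) := by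
        rw [Finsupp.sum_add_index' (by simp) (by intros; ring)]
        simp
      rw [tsub_add_cancel_of_le hle] at h1
      omega

lemma annExp_mem_lowWeight (ε k : ℤ) (N D : ℕ) {f : Pol} (hf : f ∈ lowWeight D) :
    annExp ε k N f ∈ lowWeight (D - N) := by
  have key : ∀ (c : ℕ → ℂ) (q N D : ℕ) (f : Pol), f ∈ lowWeight D →
      PowerSeries.coeff N ((PowerSeries.mk fun p : ℕ =>
        if p = 0 then (0 : Module.End ℂ Pol) else c p • bos k (p : ℤ)) ^ q) f
        ∈ lowWeight (D - N) := by
    intro c q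
    induction q with
    | zero =>
      intro N D f hf
      rw [pow_zero, PowerSeries.coeff_one]
      split_ifs with h
      · subst h; simpa using hf
      · simp
    | succ q ih =>
      intro N D f hf
      rw [pow_succ, PowerSeries.coeff_mul, LinearMap.sum_apply]
      refine Submodule.sum_mem _ fun x hx => ?_
      rw [Finset.HasAntidiagonal.mem_antidiagonal] at hx
      rw [Module.End.mul_apply, PowerSeries.coeff_mk]
      have : D - N = D - x.2 - x.1 := by omega
      rw [this]
      apply ih
      split_ifs with h
      · simp
      · obtain ⟨i, hi⟩ := Nat.exists_eq_succ_of_ne_zero h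
        rw [hi, LinearMap.smul_apply]
        refine Submodule.smul_mem _ _ ?_
        change ((((i : ℂ) + 1) / 2) • (MvPolynomial.pderiv i).toLinearMap) f ∈ _
        rw [LinearMap.smul_apply]
        exact Submodule.smul_mem _ _ (pderiv_mem_lowWeight i D hf)
  unfold annExp expCoeff
  rw [LinearMap.sum_apply]
  refine Submodule.sum_mem _ fun q _ => ?_
  rw [LinearMap.smul_apply]
  exact Submodule.smul_mem _ _ (key _ q N D f hf)

/-- The term of `z ^ (ε a_0 / √2) exp (…) exp (…)` on `F̄(k)` with indices `M`, `N` in the two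
exponentials, if it contributes to the power `z ^ (e/2)`, and `0` otherwise.
Note that `z ^ (ε a_0 / √2) = z ^ (ε k / 2)` on `F̄(k)`. -/
def vertexTerm (ε k e : ℤ) (x : ℕ × ℕ) : Module.End ℂ Pol :=
  if ε * k + x.1 - x.2 = e then creExp ε k x.1 * annExp ε k x.2 else 0

lemma vertexTerm_finite (ε k e : ℤ) (f : Pol) :
    (Function.support fun x => vertexTerm ε k e x f).Finite := by
  obtain ⟨D, hD⟩ := exists_mem_lowWeight f
  refine ((Set.finite_Iic (e - ε * k + D).toNat).prod (Set.finite_Iic D)).subset fun x hx => ?_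
  rw [Function.mem_support, vertexTerm] at hx
  split_ifs at hx with h
  · have h2 : x.2 ≤ D := by
      by_contra hcon
      apply hx
      have hm := annExp_mem_lowWeight ε k x.2 D hD
      rw [Nat.sub_eq_zero_of_le (by omega), lowWeight_zero, Submodule.mem_bot] at hm
      rw [Module.End.mul_apply, hm, map_zero]
    refine Set.mem_prod.2 ⟨?_, h2⟩
    rw [Set.mem_Iic]
    omega
  · simp at hx

/-- The coefficient of `z ^ (e/2)` in
`z ^ (ε a_0/√2) exp (ε ∑_j z ^ j/(j√2) a_{-j}) exp (ε ∑_j z ^ (-j)/(-j√2) a_j)` on `F̄(k)`. -/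
def vertexCoeff (ε k e : ℤ) : Module.End ℂ Pol :=
  locSum (vertexTerm ε k e) (vertexTerm_finite ε k e)

/-- The fermion `ψ̃_r` with `r = m/2 + 1/4`, `m ∈ ℤ`: the coefficient of
`z ^ (-r - 1/4) = z ^ (-(m+1)/2)` in
`ψ̃(z) = S z ^ (a_0/√2) exp (∑_j z ^ j/(j√2) a_{-j}) exp (∑_j z ^ (-j)/(-j√2) a_j)`. -/
def psi (m : ℤ) : Module.End ℂ FockSum :=
  shiftS.toLinearMap ∘ₗ onSectors fun k => vertexCoeff 1 k (-(m + 1))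

/-- The fermion `ψ̃*_r` with `r = m/2 + 1/4`, `m ∈ ℤ`: the coefficient of
`z ^ (-r - 1/4) = z ^ (-(m+1)/2)` in
`ψ̃*(z) = S⁻¹ z ^ (-a_0/√2) exp (∑_j z ^ j/(-j√2) a_{-j}) exp (∑_j z ^ (-j)/(j√2) a_j)`. -/
def psiStar (m : ℤ) : Module.End ℂ FockSum :=
  shiftS.symm.toLinearMap ∘ₗ onSectors fun k => vertexCoeff (-1) k (-(m + 1))

/-- The vectors `∏_{k=1}^{n} ψ̃_{-k+1/4} ψ̃*_{-k+1/4} |∅,0⟩` for `n ≥ 0` and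
`∏_{k=1}^{-n} ψ̃_{-k+3/4} ψ̃*_{-k+3/4} |∅,0⟩` for `n < 0`; the factor `k = 1` is leftmost.
The list index is `i = k - 1`. In the labelling of `psi`, `r = -k + 1/4` is `m = -2k`,
and `r = -k + 3/4` is `m = -2k + 1`. -/
def fermVec (n : ℤ) : FockSum :=
  if 0 ≤ n then
    ((List.range n.toNat).map fun i : ℕ =>
      psi (-2 * ((i : ℤ) + 1)) * psiStar (-2 * ((i : ℤ) + 1))).prod (vac 0)
  else
    ((List.range (-n).toNat).map fun i : ℕ =>
      psi (-2 * ((i : ℤ) + 1) + 1) * psiStar (-2 * ((i : ℤ) + 1) + 1)).prod (vac 0)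

end VirFock

end

open scoped BigOperators

noncomputable section

namespace VirFock

open scoped ComplexConjugate

/-! ### Oscillators and their Sugawara operators -/

/-! The vectors `fermVec n` are highest weight vectors by fermionic calculus, and there are no
others because the Virasoro module they generate already has the dimension of $\mathrm F$ in every
degree.

Existence. The modes of the two vertex operators satisfy $[a_q,\psi_m]=\pm\frac1{\sqrt2}\psi_{m+q}$
(`heis_vertexOp_comm`), the anticommutation relations (`vertexOp_anticomm`), and, for the Sugawara
operators built from all the $a_j$, the relations of a primary field of weight $1/4$
(`sug_vertexOp_comm`). The last two are proved by a uniqueness principle, `eq_zero_of_vacuum`: a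
family of operators closed under commutators with the nonzero modes is determined by its
vacuum-to-vacuum coefficients. In labels $m=2j$, the bosonic mode $a_s$ and the operator $L_s$ both
shift a fermionic mode by $2s$. For $s>0$ the shifted mode is already present in the product or
kills the vacuum, so $a_s$ and $L_s$ kill `fermVec n`. Together with charge zero, being killed by
the $a_s$ puts the vector in $\mathrm F$ (`mem_fockF_of_heis`); the half-integral Virasoro operators
then agree on it with the full Sugawara operators up to the constant $1/16$ (`virL_eq_sug`). It is
nonzero because the dual modes remove the fermions again (`fermProd_ne_zero`).

Completeness. Compare $\mathrm F$ with the direct sum `allVir` of untwisted Fock modules having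
vacuum weights $(n+\frac14)^2$. Both carry positive definite forms with $L_n^*=L_{-n}$ and central
charge one. The normalized `fermVec n` and the vacua of `allVir` are orthonormal singular vectors of
the same weights, so the Virasoro relations force corresponding descendants to have the same inner
products (`pairSpan_ip`). Hence the submodule of $\mathrm F$ generated by the `fermVec n` is
isometric to the submodule generated by the vacua.

That submodule is all of `allVir`. After rescaling the variables by $\sqrt2$, the operator
$4L_{-k-1}$ preserves integral polynomials and modulo $2$ is multiplication by $X_k$ plus possibly
the square of an earlier variable, because $4n+1$ is odd. Modulo $2$ every integral polynomial is
therefore a combination of descendants, and Nakayama's lemma removes the modulus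
(`functional_eq_zero`, `allVir_eigenspace_le`). Gauss' identity
$\prod_k(1-q^{2k})/(1-q^{2k-1})=\sum_t q^{t(t+1)/2}$, with $n(2n+1)$ running through the triangular
numbers, bounds the graded dimensions of $\mathrm F$ by those of `allVir` (`card_oscWt_le`). So the
descendants of the `fermVec n` exhaust each eigenspace of $L_0$ (`UnitaryVir.eigenspace_le_span`). A
singular vector is orthogonal to all proper descendants, and the weights $(n+\frac14)^2$ are
distinct, so it is a multiple of one `fermVec n` (`UnitaryVir.IsSing.mem_span`). -/

lemma finsum_eq_finsum_comp {α β M : Type*} [AddCommMonoid M] {f : α → M} {g : β → α}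
    (hg : Function.Injective g) (h : ∀ i, i ∉ Set.range g → f i = 0) :
    ∑ᶠ i, f i = ∑ᶠ j, f (g j) := by
  classical
  rw [← finsum_mem_range hg]
  refine finsum_congr fun i => ?_
  by_cases hi : i ∈ Set.range g
  · rw [finsum_eq_if, if_pos hi]
  · rw [finsum_eq_if, if_neg hi, h i hi]

/-- Operators `a p`, `p ∈ ℤ`, with `[a p, a q] = ω p δ_{p+q,0}`, each vector being killed by all
`a p` with `p` large. -/
structure Oscillators (V : Type*) [AddCommGroup V] [Module ℂ V] where
  a : ℤ → Module.End ℂ V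
  ω : ℤ → ℂ
  comm : ∀ p q, a p * a q - a q * a p = if p + q = 0 then ω p • 1 else 0
  fin : ∀ v, ∃ b : ℤ, ∀ m, b ≤ m → a m v = 0
  ω_neg : ∀ p, ω (-p) = -ω p

namespace Oscillators

variable {V : Type*} [AddCommGroup V] [Module ℂ V] (A : Oscillators V)

/-- The normally ordered product `:a p a q:`. -/
def no (p q : ℤ) : Module.End ℂ V := if p ≤ q then A.a p * A.a q else A.a q * A.a p

lemma no_apply_eq_zero {p q b : ℤ} {v : V} (hb : ∀ m, b ≤ m → A.a m v = 0) (h : b ≤ max p q) :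
    A.no p q v = 0 := by
  unfold no
  split_ifs with hpq
  · rw [Module.End.mul_apply, hb _ (by omega), map_zero]
  · rw [Module.End.mul_apply, hb _ (by omega), map_zero]

lemma no_support_subset (n : ℤ) {b : ℤ} {v : V} (hb : ∀ m, b ≤ m → A.a m v = 0) :
    (Function.support fun p : ℤ => A.no (2 * n - p) p v) ⊆ Finset.Icc (2 * n - b) b := by
  intro p hp
  by_contra hcon
  apply hp
  rw [Finset.coe_Icc, Set.mem_Icc, not_and_or] at hcon
  exact A.no_apply_eq_zero hb (by omega)

lemma no_finite (n : ℤ) (v : V) :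
    (Function.support fun p : ℤ => A.no (2 * n - p) p v).Finite := by
  obtain ⟨b, hb⟩ := A.fin v
  exact (Finset.finite_toSet _).subset (A.no_support_subset n hb)

/-- The operator `½ ∑_p :a (2n - p) a p:`. -/
def sug (n : ℤ) : Module.End ℂ V :=
  (1 / 2 : ℂ) • locSum (fun p : ℤ => A.no (2 * n - p) p) (A.no_finite n)

lemma sug_apply (n : ℤ) (v : V) :
    A.sug n v = (1 / 2 : ℂ) • ∑ᶠ p : ℤ, A.no (2 * n - p) p v := rfl

/-- The Leibniz rule gives a result symmetric in the two factors, so the normal ordering plays no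
role here. -/
lemma no_comm (x y p : ℤ) :
    A.no x y * A.a p - A.a p * A.no x y =
      (if y = -p then A.ω y • A.a x else 0) + (if x = -p then A.ω x • A.a y else 0) := by
  have key : ∀ x y : ℤ, A.a x * A.a y * A.a p - A.a p * (A.a x * A.a y) =
      (if y = -p then A.ω y • A.a x else 0) + (if x = -p then A.ω x • A.a y else 0) := by
    intro x y
    have h1 : A.a x * A.a y * A.a p - A.a p * (A.a x * A.a y) =
        A.a x * (A.a y * A.a p - A.a p * A.a y) + (A.a x * A.a p - A.a p * A.a x) * A.a y := by
      noncomm_ring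
    rw [h1, A.comm, A.comm]
    congr 1
    · by_cases h : y = -p
      · rw [if_pos (by omega), if_pos h, mul_smul_comm, mul_one]
      · rw [if_neg (by omega), if_neg h, mul_zero]
    · by_cases h : x = -p
      · rw [if_pos (by omega), if_pos h, smul_mul_assoc, one_mul]
      · rw [if_neg (by omega), if_neg h, zero_mul]
  unfold no
  by_cases h : x ≤ y
  · rw [if_pos h]
    exact key x y
  · rw [if_neg h, key y x, add_comm]

/-- Only the summands with index `-p` and `p + 2 * n` fail to commute with `a p`. They contribute
equally, which cancels the factor one half. -/
lemma sug_comm (n p : ℤ) :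
    A.sug n * A.a p - A.a p * A.sug n = -A.ω p • A.a (p + 2 * n) := by
  ext v
  simp only [LinearMap.sub_apply, Module.End.mul_apply, sug_apply, map_smul, LinearMap.smul_apply]
  have hfin : (Function.support fun q : ℤ => A.a p (A.no (2 * n - q) q v)).Finite :=
    (A.no_finite n v).subset (Function.support_comp_subset (map_zero (A.a p)) _)
  rw [map_finsum (A.a p) (A.no_finite n v), ← smul_sub,
    ← finsum_sub_distrib (A.no_finite n _) hfin]
  have h : ∀ q : ℤ, A.no (2 * n - q) q (A.a p v) - A.a p (A.no (2 * n - q) q v) =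
      (if q = -p then -A.ω p • A.a (p + 2 * n) v else 0) +
      (if q = p + 2 * n then -A.ω p • A.a (p + 2 * n) v else 0) := by
    intro q
    have := congrArg (fun T : Module.End ℂ V => T v) (A.no_comm (2 * n - q) q p)
    simp only [LinearMap.sub_apply, Module.End.mul_apply, LinearMap.add_apply] at this
    rw [this]
    congr 1
    · by_cases hq : q = -p
      · rw [if_pos hq, if_pos hq, hq, A.ω_neg, LinearMap.smul_apply]
        congr 3; ring
      · rw [if_neg hq, if_neg hq, LinearMap.zero_apply]
    · by_cases hq : q = p + 2 * n
      · rw [if_pos hq, if_pos (by omega), hq, LinearMap.smul_apply,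
          show 2 * n - (p + 2 * n) = -p by ring, A.ω_neg]
      · rw [if_neg hq, if_neg (by omega), LinearMap.zero_apply]
  simp only [h]
  have hf : ∀ x : ℤ, (Function.support fun q : ℤ =>
      if q = x then -A.ω p • A.a (p + 2 * n) v else 0).Finite := fun x =>
    (Set.finite_singleton x).subset fun q hq => by
      by_contra hc
      exact hq (if_neg hc)
  have hs : ∀ x : ℤ, (∑ᶠ q : ℤ, if q = x then -A.ω p • A.a (p + 2 * n) v else 0) =
      -A.ω p • A.a (p + 2 * n) v := fun x => by
    rw [finsum_eq_single _ x fun q hq => if_neg hq, if_pos rfl]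
  rw [finsum_add_distrib (hf _) (hf _), hs, hs, ← two_smul ℂ, smul_smul]
  norm_num

/-- The Sugawara operators shifted by a constant `κ` in degree zero. -/
def vir (κ : ℂ) (n : ℤ) : Module.End ℂ V := A.sug n + (if n = 0 then κ else 0) • 1

lemma vir_comm (κ : ℂ) (n p : ℤ) :
    A.vir κ n * A.a p - A.a p * A.vir κ n = -A.ω p • A.a (p + 2 * n) := by
  rw [← A.sug_comm, vir, add_mul, mul_add, smul_mul_assoc, mul_smul_comm, one_mul, mul_one]
  abel

/-- The defect `[Lₘ, Lₙ] - (m - n) Lₘ₊ₙ` commutes with all oscillators. -/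
lemma vir_defect_comm (κ : ℂ) (hω : ∀ p n, A.ω p * A.ω (p + 2 * n) = A.ω p * ((p + 2 * n) / 2))
    (m n p : ℤ) :
    (A.vir κ m * A.vir κ n - A.vir κ n * A.vir κ m - ((m : ℂ) - n) • A.vir κ (m + n)) * A.a p =
    A.a p *
      (A.vir κ m * A.vir κ n - A.vir κ n * A.vir κ m - ((m : ℂ) - n) • A.vir κ (m + n)) := by
  have hc : ∀ k q, A.vir κ k * A.a q = A.a q * A.vir κ k + -A.ω q • A.a (q + 2 * k) :=
    fun k q => by rw [← A.vir_comm κ k q]; abel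
  -- All terms but the last, and apart from the product kept on the right of `a p`, are symmetric in
  -- `k` and `l`. Antisymmetrizing leaves `ω p * (n - m)`, which is what the term `(m - n) • L (m +
  -- n)` produces.
  have h2 : ∀ k l : ℤ, A.vir κ k * A.vir κ l * A.a p = A.a p * (A.vir κ k * A.vir κ l) +
      -A.ω p • (A.a (p + 2 * k) * A.vir κ l) + -A.ω p • (A.a (p + 2 * l) * A.vir κ k) +
      (A.ω p * ((p + 2 * l) / 2)) • A.a (p + 2 * (k + l)) := by
    intro k l
    rw [mul_assoc, hc, mul_add, ← mul_assoc, hc, mul_smul_comm, hc, ← hω]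
    rw [add_mul, smul_add, smul_smul, smul_mul_assoc, mul_assoc,
      show p + 2 * l + 2 * k = p + 2 * (k + l) by ring, neg_mul_neg]
    abel
  rw [sub_mul, sub_mul, h2, h2, smul_mul_assoc, hc, mul_sub, mul_sub, mul_smul_comm, add_comm n m]
  module

end Oscillators

/-! ### Fock modules with one oscillator of every other degree -/

lemma pderiv_comm (i j : ℕ) (f : Pol) :
    MvPolynomial.pderiv i (MvPolynomial.pderiv j f) =
      MvPolynomial.pderiv j (MvPolynomial.pderiv i f) := by
  ext s
  simp only [MvPolynomial.coeff_pderiv, Finsupp.add_apply]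
  rw [add_right_comm]
  by_cases h : i = j
  · subst h; ring
  · rw [Finsupp.single_eq_of_ne h, Finsupp.single_eq_of_ne (Ne.symm h)]
    push_cast; ring

/-- The oscillators on polynomials: for `p = 2 i + 1 + ε > 0`, `a p` is `p/2` times the derivative by
the `i`-th variable, `a (-p)` is multiplication by this variable, and `a 0 = z`. -/
def oscA (ε : Fin 2) (z : ℂ) (p : ℤ) : Module.End ℂ Pol :=
  if p = 0 then z • 1
  else if (p - 1 - (ε : ℕ)) % 2 = 0 then
    if 0 < p then ((p : ℂ) / 2) • (MvPolynomial.pderiv ((p - 1 - (ε : ℕ)) / 2).toNat).toLinearMap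
    else LinearMap.mulLeft ℂ (MvPolynomial.X ((-p - 1 - (ε : ℕ)) / 2).toNat)
  else 0

/-- The commutator of `a p` and `a (-p)`. -/
def oscω (ε : Fin 2) (p : ℤ) : ℂ := if (p - 1 - (ε : ℕ)) % 2 = 0 then (p : ℂ) / 2 else 0

/-- The index of the oscillator that belongs to the `i`-th variable. -/
def oscPos (ε : Fin 2) (i : ℕ) : ℤ := 2 * i + 1 + (ε : ℕ)

lemma oscPos_pos (ε : Fin 2) (i : ℕ) : 0 < oscPos ε i := by unfold oscPos; omega

lemma oscPos_injective (ε : Fin 2) : Function.Injective (oscPos ε) := fun i j h => by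
  unfold oscPos at h; omega

lemma oscA_zero (ε : Fin 2) (z : ℂ) : oscA ε z 0 = z • 1 := if_pos rfl

lemma oscA_pos (ε : Fin 2) (z : ℂ) (i : ℕ) :
    oscA ε z (oscPos ε i) =
      ((oscPos ε i : ℂ) / 2) • (MvPolynomial.pderiv (R := ℂ) i).toLinearMap := by
  have h := oscPos_pos ε i
  unfold oscA
  rw [if_neg h.ne', if_pos (by unfold oscPos; omega), if_pos h]
  congr 3
  unfold oscPos; omega

lemma oscA_neg (ε : Fin 2) (z : ℂ) (i : ℕ) :
    oscA ε z (-oscPos ε i) = LinearMap.mulLeft ℂ (MvPolynomial.X (R := ℂ) i) := by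
  have h := oscPos_pos ε i
  unfold oscA
  rw [if_neg (by omega), if_pos (by unfold oscPos; omega), if_neg (by omega)]
  congr 2
  unfold oscPos; omega

lemma oscω_pos (ε : Fin 2) (i : ℕ) : oscω ε (oscPos ε i) = (oscPos ε i : ℂ) / 2 :=
  if_pos (by unfold oscPos; omega)

lemma oscω_neg (ε : Fin 2) (p : ℤ) : oscω ε (-p) = -oscω ε p := by
  unfold oscω
  by_cases h : (p - 1 - (ε : ℕ)) % 2 = 0
  · rw [if_pos h, if_pos (by omega)]; push_cast; ring
  · rw [if_neg h, if_neg (by omega), neg_zero]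

lemma oscω_zero (ε : Fin 2) : oscω ε 0 = 0 := by
  have := oscω_neg ε 0
  rw [neg_zero] at this
  exact self_eq_neg.mp this

lemma osc_cases (ε : Fin 2) (p : ℤ) : p = 0 ∨ (∃ i, p = oscPos ε i) ∨ (∃ i, p = -oscPos ε i) ∨
    (oscω ε p = 0 ∧ ∀ z, oscA ε z p = 0) := by
  by_cases h0 : p = 0
  · exact Or.inl h0
  by_cases h : (p - 1 - (ε : ℕ)) % 2 = 0
  · by_cases hp : 0 < p
    · refine Or.inr (Or.inl ⟨((p - 1 - (ε : ℕ)) / 2).toNat, ?_⟩)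
      unfold oscPos; omega
    · refine Or.inr (Or.inr (Or.inl ⟨((-p - 1 - (ε : ℕ)) / 2).toNat, ?_⟩))
      unfold oscPos; omega
  · exact Or.inr (Or.inr (Or.inr ⟨if_neg h, fun z => by rw [oscA, if_neg h0, if_neg h]⟩))

lemma oscA_comm_pos (ε : Fin 2) (z : ℂ) (i : ℕ) (q : ℤ) :
    oscA ε z (oscPos ε i) * oscA ε z q - oscA ε z q * oscA ε z (oscPos ε i) =
      if oscPos ε i + q = 0 then oscω ε (oscPos ε i) • 1 else 0 := by
  have hi := oscPos_pos ε i
  rcases osc_cases ε q with rfl | ⟨j, rfl⟩ | ⟨j, rfl⟩ | ⟨h, h'⟩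
  · rw [oscA_zero, if_neg (by omega)]; simp
  · have hj := oscPos_pos ε j
    rw [if_neg (by omega), oscA_pos, oscA_pos]
    refine LinearMap.ext fun f => ?_
    simp only [LinearMap.sub_apply, Module.End.mul_apply, LinearMap.smul_apply,
      Derivation.coeFn_coe, map_smul, pderiv_comm i j, LinearMap.zero_apply]
    rw [smul_comm, sub_self]
  · rw [oscA_pos, oscA_neg, oscω_pos]
    refine LinearMap.ext fun f => ?_
    by_cases hij : i = j
    · subst hij
      rw [if_pos (by omega)]
      simp only [LinearMap.sub_apply, Module.End.mul_apply, LinearMap.smul_apply,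
        LinearMap.mulLeft_apply, Derivation.coeFn_coe, MvPolynomial.pderiv_mul,
        MvPolynomial.pderiv_X_self, Module.End.one_apply, mul_smul_comm]
      rw [← smul_sub]; congr 1; ring
    · rw [if_neg fun h => hij (oscPos_injective ε (by omega))]
      simp only [LinearMap.sub_apply, Module.End.mul_apply, LinearMap.smul_apply,
        LinearMap.mulLeft_apply, Derivation.coeFn_coe, MvPolynomial.pderiv_mul,
        MvPolynomial.pderiv_X_of_ne (Ne.symm hij), LinearMap.zero_apply, mul_smul_comm]
      rw [← smul_sub, zero_mul, zero_add, sub_self, smul_zero]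
  · rw [h' z, mul_zero, zero_mul, sub_zero]
    split_ifs with hs
    · rw [eq_neg_of_add_eq_zero_right hs, oscω_neg, neg_eq_zero] at h
      rw [h, zero_smul]
    · rfl

lemma oscA_fin (ε : Fin 2) (z : ℂ) (f : Pol) : ∃ b : ℤ, ∀ m, b ≤ m → oscA ε z m f = 0 := by
  refine ⟨2 * (f.vars.sup id : ℕ) + 4, fun m hm => ?_⟩
  rcases osc_cases ε m with rfl | ⟨i, rfl⟩ | ⟨i, rfl⟩ | ⟨-, h'⟩
  · omega
  · have hi : i ∉ f.vars := fun h => by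
      have := Finset.le_sup (f := id) h
      simp only [id] at this
      unfold oscPos at hm
      omega
    rw [oscA_pos]
    simp [MvPolynomial.pderiv_eq_zero_of_notMem_vars hi]
  · have := oscPos_pos ε i
    omega
  · rw [h', LinearMap.zero_apply]

/-- The polynomial Fock module. -/
def osc (ε : Fin 2) (z : ℂ) : Oscillators Pol where
  a := oscA ε z
  ω := oscω ε
  ω_neg := oscω_neg ε
  fin := oscA_fin ε z
  comm p q := by
    rcases osc_cases ε p with rfl | ⟨i, rfl⟩ | ⟨i, rfl⟩ | ⟨h, h'⟩
    · rw [oscA_zero, oscω_zero]; simp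
    · exact oscA_comm_pos ε z i q
    · rcases osc_cases ε q with rfl | ⟨j, rfl⟩ | ⟨j, rfl⟩ | ⟨h, h'⟩
      · rw [oscA_zero, if_neg (by have := oscPos_pos ε i; omega)]; simp
      · rw [← neg_sub, oscA_comm_pos, oscω_neg]
        by_cases hij : oscPos ε j + -oscPos ε i = 0
        · rw [if_pos hij, if_pos (by omega), show oscPos ε i = oscPos ε j by omega]
          module
        · rw [if_neg hij, if_neg (by omega), neg_zero]
      · rw [if_neg (by have := oscPos_pos ε i; have := oscPos_pos ε j; omega), oscA_neg, oscA_neg]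
        refine LinearMap.ext fun f => ?_
        simp [mul_left_comm]
      · rw [h' z, mul_zero, zero_mul, sub_zero]
        split_ifs with hs
        · rw [eq_neg_of_add_eq_zero_right hs, oscω_neg, neg_eq_zero] at h
          rw [h, zero_smul]
        · rfl
    · rw [h' z, mul_zero, zero_mul, sub_zero, h, zero_smul, ite_self]

lemma osc_a (ε : Fin 2) (z : ℂ) (p : ℤ) : (osc ε z).a p = oscA ε z p := rfl

/-- The indices `p` and `p + 2 * n` have the same parity, so the second factor is nontrivial
whenever the first is. This is the hypothesis of `vir_defect_comm`. -/
lemma oscω_mul (ε : Fin 2) (p n : ℤ) :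
    oscω ε p * oscω ε (p + 2 * n) = oscω ε p * ((p + 2 * n) / 2) := by
  unfold oscω
  by_cases h : (p - 1 - (ε : ℕ)) % 2 = 0
  · rw [if_pos h, if_pos (by omega)]; push_cast; ring
  · rw [if_neg h, zero_mul, zero_mul]

lemma oscA_one_of_pos (ε : Fin 2) (z : ℂ) {p : ℤ} (hp : 0 < p) : oscA ε z p 1 = 0 := by
  rcases osc_cases ε p with rfl | ⟨i, rfl⟩ | ⟨i, rfl⟩ | ⟨-, h'⟩
  · omega
  · rw [oscA_pos]; simp
  · have := oscPos_pos ε i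
    omega
  · rw [h', LinearMap.zero_apply]

lemma eq_C_of_pderiv_eq_zero {f : Pol} (h : ∀ i, MvPolynomial.pderiv i f = 0) :
    f = MvPolynomial.C (MvPolynomial.constantCoeff f) := by
  ext s
  rw [MvPolynomial.coeff_C]
  split_ifs with hs
  · rw [← hs]; rfl
  · obtain ⟨i, hi⟩ : ∃ i, s i ≠ 0 := by
      by_contra hc
      push Not at hc
      exact hs (Finsupp.ext fun i => (hc i).symm)
    have h1 := congrArg (MvPolynomial.coeff (s - Finsupp.single i 1)) (h i)
    have hle : Finsupp.single i 1 ≤ s := by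
      rw [Finsupp.single_le_iff]; omega
    rw [MvPolynomial.coeff_pderiv, tsub_add_cancel_of_le hle, MvPolynomial.coeff_zero] at h1
    refine (mul_eq_zero.mp h1).resolve_right ?_
    exact_mod_cast Nat.succ_ne_zero ((s - Finsupp.single i 1 : ℕ →₀ ℕ) i)

/-- An operator that commutes with all oscillators is a scalar. -/
lemma osc_schur (ε : Fin 2) (z : ℂ) {D : Module.End ℂ Pol}
    (h : ∀ p, D * oscA ε z p = oscA ε z p * D) : ∃ c : ℂ, D = c • 1 := by
  -- The vacuum is killed by all annihilation operators, hence so is `D 1`; such a polynomial is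
  -- constant. The creation operators carry this scalar to all polynomials.
  have h1 : D 1 = MvPolynomial.C (MvPolynomial.constantCoeff (D 1)) := by
    refine eq_C_of_pderiv_eq_zero fun i => ?_
    have := congrArg (fun T : Module.End ℂ Pol => T 1) (h (oscPos ε i))
    simp only [Module.End.mul_apply, oscA_one_of_pos ε z (oscPos_pos ε i), map_zero] at this
    rw [oscA_pos, LinearMap.smul_apply] at this
    refine (smul_eq_zero.mp this.symm).resolve_left ?_
    have := oscPos_pos ε i
    simp only [ne_eq, div_eq_zero_iff, OfNat.ofNat_ne_zero, or_false]
    exact_mod_cast this.ne'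
  refine ⟨MvPolynomial.constantCoeff (D 1), ?_⟩
  refine LinearMap.ext fun f => ?_
  induction f using MvPolynomial.induction_on with
  | C a =>
    rw [← mul_one (MvPolynomial.C a), ← MvPolynomial.smul_eq_C_mul, map_smul, map_smul]
    congr 1
    rw [LinearMap.smul_apply, Module.End.one_apply, MvPolynomial.smul_eq_C_mul, mul_one, ← h1]
  | add f g hf hg => rw [map_add, map_add, hf, hg]
  | mul_X f i hf =>
    have := congrArg (fun T : Module.End ℂ Pol => T f) (h (-oscPos ε i))
    simp only [Module.End.mul_apply, oscA_neg, LinearMap.mulLeft_apply] at this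
    rw [mul_comm, this, hf]
    simp

/-! ### Adjoints of the Sugawara operators. -/

namespace Oscillators
variable {V : Type*} [AddCommGroup V] [Module ℂ V] (A : Oscillators V)

lemma no_symm (p q : ℤ) : A.no p q = A.no q p := by
  unfold no
  rcases lt_trichotomy p q with h | rfl | h
  · rw [if_pos h.le, if_neg (by omega)]
  · rfl
  · rw [if_neg (by omega), if_pos h.le]

/-- If `a (-p)` is adjoint to `a p`, then `L (-n)` is adjoint to `L n`. -/
lemma sug_adjoint {ip : V → V → ℂ} (hr : ∀ x y z, ip x (y + z) = ip x y + ip x z)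
    (hl : ∀ x y z, ip (x + y) z = ip x z + ip y z) (hsr : ∀ (c : ℂ) x y, ip x (c • y) = c * ip x y)
    (hsl : ∀ (c : ℂ) x y, ip (c • x) y = conj c * ip x y)
    (h : ∀ p x y, ip (A.a p x) y = ip x (A.a (-p) y)) (n : ℤ) (x y : V) :
    ip (A.sug n x) y = ip x (A.sug (-n) y) := by
  have hno : ∀ p q : ℤ, ip (A.no p q x) y = ip x (A.no (-p) (-q) y) := by
    intro p q
    have key : ∀ p q : ℤ, p ≤ q → ip (A.no p q x) y = ip x (A.no (-p) (-q) y) := by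
      intro p q hpq
      rw [A.no_symm (-p), no, if_pos hpq, no, if_pos (by omega), Module.End.mul_apply, h, h,
        Module.End.mul_apply]
    rcases le_total p q with hpq | hpq
    · exact key p q hpq
    · rw [A.no_symm p, A.no_symm (-p)]; exact key q p hpq
  have h1 := map_finsum (AddMonoidHom.mk' (fun x => ip x y) fun a b => hl a b y)
    (A.no_finite n x)
  have h2 := map_finsum (AddMonoidHom.mk' (ip x) (hr x)) (A.no_finite (-n) y)
  simp only [AddMonoidHom.mk'_apply] at h1 h2
  rw [sug_apply, sug_apply, hsl, hsr, h1, h2, ← finsum_comp_equiv (Equiv.neg ℤ)]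
  congr 1
  · rw [map_div₀, map_one, Complex.conj_ofNat]
  · refine finsum_congr fun p => ?_
    rw [hno, Equiv.neg_apply, show -(2 * n - -p) = 2 * -n - p by ring, neg_neg]

end Oscillators

/-! ### The Hermitian form -/

/-- The square of the norm of a monomial. -/
def oscNorm (ε : Fin 2) (s : ℕ →₀ ℕ) : ℝ :=
  s.prod fun i c => (c.factorial : ℝ) * ((oscPos ε i : ℝ) / 2) ^ c

lemma oscNorm_pos (ε : Fin 2) (s : ℕ →₀ ℕ) : 0 < oscNorm ε s := by
  refine Finset.prod_pos fun i _ => mul_pos (by positivity) (pow_pos ?_ _)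
  have : (0 : ℝ) < oscPos ε i := by exact_mod_cast oscPos_pos ε i
  positivity

lemma oscNorm_add_single (ε : Fin 2) (s : ℕ →₀ ℕ) (i : ℕ) :
    oscNorm ε (s + Finsupp.single i 1) = oscNorm ε s * ((s i + 1) * ((oscPos ε i : ℝ) / 2)) := by
  unfold oscNorm
  rw [← Finsupp.mul_prod_erase' s i _ (by simp),
    ← Finsupp.mul_prod_erase' (s + Finsupp.single i 1) i _ (by simp)]
  have : (s + Finsupp.single i 1).erase i = s.erase i := by
    rw [Finsupp.erase_add, Finsupp.erase_single, add_zero]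
  rw [this, Finsupp.add_apply, Finsupp.single_eq_same, Nat.factorial_succ, pow_succ]
  push_cast
  ring

/-- The Hermitian form on polynomials for which `a (-p)` is adjoint to `a p`. -/
def oscIp (ε : Fin 2) (f g : Pol) : ℂ :=
  ∑ᶠ s, conj (MvPolynomial.coeff s f) * MvPolynomial.coeff s g * (oscNorm ε s : ℂ)

lemma oscIp_eq_sum (ε : Fin 2) (f g : Pol) {S : Finset (ℕ →₀ ℕ)} (hS : f.support ⊆ S) :
    oscIp ε f g =
      ∑ s ∈ S, conj (MvPolynomial.coeff s f) * MvPolynomial.coeff s g * (oscNorm ε s : ℂ) := by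
  refine finsum_eq_sum_of_support_subset _ fun s hs => ?_
  refine Finset.mem_coe.2 (hS (MvPolynomial.mem_support_iff.2 fun h => hs ?_))
  simp only [h, map_zero, zero_mul]

lemma oscIp_add_right (ε : Fin 2) (f g h : Pol) :
    oscIp ε f (g + h) = oscIp ε f g + oscIp ε f h := by
  simp only [oscIp_eq_sum ε f _ (Finset.Subset.refl _), ← Finset.sum_add_distrib,
    MvPolynomial.coeff_add]
  exact Finset.sum_congr rfl fun s _ => by ring

lemma oscIp_smul_right (ε : Fin 2) (c : ℂ) (f g : Pol) :
    oscIp ε f (c • g) = c * oscIp ε f g := by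
  simp only [oscIp_eq_sum ε f _ (Finset.Subset.refl _), Finset.mul_sum,
    MvPolynomial.coeff_smul, smul_eq_mul]
  exact Finset.sum_congr rfl fun s _ => by ring

lemma oscIp_conj (ε : Fin 2) (f g : Pol) : conj (oscIp ε g f) = oscIp ε f g := by
  classical
  rw [oscIp_eq_sum ε f g Finset.subset_union_left,
    oscIp_eq_sum ε g f (Finset.subset_union_right (s₁ := f.support)), map_sum]
  refine Finset.sum_congr rfl fun s _ => ?_
  simp only [map_mul, Complex.conj_conj, Complex.conj_ofReal]
  ring

lemma oscIp_self (ε : Fin 2) (f : Pol) : oscIp ε f f =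
    ((∑ s ∈ f.support, Complex.normSq (MvPolynomial.coeff s f) * oscNorm ε s : ℝ) : ℂ) := by
  rw [oscIp_eq_sum ε f f (Finset.Subset.refl _)]
  push_cast
  exact Finset.sum_congr rfl fun s _ => by rw [Complex.normSq_eq_conj_mul_self]

lemma oscIp_nonneg (ε : Fin 2) (f : Pol) : 0 ≤ (oscIp ε f f).re := by
  rw [oscIp_self, Complex.ofReal_re]
  exact Finset.sum_nonneg fun s _ => mul_nonneg (Complex.normSq_nonneg _) (oscNorm_pos ε s).le

lemma oscIp_definite (ε : Fin 2) (f : Pol) (h : oscIp ε f f = 0) : f = 0 := by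
  rw [oscIp_self, Complex.ofReal_eq_zero, Finset.sum_eq_zero_iff_of_nonneg fun s _ =>
    mul_nonneg (Complex.normSq_nonneg _) (oscNorm_pos ε s).le] at h
  ext s
  by_contra hs
  have := h s (MvPolynomial.mem_support_iff.2 hs)
  exact hs (Complex.normSq_eq_zero.1 ((mul_eq_zero.1 this).resolve_right (oscNorm_pos ε s).ne'))

lemma oscIp_add_left (ε : Fin 2) (f g h : Pol) :
    oscIp ε (f + g) h = oscIp ε f h + oscIp ε g h := by
  rw [← oscIp_conj, oscIp_add_right, map_add, oscIp_conj, oscIp_conj]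

lemma oscIp_smul_left (ε : Fin 2) (c : ℂ) (f g : Pol) :
    oscIp ε (c • f) g = conj c * oscIp ε f g := by
  rw [← oscIp_conj, oscIp_smul_right, map_mul, oscIp_conj]

lemma oscIp_one_left (ε : Fin 2) (f : Pol) : oscIp ε 1 f = MvPolynomial.constantCoeff f := by
  rw [oscIp_eq_sum ε 1 f (S := {0})]
  · simp [oscNorm, MvPolynomial.constantCoeff_eq]
  · intro s hs
    rw [MvPolynomial.mem_support_iff, MvPolynomial.coeff_one] at hs
    rw [Finset.mem_singleton]
    by_contra hc
    exact hs (if_neg fun h => hc h.symm)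

/-- Raising the exponent of one variable multiplies `oscNorm` by exactly the coefficient that the
derivative produces, times half the mode index (`oscNorm_add_single`). -/
lemma oscIp_X_mul (ε : Fin 2) (i : ℕ) (f g : Pol) :
    oscIp ε (MvPolynomial.X i * f) g =
      oscIp ε f (((oscPos ε i : ℂ) / 2) • MvPolynomial.pderiv i g) := by
  classical
  unfold oscIp
  have hinj : Function.Injective fun s : ℕ →₀ ℕ => s + Finsupp.single i 1 :=
    fun s t h => add_right_cancel h
  rw [finsum_eq_finsum_comp hinj]
  · refine finsum_congr fun s => ?_
    rw [add_comm, MvPolynomial.coeff_X_mul, MvPolynomial.coeff_smul, MvPolynomial.coeff_pderiv,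
      add_comm, oscNorm_add_single]
    push_cast
    simp only [smul_eq_mul]
    ring
  · intro s hs
    rw [MvPolynomial.coeff_X_mul', if_neg, map_zero, zero_mul, zero_mul]
    intro hi
    refine hs ⟨s - Finsupp.single i 1, tsub_add_cancel_of_le ?_⟩
    rw [Finsupp.single_le_iff]
    exact Nat.one_le_iff_ne_zero.2 (Finsupp.mem_support_iff.1 hi)

lemma oscIp_a (ε : Fin 2) (z : ℝ) (p : ℤ) (f g : Pol) :
    oscIp ε (oscA ε z p f) g = oscIp ε f (oscA ε z (-p) g) := by
  have hneg : ∀ i f g,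
      oscIp ε (oscA ε z (-oscPos ε i) f) g = oscIp ε f (oscA ε z (oscPos ε i) g) := by
    intro i f g
    rw [oscA_neg, LinearMap.mulLeft_apply, oscIp_X_mul, oscA_pos]
    rfl
  rcases osc_cases ε p with rfl | ⟨i, rfl⟩ | ⟨i, rfl⟩ | ⟨h, h'⟩
  · rw [neg_zero, oscA_zero]
    simp only [LinearMap.smul_apply, Module.End.one_apply, oscIp_smul_left, oscIp_smul_right,
      Complex.conj_ofReal]
  · rw [← oscIp_conj, ← hneg, oscIp_conj]
  · rw [hneg, neg_neg]
  · have h2 : oscA ε z (-p) = 0 := by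
      rcases osc_cases ε (-p) with hp | ⟨i, hi⟩ | ⟨i, hi⟩ | ⟨-, h2⟩
      · rw [neg_eq_zero.1 hp, neg_zero]
        rw [neg_eq_zero.1 hp] at h'
        exact h' _
      · exfalso
        rw [← neg_eq_zero, ← oscω_neg, hi, oscω_pos] at h
        have := oscPos_pos ε i
        simp only [div_eq_zero_iff, OfNat.ofNat_ne_zero, or_false, Int.cast_eq_zero] at h
        omega
      · exfalso
        rw [neg_inj.1 hi, oscω_pos] at h
        have := oscPos_pos ε i
        simp only [div_eq_zero_iff, OfNat.ofNat_ne_zero, or_false, Int.cast_eq_zero] at h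
        omega
      · exact h2 _
    rw [h', h2, LinearMap.zero_apply, LinearMap.zero_apply]
    rw [← zero_smul ℂ (0 : Pol), oscIp_smul_left, oscIp_smul_right]
    simp

lemma oscIp_vir (ε : Fin 2) (z κ : ℝ) (n : ℤ) (f g : Pol) :
    oscIp ε ((osc ε z).vir κ n f) g = oscIp ε f ((osc ε z).vir κ (-n) g) := by
  simp only [Oscillators.vir, LinearMap.add_apply, LinearMap.smul_apply, Module.End.one_apply,
    oscIp_add_left, oscIp_add_right, oscIp_smul_left, oscIp_smul_right, neg_eq_zero]
  rw [(osc ε z).sug_adjoint (oscIp_add_right ε) (oscIp_add_left ε) (oscIp_smul_right ε)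
    (oscIp_smul_left ε) (oscIp_a ε z)]
  congr 2
  split_ifs <;> simp

/-! ### Unitary representations of the Virasoro algebra of central charge one -/

/-- Operators `L n` with the Virasoro relations of central charge one (the central term is only
recorded for `n = 1, 2`) and a positive definite form for which `L (-n)` is adjoint to `L n`. -/
structure UnitaryVir (V : Type*) [AddCommGroup V] [Module ℂ V] where
  L : ℤ → Module.End ℂ V
  ip : V → V → ℂ
  comm : ∀ m n : ℤ, m + n ≠ 0 → L m * L n - L n * L m = ((m : ℂ) - n) • L (m + n)
  comm_one : L 1 * L (-1) - L (-1) * L 1 = (2 : ℂ) • L 0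
  comm_two : L 2 * L (-2) - L (-2) * L 2 = (4 : ℂ) • L 0 + (1 / 2 : ℂ) • 1
  ip_add : ∀ x y z, ip x (y + z) = ip x y + ip x z
  ip_smul : ∀ (c : ℂ) x y, ip x (c • y) = c * ip x y
  ip_conj : ∀ x y, conj (ip y x) = ip x y
  ip_nonneg : ∀ x, 0 ≤ (ip x x).re
  ip_definite : ∀ x, ip x x = 0 → x = 0
  ip_L : ∀ n x y, ip (L n x) y = ip x (L (-n) y)

lemma oscIp_X (ε : Fin 2) (i : ℕ) (g : Pol) : oscIp ε (MvPolynomial.X i) g =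
    ((oscPos ε i : ℂ) / 2) * MvPolynomial.constantCoeff (MvPolynomial.pderiv i g) := by
  rw [← mul_one (MvPolynomial.X i), oscIp_X_mul, oscIp_smul_right, oscIp_one_left]

lemma oscIp_zero_right (ε : Fin 2) (f : Pol) : oscIp ε f 0 = 0 := by
  rw [← zero_smul ℂ (0 : Pol), oscIp_smul_right, zero_mul]

/-! ### The Virasoro relations and the central charge of the oscillator representations. -/

lemma vir_one_of_pos (ε : Fin 2) (z κ : ℂ) {n : ℤ} (hn : 0 < n) : (osc ε z).vir κ n 1 = 0 := by
  have h : ∀ p : ℤ, (osc ε z).no (2 * n - p) p 1 = 0 := fun p =>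
    (osc ε z).no_apply_eq_zero (b := 1) (fun m hm => oscA_one_of_pos ε z (by omega)) (by omega)
  simp only [Oscillators.vir, Oscillators.sug_apply, h, finsum_zero, smul_zero, if_neg hn.ne',
    zero_smul, add_zero]

lemma vir_zero_one (ε : Fin 2) (z κ : ℂ) :
    (osc ε z).vir κ 0 1 = (z ^ 2 / 2 + κ) • (1 : Pol) := by
  have h : ∀ p : ℤ, p ≠ 0 → (osc ε z).no (2 * 0 - p) p 1 = 0 := fun p hp =>
    (osc ε z).no_apply_eq_zero (b := 1) (fun m hm => oscA_one_of_pos ε z (by omega)) (by omega)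
  rw [Oscillators.vir, LinearMap.add_apply, Oscillators.sug_apply, finsum_eq_single _ 0 h,
    Oscillators.no, if_pos (by norm_num), if_pos rfl]
  simp only [mul_zero, sub_zero, osc_a, oscA_zero, Module.End.mul_apply, LinearMap.smul_apply,
    Module.End.one_apply]
  module

/-- The defect commutes with every oscillator, so Schur's lemma applies. No direct computation of
the central term with infinite sums is needed; the scalar is found from vacuum expectations. -/
lemma vir_defect_scalar (ε : Fin 2) (z κ : ℂ) (m n : ℤ) : ∃ c : ℂ,
    (osc ε z).vir κ m * (osc ε z).vir κ n - (osc ε z).vir κ n * (osc ε z).vir κ m -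
      ((m : ℂ) - n) • (osc ε z).vir κ (m + n) = c • 1 :=
  osc_schur ε z fun p => (osc ε z).vir_defect_comm κ (oscω_mul ε) m n p

lemma eq_zero_of_smul_one {c : ℂ} (ε : Fin 2) (h : oscIp ε 1 (c • (1 : Pol)) = 0) : c = 0 := by
  rw [oscIp_smul_right, oscIp_one_left, map_one, mul_one] at h
  exact h

/-- The vacuum expectation of the defect vanishes: for positive `n` the vacuum is killed directly,
for negative `n` after passing to the adjoint. -/
lemma vir_zero_comm (ε : Fin 2) (z κ : ℝ) (n : ℤ) :
    (osc ε z).vir κ 0 * (osc ε z).vir κ n - (osc ε z).vir κ n * (osc ε z).vir κ 0 =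
      (-n : ℂ) • (osc ε z).vir κ n := by
  obtain ⟨c, hc⟩ := vir_defect_scalar ε z κ 0 n
  have h1 := congrArg (fun T : Module.End ℂ Pol => oscIp ε 1 (T 1)) hc
  have hc0 : c = 0 := by
    rcases lt_trichotomy n 0 with hn | rfl | hn
    · refine eq_zero_of_smul_one ε (h1.symm.trans ?_)
      have h2 : ∀ f, oscIp ε 1 ((osc ε z).vir κ n f) = 0 := fun f => by
        rw [← neg_neg n, ← oscIp_vir, vir_one_of_pos ε z κ (by omega), ← zero_smul ℂ (0 : Pol),
          oscIp_smul_left, map_zero, zero_mul]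
      simp only [LinearMap.sub_apply, Module.End.mul_apply, LinearMap.smul_apply,
        zero_add, vir_zero_one, map_smul]
      have h3 : oscIp ε 1 ((osc ε z).vir κ 0 ((osc ε z).vir κ n 1)) = 0 := by
        rw [← neg_zero, ← oscIp_vir, vir_zero_one, oscIp_smul_left, h2, mul_zero]
      rw [sub_sub, ← add_smul, sub_eq_add_neg, ← neg_smul, oscIp_add_right, oscIp_smul_right, h2,
        h3, mul_zero, add_zero]
    · rw [sub_self, zero_add, sub_self, zero_smul, sub_zero] at hc
      have := congrArg (fun T : Module.End ℂ Pol => T 1) hc.symm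
      simpa using this
    · refine eq_zero_of_smul_one ε (h1.symm.trans ?_)
      simp only [LinearMap.sub_apply, Module.End.mul_apply, LinearMap.smul_apply,
        zero_add, vir_zero_one, map_smul, vir_one_of_pos ε z κ hn, map_zero, smul_zero, sub_zero]
      rw [← zero_smul ℂ (0 : Pol), oscIp_smul_right, zero_mul]
  rw [hc0, zero_smul, sub_eq_zero, zero_add, Int.cast_zero, zero_sub] at hc
  exact hc

/-- The defect is a scalar `c`, so it commutes with `L 0`; but it also has degree `m + n` under `L
0`. Hence `(m + n) * c = 0`. -/
lemma vir_comm_of_ne (ε : Fin 2) (z κ : ℝ) {m n : ℤ} (hmn : m + n ≠ 0) :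
    (osc ε z).vir κ m * (osc ε z).vir κ n - (osc ε z).vir κ n * (osc ε z).vir κ m =
      ((m : ℂ) - n) • (osc ε z).vir κ (m + n) := by
  obtain ⟨c, hc⟩ := vir_defect_scalar ε z κ m n
  have h0 : ∀ k : ℤ, (osc ε z).vir κ 0 * (osc ε z).vir κ k =
      (osc ε z).vir κ k * (osc ε z).vir κ 0 + (-k : ℂ) • (osc ε z).vir κ k := fun k => by
    rw [← vir_zero_comm ε z κ k]; abel
  have h00 : ∀ k l : ℤ, (osc ε z).vir κ 0 * ((osc ε z).vir κ k * (osc ε z).vir κ l) =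
      (osc ε z).vir κ k * (osc ε z).vir κ l * (osc ε z).vir κ 0 +
        (-(k + l) : ℂ) • ((osc ε z).vir κ k * (osc ε z).vir κ l) := fun k l => by
    rw [← mul_assoc, h0, add_mul, mul_assoc, h0, mul_add, smul_mul_assoc, mul_smul_comm,
      ← mul_assoc]
    module
  have h1 : (osc ε z).vir κ 0 * (c • 1 : Module.End ℂ Pol) =
      (c • 1) * (osc ε z).vir κ 0 + (-(m + n) : ℂ) • (c • 1 : Module.End ℂ Pol) := by
    rw [← hc]
    simp only [mul_sub, sub_mul, h00, mul_smul_comm, smul_mul_assoc, h0]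
    push_cast
    module
  rw [mul_smul_comm, smul_mul_assoc, mul_one, one_mul, left_eq_add, smul_smul] at h1
  have h2 := congrArg (fun T : Module.End ℂ Pol => T 1) h1
  simp only [LinearMap.smul_apply, Module.End.one_apply, LinearMap.zero_apply, smul_eq_zero,
    one_ne_zero, or_false, mul_eq_zero] at h2
  have h3 : c = 0 := by
    refine h2.resolve_left ?_
    rw [neg_eq_zero]
    exact_mod_cast hmn
  rw [h3, zero_smul, sub_eq_zero] at hc
  exact hc

/-- The central term is determined by the norm of `L (-n)` applied to the vacuum. -/
lemma vir_comm_neg (ε : Fin 2) (z κ : ℝ) {n : ℤ} (hn : 0 < n) (c : ℂ)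
    (h : oscIp ε ((osc ε z).vir κ (-n) 1) ((osc ε z).vir κ (-n) 1) =
      2 * n * (z ^ 2 / 2 + κ) + c) :
    (osc ε z).vir κ n * (osc ε z).vir κ (-n) - (osc ε z).vir κ (-n) * (osc ε z).vir κ n =
      (2 * n : ℂ) • (osc ε z).vir κ 0 + c • 1 := by
  obtain ⟨d, hd⟩ := vir_defect_scalar ε z κ n (-n)
  have h1 := congrArg (fun T : Module.End ℂ Pol => oscIp ε 1 (T 1)) hd
  simp only [LinearMap.sub_apply, Module.End.mul_apply, LinearMap.smul_apply,
    vir_one_of_pos ε z κ hn, map_zero, sub_zero, add_neg_cancel, vir_zero_one, smul_smul,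
    Module.End.one_apply] at h1
  have h11 : oscIp ε 1 1 = 1 := by rw [oscIp_one_left, map_one]
  have h2 := oscIp_vir ε z κ (-n) 1 ((osc ε z).vir κ (-n) 1)
  rw [neg_neg, h] at h2
  rw [sub_eq_add_neg, ← neg_smul, oscIp_add_right, oscIp_smul_right, oscIp_smul_right, h11,
    ← h2, mul_one, mul_one] at h1
  rw [add_neg_cancel] at hd
  rw [sub_eq_iff_eq_add] at hd
  rw [hd, ← h1]
  push_cast
  module

lemma no_one_of_lt (ε : Fin 2) (z : ℂ) {p q : ℤ} (h : 0 < p ∨ 0 < q) :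
    (osc ε z).no p q 1 = 0 :=
  (osc ε z).no_apply_eq_zero (b := 1) (fun m hm => oscA_one_of_pos ε z (by omega)) (by omega)

lemma vir_neg_one_one (ε : Fin 2) (z κ : ℂ) : (osc ε z).vir κ (-1) 1 =
    (1 / 2 : ℂ) • (oscA ε z (-2) (oscA ε z 0 1) + oscA ε z (-1) (oscA ε z (-1) 1) +
      oscA ε z (-2) (oscA ε z 0 1)) := by
  rw [Oscillators.vir, LinearMap.add_apply, Oscillators.sug_apply,
    finsum_eq_sum_of_support_subset (s := {0, -1, -2})]
  · simp [Oscillators.no, osc_a, add_assoc]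
  · intro p hp
    by_contra hc
    refine hp (no_one_of_lt ε z ?_)
    simp only [Finset.coe_insert, Finset.coe_singleton, Set.mem_insert_iff,
      Set.mem_singleton_iff] at hc
    omega

lemma vir_neg_two_one (ε : Fin 2) (z κ : ℂ) : (osc ε z).vir κ (-2) 1 =
    (1 / 2 : ℂ) • (oscA ε z (-4) (oscA ε z 0 1) + oscA ε z (-3) (oscA ε z (-1) 1) +
      oscA ε z (-2) (oscA ε z (-2) 1) + oscA ε z (-3) (oscA ε z (-1) 1) +
      oscA ε z (-4) (oscA ε z 0 1)) := by
  rw [Oscillators.vir, LinearMap.add_apply, Oscillators.sug_apply,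
    finsum_eq_sum_of_support_subset (s := {0, -1, -2, -3, -4})]
  · simp [Oscillators.no, osc_a, add_assoc]
  · intro p hp
    by_contra hc
    refine hp (no_one_of_lt ε z ?_)
    simp only [Finset.coe_insert, Finset.coe_singleton, Set.mem_insert_iff,
      Set.mem_singleton_iff] at hc
    omega

/-- The Virasoro representation given by oscillators, when its central charge is one. -/
def oscVir (ε : Fin 2) (z κ : ℝ)
    (h1 : oscIp ε ((osc ε z).vir κ (-1) 1) ((osc ε z).vir κ (-1) 1) = 2 * (z ^ 2 / 2 + κ))
    (h2 : oscIp ε ((osc ε z).vir κ (-2) 1) ((osc ε z).vir κ (-2) 1) =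
      4 * (z ^ 2 / 2 + κ) + 1 / 2) : UnitaryVir Pol where
  L := (osc ε z).vir κ
  ip := oscIp ε
  comm _ _ := vir_comm_of_ne ε z κ
  comm_one := by
    have := vir_comm_neg ε z κ (n := 1) one_pos 0 (by rw [h1]; push_cast; ring)
    rw [this]; push_cast; module
  comm_two := by
    have := vir_comm_neg ε z κ (n := 2) two_pos (1 / 2) (by rw [h2]; push_cast; ring)
    rw [this]; push_cast; module
  ip_add := oscIp_add_right ε
  ip_smul := oscIp_smul_right ε
  ip_conj := oscIp_conj ε
  ip_nonneg := oscIp_nonneg ε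
  ip_definite := oscIp_definite ε
  ip_L := oscIp_vir ε z κ

/-- The twisted Fock module. -/
def twisted : UnitaryVir Pol := oscVir 0 0 (1 / 16)
  (by
    -- Here `L (-1)` sends the vacuum to $\frac12X_0^2$, of square norm
    -- $\frac14\cdot2\cdot\frac14=\frac18=2\cdot\frac1{16}$. This is where the constant $1/16$ is
    -- forced.
    rw [vir_neg_one_one, oscA_zero, show (-1 : ℤ) = -oscPos 0 0 by norm_num [oscPos], oscA_neg]
    simp [-Complex.coe_smul, oscIp_X, Complex.conj_ofNat, oscIp_smul_left, oscIp_smul_right,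
      oscIp_X_mul, oscPos]
    norm_num)
  (by
    -- Here `L (-2)` sends the vacuum to $X_1X_0$, of square norm
    -- $\frac32\cdot\frac12=\frac4{16}+\frac12$.
    have h2 : oscA 0 ((0 : ℝ) : ℂ) (-2) = 0 := by
      rw [oscA, if_neg (by norm_num), if_neg (by norm_num)]
    rw [vir_neg_two_one, oscA_zero, h2, show (-1 : ℤ) = -oscPos 0 0 by norm_num [oscPos],
      show (-3 : ℤ) = -oscPos 0 1 by norm_num [oscPos], oscA_neg, oscA_neg]
    simp [-Complex.coe_smul, oscIp_X, Complex.conj_ofNat, oscIp_smul_left, oscIp_smul_right,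
      oscIp_add_left, oscIp_add_right, oscIp_X_mul, oscPos]
    norm_num)

/-- The untwisted Fock module with zero mode `z`. -/
def untwisted (z : ℝ) : UnitaryVir Pol := oscVir 1 z 0
  (by
    have h1 : oscA 1 (z : ℂ) (-1) = 0 := by
      rw [oscA, if_neg (by norm_num), if_neg (by norm_num)]
    rw [vir_neg_one_one, oscA_zero, h1, show (-2 : ℤ) = -oscPos 1 0 by norm_num [oscPos], oscA_neg]
    simp [-Complex.coe_smul, oscIp_X, Complex.conj_ofNat, oscIp_smul_left, oscIp_smul_right,
      oscIp_add_left, oscIp_add_right, oscPos]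
    ring)
  (by
    -- Here `L (-2)` sends the vacuum to $zX_1+\frac12X_0^2$, of square norm $2z^2+\frac12$.
    have h1 : oscA 1 (z : ℂ) (-1) = 0 := by
      rw [oscA, if_neg (by norm_num), if_neg (by norm_num)]
    rw [vir_neg_two_one, oscA_zero, h1, show (-2 : ℤ) = -oscPos 1 0 by norm_num [oscPos],
      show (-4 : ℤ) = -oscPos 1 1 by norm_num [oscPos], oscA_neg, oscA_neg]
    simp [-Complex.coe_smul, oscIp_X, oscIp_zero_right, Complex.conj_ofNat, oscIp_smul_left,
      oscIp_smul_right, oscIp_add_left, oscIp_add_right, oscIp_X_mul, oscPos]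
    ring)

namespace UnitaryVir

variable {V V' : Type*} [AddCommGroup V] [Module ℂ V] [AddCommGroup V'] [Module ℂ V']
  (U : UnitaryVir V) (U' : UnitaryVir V')

lemma ip_add_left (x y z : V) : U.ip (x + y) z = U.ip x z + U.ip y z := by
  rw [← U.ip_conj, U.ip_add, map_add, U.ip_conj, U.ip_conj]

lemma ip_smul_left (c : ℂ) (x y : V) : U.ip (c • x) y = conj c * U.ip x y := by
  rw [← U.ip_conj, U.ip_smul, map_mul, U.ip_conj]

lemma ip_zero (x : V) : U.ip x 0 = 0 := by
  rw [← zero_smul ℂ (0 : V), U.ip_smul, zero_mul]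

lemma zero_ip (x : V) : U.ip 0 x = 0 := by
  rw [← U.ip_conj, U.ip_zero, map_zero]

/-- `v` is a (possibly zero) singular vector of weight `h`. -/
def IsSing (h : ℂ) (v : V) : Prop := (∀ n : ℤ, 0 < n → U.L n v = 0) ∧ U.L 0 v = h • v

/-- The operator `L (-(k₁+1)) ⋯ L (-(kₗ+1))`. -/
def word (w : List ℕ) : Module.End ℂ V := (w.map fun k : ℕ => U.L (-((k : ℤ) + 1))).prod

/-- The degree of a word. -/
def _root_.VirFock.wordDeg (w : List ℕ) : ℕ := (w.map fun k => k + 1).sum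

lemma word_nil : U.word [] = 1 := rfl

lemma word_cons (k : ℕ) (w : List ℕ) : U.word (k :: w) = U.L (-((k : ℤ) + 1)) * U.word w := by
  simp [word]

lemma L_zero_mul (n : ℤ) : U.L 0 * U.L n = U.L n * U.L 0 + (-n : ℂ) • U.L n := by
  by_cases h : n = 0
  · subst h; simp
  · have := U.comm 0 n (by rwa [zero_add])
    rw [sub_eq_iff_eq_add, zero_add] at this
    rw [this]; push_cast; module

lemma L_zero_word {h : ℂ} {v : V} (hv : U.L 0 v = h • v) (w : List ℕ) :
    U.L 0 (U.word w v) = (h + wordDeg w) • U.word w v := by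
  induction w with
  | nil => simpa [word, wordDeg] using hv
  | cons k w ih =>
    rw [word_cons, Module.End.mul_apply, ← Module.End.mul_apply, L_zero_mul, LinearMap.add_apply,
      Module.End.mul_apply, ih, LinearMap.smul_apply, map_smul, ← add_smul]
    congr 1
    simp only [wordDeg, List.map_cons, List.sum_cons]
    push_cast
    ring

lemma L_word_cons {n : ℤ} {k : ℕ} (hn : n - (k + 1) ≠ 0) (w : List ℕ) (u : V) :
    U.L n (U.word (k :: w) u) = U.L (-((k : ℤ) + 1)) (U.L n (U.word w u)) +
      ((n : ℂ) + (k + 1)) • U.L (n - (k + 1)) (U.word w u) := by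
  have := congrArg (fun S : Module.End ℂ V => S (U.word w u))
    (U.comm n (-((k : ℤ) + 1)) (by rwa [← sub_eq_add_neg]))
  simp only [LinearMap.sub_apply, Module.End.mul_apply, LinearMap.smul_apply] at this
  rw [sub_eq_iff_eq_add, ← sub_eq_add_neg] at this
  rw [word_cons, Module.End.mul_apply, this, add_comm]
  push_cast
  rw [sub_neg_eq_add]

lemma L_one_word_cons (w : List ℕ) (u : V) : U.L 1 (U.word (0 :: w) u) =
    U.L (-(((0 : ℕ) : ℤ) + 1)) (U.L 1 (U.word w u)) + (2 : ℂ) • U.L 0 (U.word w u) := by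
  have := congrArg (fun S : Module.End ℂ V => S (U.word w u)) U.comm_one
  simp only [LinearMap.sub_apply, Module.End.mul_apply, LinearMap.smul_apply] at this
  rw [sub_eq_iff_eq_add'] at this
  exact this

lemma L_two_word_cons (w : List ℕ) (u : V) : U.L 2 (U.word (1 :: w) u) =
    U.L (-(((1 : ℕ) : ℤ) + 1)) (U.L 2 (U.word w u)) +
      ((4 : ℂ) • U.L 0 (U.word w u) + (1 / 2 : ℂ) • U.word w u) := by
  have := congrArg (fun S : Module.End ℂ V => S (U.word w u)) U.comm_two
  simp only [LinearMap.sub_apply, Module.End.mul_apply, LinearMap.smul_apply,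
    LinearMap.add_apply, Module.End.one_apply] at this
  rw [sub_eq_iff_eq_add'] at this
  exact this

/-- All positive modes arise from `L 1` and `L 2` by commutators, so the central term is needed only
in degrees one and two. -/
lemma L_succ_apply {n : ℕ} (hn : 0 < n) (u : V) :
    U.L ((n + 1 : ℕ) + 1) u = (n : ℂ)⁻¹ • (U.L (n + 1) (U.L 1 u) - U.L 1 (U.L (n + 1) u)) := by
  have h0 : (n : ℂ) ≠ 0 := by exact_mod_cast hn.ne'
  have := congrArg (fun S : Module.End ℂ V => S u) (U.comm (n + 1) 1 (by omega))
  simp only [LinearMap.sub_apply, Module.End.mul_apply, LinearMap.smul_apply] at this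
  rw [this, smul_smul]
  push_cast
  rw [add_sub_cancel_right, inv_mul_cancel₀ h0, one_smul]

/-- The span of the pairs of vectors obtained by applying a word to the pairs `(v i, v' i)`. -/
def pairSpan {ι : Type*} (v : ι → V) (v' : ι → V') : Submodule ℂ (V × V') :=
  Submodule.span ℂ {x | ∃ i w, x = (U.word w (v i), U'.word w (v' i))}

/-! ### Comparison of two modules through equal words in their singular vectors. -/

section Pair

variable {ι : Type*} {v : ι → V} {v' : ι → V'}

lemma mem_pairSpan (i : ι) (w : List ℕ) :
    (U.word w (v i), U'.word w (v' i)) ∈ U.pairSpan U' v v' :=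
  Submodule.subset_span ⟨i, w, rfl⟩

lemma pairSpan_stable_of_words {n : ℤ}
    (h : ∀ i w, (U.L n (U.word w (v i)), U'.L n (U'.word w (v' i))) ∈ U.pairSpan U' v v')
    {x : V × V'} (hx : x ∈ U.pairSpan U' v v') :
    (U.L n x.1, U'.L n x.2) ∈ U.pairSpan U' v v' := by
  have : U.pairSpan U' v v' ≤
      (U.pairSpan U' v v').comap (LinearMap.prodMap (U.L n) (U'.L n)) := by
    refine Submodule.span_le.2 ?_
    rintro _ ⟨i, w, rfl⟩
    exact h i w
  exact this hx

lemma pairSpan_neg (k : ℕ) {x : V × V'} (hx : x ∈ U.pairSpan U' v v') :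
    (U.L (-((k : ℤ) + 1)) x.1, U'.L (-((k : ℤ) + 1)) x.2) ∈ U.pairSpan U' v v' := by
  refine U.pairSpan_stable_of_words U' (fun i w => ?_) hx
  have := U.mem_pairSpan U' (v := v) (v' := v') i (k :: w)
  rwa [word_cons, word_cons] at this

variable {h : ι → ℂ} (hv : ∀ i, U.IsSing (h i) (v i)) (hv' : ∀ i, U'.IsSing (h i) (v' i))

include hv hv'

/-- Moving `L 1` or `L 2` to the right through a word uses only relations whose coefficients are the
same in both modules, and the singular vectors have equal weights. The result is thus the same
combination of words on both sides. The terms of degree zero are scalars by `L_zero_word`, and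
negative modes merely lengthen a word. -/
lemma pairSpan_small (i : ι) (w : List ℕ) :
    (U.L 0 (U.word w (v i)), U'.L 0 (U'.word w (v' i))) ∈ U.pairSpan U' v v' ∧
    (U.L 1 (U.word w (v i)), U'.L 1 (U'.word w (v' i))) ∈ U.pairSpan U' v v' ∧
    (U.L 2 (U.word w (v i)), U'.L 2 (U'.word w (v' i))) ∈ U.pairSpan U' v v' := by
  have h0 : ∀ w, (U.L 0 (U.word w (v i)), U'.L 0 (U'.word w (v' i))) ∈ U.pairSpan U' v v' := by
    intro w
    rw [U.L_zero_word (hv i).2, U'.L_zero_word (hv' i).2]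
    exact Submodule.smul_mem _ (h i + wordDeg w) (U.mem_pairSpan U' i w)
  refine ⟨h0 w, ?_⟩
  induction w with
  | nil =>
    simp only [word_nil, Module.End.one_apply, (hv i).1 1 one_pos, (hv' i).1 1 one_pos,
      (hv i).1 2 two_pos, (hv' i).1 2 two_pos]
    exact ⟨zero_mem _, zero_mem _⟩
  | cons k w ih =>
    have hm := U.mem_pairSpan U' (v := v) (v' := v') i w
    have step : ∀ n : ℤ, n - (k + 1) ≠ 0 →
        (U.L n (U.word w (v i)), U'.L n (U'.word w (v' i))) ∈ U.pairSpan U' v v' →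
        (U.L (n - (k + 1)) (U.word w (v i)), U'.L (n - (k + 1)) (U'.word w (v' i))) ∈
          U.pairSpan U' v v' →
        (U.L n (U.word (k :: w) (v i)), U'.L n (U'.word (k :: w) (v' i))) ∈
          U.pairSpan U' v v' := by
      intro n hn h1 h2
      rw [U.L_word_cons hn, U'.L_word_cons hn]
      exact add_mem (U.pairSpan_neg U' k h1) (Submodule.smul_mem _ ((n : ℂ) + (k + 1)) h2)
    have hneg : ∀ n : ℤ, n < 0 →
        (U.L n (U.word w (v i)), U'.L n (U'.word w (v' i))) ∈ U.pairSpan U' v v' := by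
      intro n hn
      have := U.pairSpan_neg U' (-n - 1).toNat hm
      rwa [show -(((-n - 1).toNat : ℤ) + 1) = n by omega] at this
    constructor
    · rcases Nat.eq_zero_or_pos k with rfl | hk
      · rw [U.L_one_word_cons, U'.L_one_word_cons]
        exact add_mem (U.pairSpan_neg U' 0 ih.1) (Submodule.smul_mem _ (2 : ℂ) (h0 w))
      · exact step 1 (by omega) ih.1 (hneg _ (by omega))
    · rcases lt_trichotomy k 1 with hk | rfl | hk
      · obtain rfl : k = 0 := by omega
        exact step 2 (by norm_num) ih.2 (by convert ih.1 using 3 <;> norm_num)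
      · rw [U.L_two_word_cons, U'.L_two_word_cons]
        exact add_mem (U.pairSpan_neg U' 1 ih.2)
          (add_mem (Submodule.smul_mem _ (4 : ℂ) (h0 w)) (Submodule.smul_mem _ (1 / 2 : ℂ) hm))
      · exact step 2 (by omega) ih.2 (hneg _ (by omega))

lemma pairSpan_pos (n : ℕ) {x : V × V'} (hx : x ∈ U.pairSpan U' v v') :
    (U.L (n + 1) x.1, U'.L (n + 1) x.2) ∈ U.pairSpan U' v v' := by
  have h1 : ∀ {x : V × V'}, x ∈ U.pairSpan U' v v' →
      (U.L 1 x.1, U'.L 1 x.2) ∈ U.pairSpan U' v v' := fun hx =>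
    U.pairSpan_stable_of_words U' (fun i w => (U.pairSpan_small U' hv hv' i w).2.1) hx
  induction n generalizing x with
  | zero => simpa using h1 hx
  | succ n ih =>
    rcases Nat.eq_zero_or_pos n with rfl | hn
    · simpa [one_add_one_eq_two] using
        U.pairSpan_stable_of_words U' (fun i w => (U.pairSpan_small U' hv hv' i w).2.2) hx
    · rw [U.L_succ_apply hn, U'.L_succ_apply hn]
      exact Submodule.smul_mem _ (n : ℂ)⁻¹ (sub_mem (ih (h1 hx)) (h1 (ih hx)))

/-- Pairs of vectors obtained in the same way from singular vectors of the same weights have the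
same inner products. -/
lemma pairSpan_ip (hip : ∀ i j, U.ip (v i) (v j) = U'.ip (v' i) (v' j)) {x y : V × V'}
    (hx : x ∈ U.pairSpan U' v v') (hy : y ∈ U.pairSpan U' v v') :
    U.ip x.1 y.1 = U'.ip x.2 y.2 := by
  induction hx using Submodule.span_induction generalizing y with
  | zero => simp only [Prod.fst_zero, Prod.snd_zero, zero_ip]
  | add a b _ _ ha hb =>
    simp only [Prod.fst_add, Prod.snd_add, ip_add_left]
    rw [ha hy, hb hy]
  | smul c a _ ha =>
    simp only [Prod.smul_fst, Prod.smul_snd, ip_smul_left]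
    rw [ha hy]
  | mem x hx =>
    obtain ⟨i, w, rfl⟩ := hx
    -- The letters of `x` are moved to `y` by adjunction; there they become positive modes, which
    -- preserve `pairSpan`. Hence the generalization over `y`.
    induction w generalizing y with
    | nil =>
      induction hy using Submodule.span_induction with
      | zero => simp only [Prod.fst_zero, Prod.snd_zero, ip_zero]
      | add a b _ _ ha hb =>
        simp only [Prod.fst_add, Prod.snd_add, ip_add]
        rw [ha, hb]
      | smul c a _ ha =>
        simp only [Prod.smul_fst, Prod.smul_snd, ip_smul]
        rw [ha]
      | mem y hy =>
        obtain ⟨j, w, rfl⟩ := hy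
        cases w with
        | nil => exact hip i j
        | cons k w =>
          simp only [word_nil, Module.End.one_apply, word_cons, Module.End.mul_apply]
          -- A proper descendant is orthogonal to a singular vector in either module, so both sides
          -- vanish.
          rw [← U.ip_L, ← U'.ip_L, (hv i).1 _ (by omega), (hv' i).1 _ (by omega), zero_ip, zero_ip]
    | cons k w ih =>
      simp only [word_cons, Module.End.mul_apply, ip_L, neg_neg]
      exact ih (U.pairSpan_pos U' hv hv' k hy)

/-- If the eigenspace of `L 0` in the second module is spanned by descendants of the singular vectors,
and the eigenspace in the first module is not larger, then it is spanned by descendants, too. -/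
lemma eigenspace_le_span (hip : ∀ i j, U.ip (v i) (v j) = U'.ip (v' i) (v' j)) (c : ℂ)
    [FiniteDimensional ℂ (Module.End.eigenspace (U.L 0) c)]
    [FiniteDimensional ℂ (Module.End.eigenspace (U'.L 0) c)]
    (hdim : Module.finrank ℂ (Module.End.eigenspace (U.L 0) c) ≤
      Module.finrank ℂ (Module.End.eigenspace (U'.L 0) c))
    (hspan : Module.End.eigenspace (U'.L 0) c ≤
      Submodule.span ℂ {x | ∃ i w, h i + wordDeg w = c ∧ x = U'.word w (v' i)}) :
    Module.End.eigenspace (U.L 0) c ≤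
      Submodule.span ℂ {x | ∃ i w, h i + wordDeg w = c ∧ x = U.word w (v i)} := by
  set M : Submodule ℂ (V × V') := Submodule.span ℂ
    {x | ∃ i w, h i + wordDeg w = c ∧ x = (U.word w (v i), U'.word w (v' i))} with hM
  have hMN : M ≤ U.pairSpan U' v v' := Submodule.span_mono fun x ⟨i, w, _, hx⟩ => ⟨i, w, hx⟩
  have h1 : M.map (LinearMap.fst ℂ V V') =
      Submodule.span ℂ {x | ∃ i w, h i + wordDeg w = c ∧ x = U.word w (v i)} := by
    rw [hM, Submodule.map_span]
    congr 1
    ext x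
    constructor
    · rintro ⟨_, ⟨i, w, hw, rfl⟩, rfl⟩
      exact ⟨i, w, hw, rfl⟩
    · rintro ⟨i, w, hw, rfl⟩
      exact ⟨_, ⟨i, w, hw, rfl⟩, rfl⟩
  have h2 : M.map (LinearMap.snd ℂ V V') =
      Submodule.span ℂ {x | ∃ i w, h i + wordDeg w = c ∧ x = U'.word w (v' i)} := by
    rw [hM, Submodule.map_span]
    congr 1
    ext x
    constructor
    · rintro ⟨_, ⟨i, w, hw, rfl⟩, rfl⟩
      exact ⟨i, w, hw, rfl⟩
    · rintro ⟨i, w, hw, rfl⟩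
      exact ⟨_, ⟨i, w, hw, rfl⟩, rfl⟩
  have e1 : M.map (LinearMap.fst ℂ V V') ≤ Module.End.eigenspace (U.L 0) c := by
    rw [h1, Submodule.span_le]
    rintro _ ⟨i, w, hw, rfl⟩
    rw [SetLike.mem_coe, Module.End.mem_eigenspace_iff, U.L_zero_word (hv i).2, hw]
  have e2 : M.map (LinearMap.snd ℂ V V') ≤ Module.End.eigenspace (U'.L 0) c := by
    rw [h2, Submodule.span_le]
    rintro _ ⟨i, w, hw, rfl⟩
    rw [SetLike.mem_coe, Module.End.mem_eigenspace_iff, U'.L_zero_word (hv' i).2, hw]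
  -- Both coordinates of an element of `M` have the same norm. By definiteness one vanishes when the
  -- other does, so `M` is the graph of an isomorphism.
  have i1 : Function.Injective ((LinearMap.fst ℂ V V').domRestrict M) := by
    rw [injective_iff_map_eq_zero]
    rintro ⟨x, hx⟩ h0
    have h0 : x.1 = 0 := h0
    have := U.pairSpan_ip U' hv hv' hip (hMN hx) (hMN hx)
    rw [h0, zero_ip] at this
    exact Subtype.ext (Prod.ext h0 (U'.ip_definite _ this.symm))
  have i2 : Function.Injective ((LinearMap.snd ℂ V V').domRestrict M) := by
    rw [injective_iff_map_eq_zero]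
    rintro ⟨x, hx⟩ h0
    have h0 : x.2 = 0 := h0
    have := U.pairSpan_ip U' hv hv' hip (hMN hx) (hMN hx)
    rw [h0, zero_ip] at this
    exact Subtype.ext (Prod.ext (U.ip_definite _ this) h0)
  have d1 := LinearMap.finrank_range_of_inj i1
  have d2 := LinearMap.finrank_range_of_inj i2
  rw [LinearMap.range_domRestrict] at d1 d2
  rw [← h1]
  -- The two projections of `M` have equal dimension, and the second contains the whole eigenspace
  -- of the second module, which is at least as large as that of the first.
  refine (Submodule.eq_of_le_of_finrank_le e1 ?_).ge
  rw [d1, ← d2, h2]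
  have : FiniteDimensional ℂ (Submodule.span ℂ
      {x | ∃ i w, h i + wordDeg w = c ∧ x = U'.word w (v' i)}) := by
    rw [← h2]; exact Submodule.finiteDimensional_of_le e2
  exact hdim.trans (Submodule.finrank_mono hspan)

end Pair

/-- If the eigenspace of `L 0` is spanned by descendants of orthonormal singular vectors of different
weights, then the singular vectors in it are multiples of the given one. -/
lemma IsSing.mem_span {ι : Type*} {v : ι → V} {h : ι → ℂ}
    (hn : ∀ i, U.ip (v i) (v i) = 1) (hinj : Function.Injective h) {c : ℂ}
    (hv : ∀ i, U.IsSing (h i) (v i))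
    (hspan : Module.End.eigenspace (U.L 0) c ≤
      Submodule.span ℂ {x | ∃ i w, h i + wordDeg w = c ∧ x = U.word w (v i)})
    {f : V} (hf : U.IsSing c f) (hf0 : f ≠ 0) : ∃ i, h i = c ∧ ∃ a : ℂ, f = a • v i := by
  -- A singular vector is orthogonal to all proper descendants. If it is also orthogonal to the
  -- given singular vectors of its weight, it is orthogonal to the spanning set of its own
  -- eigenspace, hence to itself.
  have key : ∀ g : V, U.IsSing c g → (∀ i, h i = c → U.ip (v i) g = 0) → g = 0 := by
    intro g hg hi
    have horth : ∀ y ∈ Submodule.span ℂ {x | ∃ i w, h i + wordDeg w = c ∧ x = U.word w (v i)},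
        U.ip y g = 0 := by
      intro y hy
      induction hy using Submodule.span_induction with
      | zero => exact U.zero_ip g
      | add a b _ _ ha hb => rw [U.ip_add_left, ha, hb, add_zero]
      | smul c a _ ha => rw [U.ip_smul_left, ha, mul_zero]
      | mem y hy =>
        obtain ⟨i, w, hw, rfl⟩ := hy
        cases w with
        | nil => exact hi i (by simpa [wordDeg] using hw)
        | cons k w =>
          rw [word_cons, Module.End.mul_apply, U.ip_L, neg_neg, hg.1 _ (by omega), U.ip_zero]
    exact U.ip_definite g (horth g (hspan (Module.End.mem_eigenspace_iff.2 hg.2)))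
  by_cases hex : ∃ i, h i = c
  · obtain ⟨i, hi⟩ := hex
    refine ⟨i, hi, U.ip (v i) f, ?_⟩
    have := key (f - U.ip (v i) f • v i) ⟨fun n hn => ?_, ?_⟩ fun j hj => ?_
    · rwa [sub_eq_zero] at this
    · rw [map_sub, map_smul, hf.1 n hn, (hv i).1 n hn, smul_zero, sub_zero]
    · rw [map_sub, map_smul, hf.2, (hv i).2, hi, smul_sub, smul_comm]
    · rw [hinj (hj.trans hi.symm), sub_eq_add_neg, ← neg_smul, U.ip_add, U.ip_smul, hn]
      ring
  · exact absurd (key f hf fun i hi => absurd ⟨i, hi⟩ hex) hf0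

end UnitaryVir

/-! ### Diagonal operators -/

section Diagonal

variable {I V : Type*} [AddCommGroup V] [Module ℂ V] (b : Module.Basis I ℂ V)
  {T : Module.End ℂ V} {ev : I → ℂ} (hT : ∀ i, T (b i) = ev i • b i)

include hT

lemma eigenspace_eq_span (c : ℂ) :
    Module.End.eigenspace T c = Submodule.span ℂ (b '' {i | ev i = c}) := by
  apply le_antisymm
  · intro v hv
    rw [b.mem_span_image]
    intro i hi
    have hrepr : ∀ i, b.repr (T v) i = ev i * b.repr v i := by
      intro i
      have : (Finsupp.lapply i ∘ₗ b.repr.toLinearMap) ∘ₗ T =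
          ev i • (Finsupp.lapply i ∘ₗ b.repr.toLinearMap) := by
        refine b.ext fun j => ?_
        simp only [LinearMap.comp_apply, hT, map_smul, LinearMap.smul_apply,
          LinearEquiv.coe_coe, Module.Basis.repr_self, Finsupp.lapply_apply, smul_eq_mul]
        by_cases hij : i = j
        · rw [hij]
        · rw [Finsupp.single_eq_of_ne hij, mul_zero, mul_zero]
      exact congrArg (fun S : V →ₗ[ℂ] ℂ => S v) this
    have h1 := hrepr i
    rw [Module.End.mem_eigenspace_iff.1 hv, map_smul, Finsupp.smul_apply, smul_eq_mul] at h1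
    exact (mul_right_cancel₀ (Finsupp.mem_support_iff.1 hi) h1).symm
  · rw [Submodule.span_le]
    rintro _ ⟨i, hi, rfl⟩
    rw [SetLike.mem_coe, Module.End.mem_eigenspace_iff, hT, hi]

lemma finrank_eigenspace_diagonal (c : ℂ) (hfin : {i | ev i = c}.Finite) :
    FiniteDimensional ℂ (Module.End.eigenspace T c) ∧
      Module.finrank ℂ (Module.End.eigenspace T c) = Nat.card {i | ev i = c} := by
  rw [eigenspace_eq_span b hT]
  refine ⟨FiniteDimensional.span_of_finite ℂ (hfin.image b), ?_⟩
  have : Fintype {i | ev i = c} := hfin.fintype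
  rw [Set.image_eq_range, Nat.card_eq_fintype_card]
  exact finrank_span_eq_card (b.linearIndependent.comp _ Subtype.val_injective)

/-- Composing a functional with this projection gives one that sees only the basis vectors of a
single eigenvalue, finitely many when the eigenspace is finite-dimensional. -/
lemma exists_eigenspace_projection (c : ℂ) : ∃ π : Module.End ℂ V,
    (∀ i, ev i ≠ c → π (b i) = 0) ∧ (∀ x, T x = c • x → π x = x) ∧
      ∀ μ x, μ ≠ c → T x = μ • x → π x = 0 := by
  classical
  refine ⟨b.constr ℂ fun i => if ev i = c then b i else 0, fun i hi => ?_, fun x hx => ?_,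
    fun μ x hμ hx => ?_⟩
  · rw [Module.Basis.constr_basis, if_neg hi]
  · rw [← Module.End.mem_eigenspace_iff, eigenspace_eq_span b hT] at hx
    induction hx using Submodule.span_induction with
    | zero => exact map_zero _
    | add x y _ _ hx hy => rw [map_add, hx, hy]
    | smul a x _ hx => rw [map_smul, hx]
    | mem x hx =>
      obtain ⟨i, hi, rfl⟩ := hx
      rw [Module.Basis.constr_basis]; exact if_pos hi
  · rw [← Module.End.mem_eigenspace_iff, eigenspace_eq_span b hT] at hx
    induction hx using Submodule.span_induction with
    | zero => exact map_zero _
    | add x y _ _ hx hy => rw [map_add, hx, hy, add_zero]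
    | smul a x _ hx => rw [map_smul, hx, smul_zero]
    | mem x hx =>
      obtain ⟨i, hi, rfl⟩ := hx
      rw [Module.Basis.constr_basis, if_neg]
      exact fun h => hμ (hi.symm.trans h)

end Diagonal

/-! ### The grading of the polynomial Fock modules -/

/-- The weight of a monomial: the `i`-th variable has weight `2 i + 1 + ε`. -/
def oscWt (ε : Fin 2) (s : ℕ →₀ ℕ) : ℕ := s.sum fun i c => c * (2 * i + 1 + (ε : ℕ))

lemma oscWt_add (ε : Fin 2) (s t : ℕ →₀ ℕ) : oscWt ε (s + t) = oscWt ε s + oscWt ε t :=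
  Finsupp.sum_add_index' (by simp) (by intros; ring)

lemma oscWt_single (ε : Fin 2) (i c : ℕ) :
    oscWt ε (Finsupp.single i c) = c * (2 * i + 1 + (ε : ℕ)) := by
  simp [oscWt]

lemma oscWt_finite (ε : Fin 2) (d : ℕ) : {s | oscWt ε s ≤ d}.Finite := by
  refine (Set.finite_Iic (∑ i ∈ Finset.range d, Finsupp.single i d)).subset fun s hs => ?_
  rw [Set.mem_Iic]
  intro i
  by_cases h0 : s i = 0
  · rw [h0]; exact Nat.zero_le _
  have h1 : s i * (2 * i + 1 + (ε : ℕ)) ≤ d :=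
    (Finset.single_le_sum (f := fun i => s i * (2 * i + 1 + (ε : ℕ)))
      (fun _ _ => Nat.zero_le _) (Finsupp.mem_support_iff.2 h0)).trans hs
  have h2 : 1 ≤ s i := Nat.one_le_iff_ne_zero.2 h0
  have h3 : 2 * i + 1 + (ε : ℕ) ≤ d := (Nat.le_mul_of_pos_left _ h2).trans h1
  have h4 : s i ≤ d := (Nat.le_mul_of_pos_right _ (by omega)).trans h1
  rw [Finsupp.finsetSum_apply, Finset.sum_eq_single i]
  · rwa [Finsupp.single_eq_same]
  · intro j _ hj
    exact Finsupp.single_eq_of_ne (Ne.symm hj)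
  · intro hi
    exact absurd (Finset.mem_range.2 (by omega)) hi

lemma vir_zero_X_mul (ε : Fin 2) (z κ : ℂ) (i : ℕ) (f : Pol) :
    (osc ε z).vir κ 0 (MvPolynomial.X i * f) = MvPolynomial.X i * (osc ε z).vir κ 0 f +
      ((oscPos ε i : ℂ) / 2) • (MvPolynomial.X i * f) := by
  have := congrArg (fun T : Module.End ℂ Pol => T f) ((osc ε z).vir_comm κ 0 (-oscPos ε i))
  simp only [LinearMap.sub_apply, Module.End.mul_apply, LinearMap.smul_apply, osc_a, mul_zero,
    add_zero, oscA_neg, LinearMap.mulLeft_apply] at this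
  rw [sub_eq_iff_eq_add'] at this
  rw [this]
  congr 2
  change -oscω ε (-oscPos ε i) = _
  rw [oscω_neg, neg_neg, oscω_pos]

lemma vir_zero_monomial_mul (ε : Fin 2) (z κ : ℂ) (s : ℕ →₀ ℕ) (f : Pol) :
    (osc ε z).vir κ 0 (MvPolynomial.monomial s 1 * f) =
      MvPolynomial.monomial s 1 * (osc ε z).vir κ 0 f +
      ((oscWt ε s : ℂ) / 2) • (MvPolynomial.monomial s 1 * f) := by
  induction s using Finsupp.induction_linear generalizing f with
  | zero => simp [oscWt]
  | add s t hs ht =>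
    rw [← one_mul (1 : ℂ), ← MvPolynomial.monomial_mul, mul_assoc, hs, ht, oscWt_add,
      mul_add, mul_smul_comm, mul_assoc, add_assoc, ← add_smul]
    push_cast
    congr 2
    ring
  | single i c =>
    rw [oscWt_single]
    induction c with
    | zero => simp
    | succ c ih =>
      rw [Finsupp.single_add, ← one_mul (1 : ℂ), ← MvPolynomial.monomial_mul]
      have hX : MvPolynomial.monomial (Finsupp.single i 1) (1 : ℂ) = MvPolynomial.X i := rfl
      rw [hX, mul_comm (MvPolynomial.monomial _ _), mul_assoc, vir_zero_X_mul, ih, mul_add,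
        mul_smul_comm, mul_assoc, add_assoc, ← add_smul]
      congr 2
      unfold oscPos
      push_cast
      ring

lemma vir_zero_monomial (ε : Fin 2) (z κ : ℂ) (s : ℕ →₀ ℕ) :
    (osc ε z).vir κ 0 (MvPolynomial.monomial s 1) =
      ((oscWt ε s : ℂ) / 2 + (z ^ 2 / 2 + κ)) • MvPolynomial.monomial s 1 := by
  have := vir_zero_monomial_mul ε z κ s 1
  rw [mul_one, vir_zero_one, mul_smul_comm, mul_one, ← add_smul, add_comm] at this
  exact this

/-! ### Irreducibility of the untwisted Fock modules -/

/-- The embedding of integer polynomials into the Fock module, with variables rescaled by `√2`. -/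
def intPol : MvPolynomial ℕ ℤ →+* Pol :=
  MvPolynomial.eval₂Hom (algebraMap ℤ Pol) fun i => ((Real.sqrt 2 : ℝ) : ℂ) • MvPolynomial.X i

lemma sqrt_two_mul_self : ((Real.sqrt 2 : ℝ) : ℂ) * ((Real.sqrt 2 : ℝ) : ℂ) = 2 := by
  rw [← Complex.ofReal_mul, Real.mul_self_sqrt (by norm_num)]
  norm_num

lemma sqrt_two_ne_zero : ((Real.sqrt 2 : ℝ) : ℂ) ≠ 0 := fun h => by
  have := sqrt_two_mul_self
  rw [h] at this
  norm_num at this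

lemma intPol_X (i : ℕ) :
    intPol (MvPolynomial.X i) = ((Real.sqrt 2 : ℝ) : ℂ) • MvPolynomial.X i := by
  simp [intPol]

lemma X_eq_intPol (i : ℕ) :
    (MvPolynomial.X i : Pol) = ((Real.sqrt 2 : ℝ) : ℂ)⁻¹ • intPol (MvPolynomial.X i) := by
  rw [intPol_X, smul_smul, inv_mul_cancel₀ sqrt_two_ne_zero, one_smul]

lemma intPol_C (a : ℤ) : intPol (MvPolynomial.C a) = (a : ℂ) • (1 : Pol) := by
  simp [intPol, Algebra.smul_def]

lemma pderiv_intPol (i : ℕ) (g : MvPolynomial ℕ ℤ) :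
    MvPolynomial.pderiv i (intPol g) =
      ((Real.sqrt 2 : ℝ) : ℂ) • intPol (MvPolynomial.pderiv i g) := by
  induction g using MvPolynomial.induction_on with
  | C a => rw [intPol_C, Derivation.map_smul]; simp
  | add f g hf hg => simp only [map_add, hf, hg, smul_add]
  | mul_X f j hf =>
    rw [map_mul, MvPolynomial.pderiv_mul, MvPolynomial.pderiv_mul, hf, map_add, map_mul, map_mul,
      intPol_X, Derivation.map_smul]
    by_cases hij : j = i
    · subst hij
      rw [MvPolynomial.pderiv_X_self, MvPolynomial.pderiv_X_self, map_one]
      simp only [mul_one, smul_mul_assoc, mul_smul_comm, smul_add]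
    · rw [MvPolynomial.pderiv_X_of_ne hij, MvPolynomial.pderiv_X_of_ne hij, map_zero]
      simp only [smul_zero, mul_zero, add_zero, smul_mul_assoc, mul_smul_comm]

lemma intPol_monomial (s : ℕ →₀ ℕ) : ∃ c : ℂ, c ≠ 0 ∧
    intPol (MvPolynomial.monomial s 1) = c • MvPolynomial.monomial s 1 := by
  induction s using Finsupp.induction_linear with
  | zero => exact ⟨1, one_ne_zero, by simp⟩
  | add s t hs ht =>
    obtain ⟨c, hc, h⟩ := hs
    obtain ⟨d, hd, h'⟩ := ht
    refine ⟨c * d, mul_ne_zero hc hd, ?_⟩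
    rw [← one_mul (1 : ℤ), ← MvPolynomial.monomial_mul, map_mul, h, h', smul_mul_smul_comm,
      MvPolynomial.monomial_mul, one_mul]
  | single i n =>
    refine ⟨((Real.sqrt 2 : ℝ) : ℂ) ^ n, pow_ne_zero _ sqrt_two_ne_zero, ?_⟩
    rw [← MvPolynomial.X_pow_eq_monomial, map_pow, intPol_X, smul_pow,
      MvPolynomial.X_pow_eq_monomial]

lemma two_eq_smul_one : (2 : Pol) = (2 : ℂ) • 1 := by
  rw [MvPolynomial.smul_eq_C_mul, mul_one, map_ofNat]

/-- The square of a variable that appears in `4 L (-(k+1))` modulo `2`. -/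
def sqTerm (k : ℕ) : MvPolynomial ℕ ℤ := if k % 2 = 1 then MvPolynomial.X ((k - 1) / 2) ^ 2 else 0

/-- Twice the integral polynomials. -/
def evenPol : AddSubgroup Pol := (AddMonoidHom.range (intPol : MvPolynomial ℕ ℤ →+ Pol)).map
  (AddMonoidHom.mulLeft (2 : Pol))

lemma mem_evenPol {f : Pol} : f ∈ evenPol ↔ ∃ g, f = intPol (2 * g) := by
  constructor
  · rintro ⟨_, ⟨g, rfl⟩, rfl⟩
    exact ⟨g, by rw [map_mul, map_ofNat]; rfl⟩
  · rintro ⟨g, rfl⟩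
    exact ⟨_, ⟨g, rfl⟩, by rw [map_mul, map_ofNat]; rfl⟩

lemma finsum_mem_of_forall_mem {M : Type*} [AddCommGroup M] (G : AddSubgroup M) {f : ℤ → M}
    (h : ∀ p, f p ∈ G) : ∑ᶠ p, f p ∈ G :=
  finsum_induction (· ∈ G) G.zero_mem (fun _ _ => G.add_mem) h

/-- A symmetric sum is determined by one half. -/
lemma finsum_symm {M : Type*} [AddCommGroup M] {f : ℤ → M} (n : ℤ)
    (hf : (Function.support f).Finite) (h : ∀ p, f (-2 * n - p) = f p) :
    ∑ᶠ p, f p = f (-n) + (2 : ℕ) • ∑ᶠ p, if -n < p then f p else 0 := by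
  have h1 : ∀ p, f p = (if p = -n then f (-n) else 0) +
      ((if -n < p then f p else 0) + if p < -n then f p else 0) := by
    intro p
    rcases lt_trichotomy p (-n) with hp | hp | hp
    · rw [if_neg hp.ne, if_neg (by omega), if_pos hp]; abel
    · rw [if_pos hp, if_neg (by omega), if_neg (by omega), hp]; abel
    · rw [if_neg hp.ne', if_pos hp, if_neg (by omega)]; abel
  have f2 : (Function.support fun p => if -n < p then f p else 0).Finite :=
    hf.subset fun p hp hc => hp (by simp only [hc, ite_self])
  have f3 : (Function.support fun p => if p < -n then f p else 0).Finite :=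
    hf.subset fun p hp hc => hp (by simp only [hc, ite_self])
  have f1 : (Function.support fun p => if p = -n then f (-n) else 0).Finite :=
    (Set.finite_singleton (-n)).subset fun p hp => by
      by_contra hc; exact hp (if_neg hc)
  have e3 : (∑ᶠ p, if p < -n then f p else 0) = ∑ᶠ p, if -n < p then f p else 0 := by
    rw [← finsum_comp_equiv (Equiv.subLeft (-2 * n))]
    refine finsum_congr fun p => ?_
    simp only [Equiv.subLeft_apply, h]
    congr 1
    exact propext ⟨fun _ => by omega, fun _ => by omega⟩
  have f23 : (Function.support fun p =>
      (if -n < p then f p else 0) + if p < -n then f p else 0).Finite :=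
    hf.subset fun p hp hc => hp (by simp only [hc, ite_self, add_zero])
  rw [finsum_congr h1, finsum_add_distrib f1 f23, finsum_add_distrib f2 f3, e3,
    finsum_eq_single _ (-n) fun p hp => if_neg hp, if_pos rfl, two_smul]

/-- The sum is folded at its middle index `-(k + 1)`. On the remaining half the written order of the
two factors is the normal one, and the doubling cancels the factor one half. -/
lemma vir_neg_apply (z : ℂ) (k : ℕ) (f : Pol) :
    (4 : ℂ) • (osc 1 z).vir 0 (-((k : ℤ) + 1)) f =
      (2 : ℂ) • oscA 1 z (-((k : ℤ) + 1)) (oscA 1 z (-((k : ℤ) + 1)) f) +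
      ∑ᶠ p : ℤ, (4 : ℂ) • (if -((k : ℤ) + 1) < p then
        oscA 1 z (-2 * ((k : ℤ) + 1) - p) (oscA 1 z p f) else 0) := by
  have hfin := (osc 1 z).no_finite (-((k : ℤ) + 1)) f
  have hsymm : ∀ p : ℤ, (osc 1 z).no (2 * (-((k : ℤ) + 1)) - (-2 * ((k : ℤ) + 1) - p))
      (-2 * ((k : ℤ) + 1) - p) f = (osc 1 z).no (2 * (-((k : ℤ) + 1)) - p) p f := by
    intro p
    rw [Oscillators.no_symm]
    (congr 2; ring)
  have h2 : (Function.support fun p : ℤ => if -((k : ℤ) + 1) < p then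
        oscA 1 z (-2 * ((k : ℤ) + 1) - p) (oscA 1 z p f) else 0).Finite := by
    refine hfin.subset fun p hp hc => hp ?_
    by_cases hlt : -((k : ℤ) + 1) < p
    · simp only [if_pos hlt]
      simp only [Oscillators.no] at hc
      rw [if_pos (by omega), Module.End.mul_apply] at hc
      rw [← hc, osc_a, osc_a]
      congr 2
    · simp only [if_neg hlt]
  rw [← smul_finsum' _ h2, Oscillators.vir, LinearMap.add_apply, Oscillators.sug_apply,
    finsum_symm ((k : ℤ) + 1) hfin hsymm, if_neg (by omega), zero_smul, LinearMap.zero_apply,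
    add_zero, smul_smul, smul_add, ← Nat.cast_smul_eq_nsmul ℂ, smul_smul]
  congr 1
  · rw [Oscillators.no, if_pos (by omega), Module.End.mul_apply,
      show 2 * (-((k : ℤ) + 1)) - -((k : ℤ) + 1) = -((k : ℤ) + 1) by ring]
    norm_num [osc_a]
  · congr 1
    · norm_num
    · refine finsum_congr fun p => ?_
      by_cases hlt : -((k : ℤ) + 1) < p
      · rw [if_pos hlt, if_pos hlt, Oscillators.no, if_pos (by omega), Module.End.mul_apply]
        simp only [osc_a]
        congr 2
      · rw [if_neg hlt, if_neg hlt]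

/-- Modulo `2` only two terms of the sum survive on integral polynomials: the zero mode term, whose
coefficient is the odd number `b`, and the square in the middle. -/
lemma vir_neg_intPol {z : ℂ} {b : ℤ} (hb : b % 2 = 1)
    (hz : z * ((Real.sqrt 2 : ℝ) : ℂ) * 2 = b) (k : ℕ) (g : MvPolynomial ℕ ℤ) :
    ∃ g', (4 : ℂ) • (osc 1 z).vir 0 (-((k : ℤ) + 1)) (intPol g) =
      intPol (MvPolynomial.X k * g + sqTerm k * g + 2 * g') := by
  -- For `p > 0` the factors `√2` from the variable and from the derivative cancel, and the
  -- coefficient keeps a factor `4`. For `p < 0` two rescaled variables turn `4` into `2`.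
  have hzero : ∀ p : ℤ, p ≠ 0 → (4 : ℂ) • (if -((k : ℤ) + 1) < p then
      oscA 1 z (-2 * ((k : ℤ) + 1) - p) (oscA 1 z p (intPol g)) else 0) ∈ evenPol := by
    intro p hp0
    by_cases hlt : -((k : ℤ) + 1) < p
    · rw [if_pos hlt]
      rcases osc_cases 1 p with rfl | ⟨j, rfl⟩ | ⟨j, rfl⟩ | ⟨-, h'⟩
      · exact absurd rfl hp0
      · have hi : -2 * ((k : ℤ) + 1) - oscPos 1 j = -oscPos 1 (k + j + 1) := by
          simp only [oscPos, Fin.val_one]; push_cast; ring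
        rw [hi, oscA_neg, oscA_pos, mem_evenPol]
        obtain ⟨a, ha⟩ : ∃ a : ℤ, a = 2 * ((j : ℤ) + 1) := ⟨_, rfl⟩
        refine ⟨MvPolynomial.C a * (MvPolynomial.X (k + j + 1) *
          MvPolynomial.pderiv j g), ?_⟩
        simp only [LinearMap.smul_apply, LinearMap.mulLeft_apply, Derivation.coeFn_coe,
          pderiv_intPol, map_mul, intPol_C, X_eq_intPol (k + j + 1), map_ofNat, oscPos,
          Fin.val_one, smul_mul_assoc, mul_smul_comm, smul_smul, one_mul]
        rw [two_eq_smul_one, smul_mul_assoc, one_mul, smul_smul]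
        congr 1
        have := sqrt_two_ne_zero
        field_simp
        rw [ha]
        push_cast
        ring
      · obtain ⟨i, hi⟩ : ∃ i : ℕ, k = i + j + 1 := ⟨k - j - 1, by
          simp only [oscPos, Fin.val_one] at hlt; omega⟩
        have hi : -2 * ((k : ℤ) + 1) - -oscPos 1 j = -oscPos 1 i := by
          simp only [oscPos, Fin.val_one, hi]; push_cast; ring
        rw [hi, oscA_neg, oscA_neg, mem_evenPol]
        refine ⟨MvPolynomial.X i * (MvPolynomial.X j * g), ?_⟩
        simp only [LinearMap.mulLeft_apply, map_mul, X_eq_intPol i, X_eq_intPol j, map_ofNat,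
          smul_mul_assoc, mul_smul_comm, smul_smul]
        rw [two_eq_smul_one, smul_mul_assoc, one_mul]
        congr 1
        have h3 := sqrt_two_mul_self
        have := sqrt_two_ne_zero
        field_simp
        rw [pow_two, h3]
        norm_num
      · rw [h', LinearMap.zero_apply, map_zero, smul_zero]
        exact zero_mem _
    · rw [if_neg hlt, smul_zero]
      exact zero_mem _
  have hsq : (2 : ℂ) • oscA 1 z (-((k : ℤ) + 1)) (oscA 1 z (-((k : ℤ) + 1)) (intPol g)) =
      intPol (sqTerm k * g) := by
    unfold sqTerm
    by_cases hk : k % 2 = 1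
    · rw [if_pos hk]
      obtain ⟨m, hm⟩ : ∃ m : ℕ, k = 2 * m + 1 := ⟨k / 2, by omega⟩
      have h1 : -((k : ℤ) + 1) = -oscPos 1 m := by
        simp only [oscPos, Fin.val_one, hm]; push_cast; ring
      rw [h1, oscA_neg, show (k - 1) / 2 = m by omega, map_mul, map_pow, intPol_X, smul_pow,
        pow_two, sqrt_two_mul_self, LinearMap.mulLeft_apply, LinearMap.mulLeft_apply,
        smul_mul_assoc, pow_two, mul_assoc]
    · rw [if_neg hk, zero_mul, map_zero]
      have h1 : oscA 1 z (-((k : ℤ) + 1)) = 0 := by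
        rw [oscA, if_neg (by omega), if_neg (by simp only [Fin.val_one]; omega)]
      rw [h1, LinearMap.zero_apply, smul_zero]
  have hfin : (Function.support fun p : ℤ => (4 : ℂ) • (if -((k : ℤ) + 1) < p then
      oscA 1 z (-2 * ((k : ℤ) + 1) - p) (oscA 1 z p (intPol g)) else 0)).Finite := by
    obtain ⟨c, hc⟩ := oscA_fin 1 z (intPol g)
    refine (Set.finite_Icc (-((k : ℤ) + 1)) c).subset fun p hp => ?_
    rw [Set.mem_Icc]
    by_contra hcon
    rw [not_and_or] at hcon
    apply hp
    by_cases hlt : -((k : ℤ) + 1) < p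
    · simp only [if_pos hlt, hc p (by omega), map_zero, smul_zero]
    · simp only [if_neg hlt, smul_zero]
  have hrest : ∑ᶠ (p : ℤ) (_ : p ≠ 0), (4 : ℂ) • (if -((k : ℤ) + 1) < p then
      oscA 1 z (-2 * ((k : ℤ) + 1) - p) (oscA 1 z p (intPol g)) else 0) ∈ evenPol :=
    finsum_mem_of_forall_mem _ fun p =>
      finsum_induction (· ∈ evenPol) (zero_mem _) (fun _ _ => add_mem) fun hp => hzero p hp
  obtain ⟨g₁, hg₁⟩ := mem_evenPol.1 hrest
  refine ⟨MvPolynomial.C ((b - 1) / 2) * (MvPolynomial.X k * g) + g₁, ?_⟩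
  rw [vir_neg_apply, ← add_finsum_cond_ne 0 hfin, hg₁, hsq, if_pos (by omega), sub_zero,
    oscA_zero, show -2 * ((k : ℤ) + 1) = -oscPos 1 k by simp [oscPos]; ring, oscA_neg]
  have hb2 : b = 1 + 2 * ((b - 1) / 2) := by omega
  -- The zero mode term is `4 * z / √2 = 2 * √2 * z = b` times the rescaled variable.
  have hX : (4 : ℂ) • (LinearMap.mulLeft ℂ (MvPolynomial.X (R := ℂ) k))
      ((z • (1 : Module.End ℂ Pol)) (intPol g)) =
      intPol (MvPolynomial.C b * (MvPolynomial.X k * g)) := by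
    rw [map_mul, intPol_C, ← hz, map_mul, intPol_X]
    simp only [LinearMap.mulLeft_apply, LinearMap.smul_apply, Module.End.one_apply,
      mul_smul_comm, smul_mul_assoc, smul_smul, one_mul]
    congr 1
    linear_combination (-2 * z) * sqrt_two_mul_self
  rw [hX, hb2, ← map_add, ← map_add]
  congr 1
  simp only [map_add, map_mul, map_one, map_ofNat, add_sub_cancel_left,
    Int.mul_ediv_cancel_left _ (two_ne_zero)]
  ring

lemma untwisted_L (z : ℝ) (n : ℤ) : (untwisted z).L n = (osc 1 z).vir 0 n := by
  change (osc 1 z).vir ((0 : ℝ) : ℂ) n = _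
  rw [Complex.ofReal_zero]

/-- The span of the descendants of the vacuum. -/
def descSpan (z : ℝ) : Submodule ℂ Pol :=
  Submodule.span ℂ {x | ∃ w, x = (untwisted z).word w 1}

lemma L_neg_mem_descSpan (z : ℝ) (k : ℕ) {f : Pol} (hf : f ∈ descSpan z) :
    (untwisted z).L (-((k : ℤ) + 1)) f ∈ descSpan z := by
  have : descSpan z ≤ (descSpan z).comap ((untwisted z).L (-((k : ℤ) + 1))) := by
    refine Submodule.span_le.2 ?_
    rintro _ ⟨w, rfl⟩
    refine Submodule.subset_span ⟨k :: w, ?_⟩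
    rw [UnitaryVir.word_cons]
    rfl
  exact this hf

section

variable {z : ℝ} {b : ℤ} (hb : b % 2 = 1) (hz : (z : ℂ) * ((Real.sqrt 2 : ℝ) : ℂ) * 2 = b)

include hb hz

/-- Modulo even polynomials, every integral polynomial is a combination of descendants. -/
lemma exists_sub_mem_descSpan (g : MvPolynomial ℕ ℤ) :
    ∃ g', intPol (g - 2 * g') ∈ descSpan z := by
  have hstep : ∀ k g, (∃ g', intPol (g - 2 * g') ∈ descSpan z) →
      ∃ g', intPol (MvPolynomial.X k * g + sqTerm k * g - 2 * g') ∈ descSpan z := by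
    rintro k g ⟨g', hg'⟩
    obtain ⟨g₁, hg₁⟩ := vir_neg_intPol hb hz k (g - 2 * g')
    refine ⟨MvPolynomial.X k * g' + sqTerm k * g' - g₁, ?_⟩
    have h := Submodule.smul_mem _ (4 : ℂ) (L_neg_mem_descSpan z k hg')
    rw [untwisted_L, hg₁] at h
    convert h using 2
    ring
  have hX : ∀ k g, (∃ g', intPol (g - 2 * g') ∈ descSpan z) →
      ∃ g', intPol (MvPolynomial.X k * g - 2 * g') ∈ descSpan z := by
    intro k
    -- The unwanted square belongs to the variable of index `(k - 1) / 2 < k`, so multiplication by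
    -- it is already covered.
    induction k using Nat.strong_induction_on with
    | _ k ih =>
      intro g hg
      obtain ⟨g₁, hg₁⟩ := hstep k g hg
      by_cases hk : k % 2 = 1
      · obtain ⟨g₂, hg₂⟩ := ih ((k - 1) / 2) (by omega) _ (ih ((k - 1) / 2) (by omega) g hg)
        refine ⟨g₁ - g₂, ?_⟩
        rw [sqTerm, if_pos hk] at hg₁
        convert (descSpan z).sub_mem hg₁ hg₂ using 1
        rw [← map_sub]
        congr 1
        ring
      · refine ⟨g₁, ?_⟩
        rwa [sqTerm, if_neg hk, zero_mul, add_zero] at hg₁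
  induction g using MvPolynomial.induction_on with
  | C a =>
    refine ⟨0, ?_⟩
    rw [mul_zero, sub_zero, intPol_C]
    exact Submodule.smul_mem _ _ (Submodule.subset_span ⟨[], rfl⟩)
  | add f g hf hg =>
    obtain ⟨f', hf⟩ := hf
    obtain ⟨g', hg⟩ := hg
    refine ⟨f' + g', ?_⟩
    convert (descSpan z).add_mem hf hg using 1
    rw [← map_add]
    congr 1
    ring
  | mul_X f k hf =>
    rw [mul_comm]
    exact hX k f hf

/-- A functional that only sees finitely many monomials and kills all descendants of the vacuum
vanishes. -/
lemma functional_eq_zero {ξ : Pol →ₗ[ℂ] ℂ}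
    (hfin : {s : ℕ →₀ ℕ | ξ (MvPolynomial.monomial s 1) ≠ 0}.Finite)
    (hξ : ∀ w, ξ ((untwisted z).word w 1) = 0) (s : ℕ →₀ ℕ) :
    ξ (MvPolynomial.monomial s 1) = 0 := by
  have hdesc : ∀ f ∈ descSpan z, ξ f = 0 := by
    have : descSpan z ≤ LinearMap.ker ξ := by
      refine Submodule.span_le.2 ?_
      rintro _ ⟨w, rfl⟩
      exact hξ w
    exact this
  let ζ : MvPolynomial ℕ ℤ →ₗ[ℤ] ℂ := (ξ.toAddMonoidHom.comp intPol.toAddMonoidHom).toIntLinearMap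
  have hζ : ∀ g, ζ g = ξ (intPol g) := fun g => rfl
  -- The values of the functional on integral polynomials form an additive subgroup of `ℂ` equal to
  -- its own double.
  have hrange : LinearMap.range ζ ≤ Ideal.span {(2 : ℤ)} • LinearMap.range ζ := by
    rintro _ ⟨g, rfl⟩
    obtain ⟨g', hg'⟩ := exists_sub_mem_descSpan hb hz g
    have h := hdesc _ hg'
    rw [map_sub, map_sub, sub_eq_zero, ← hζ, ← hζ] at h
    have h2 : ζ (2 * g') = (2 : ℤ) • ζ g' := by
      rw [← map_smul]; congr 1; rw [zsmul_eq_mul]; rfl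
    rw [h, h2]
    exact Submodule.smul_mem_smul (Ideal.mem_span_singleton_self 2) ⟨g', rfl⟩
  -- This is where finiteness is used: finitely many monomial values generate the group.
  have hfg : (LinearMap.range ζ).FG := by
    have h1 : LinearMap.range ζ ≤ Submodule.span ℤ
        ((fun s => ζ (MvPolynomial.monomial s 1)) ''
          {s : ℕ →₀ ℕ | ξ (MvPolynomial.monomial s 1) ≠ 0}) := by
      rintro _ ⟨g, rfl⟩
      rw [g.as_sum, map_sum]
      refine Submodule.sum_mem _ fun t _ => ?_
      have : MvPolynomial.monomial t (g.coeff t) =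
          (g.coeff t) • MvPolynomial.monomial t (1 : ℤ) := by
        rw [MvPolynomial.smul_monomial, smul_eq_mul, mul_one]
      rw [this, map_smul]
      refine Submodule.smul_mem _ _ ?_
      by_cases ht : ξ (MvPolynomial.monomial t 1) = 0
      · obtain ⟨c, -, hc⟩ := intPol_monomial t
        rw [hζ, hc, map_smul, ht, smul_zero]
        exact zero_mem _
      · exact Submodule.subset_span ⟨t, ht, rfl⟩
    have : (Submodule.span ℤ ((fun s => ζ (MvPolynomial.monomial s 1)) ''
          {s : ℕ →₀ ℕ | ξ (MvPolynomial.monomial s 1) ≠ 0})).FG :=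
      Submodule.fg_span (hfin.image _)
    exact Submodule.FG.of_le this h1
  -- By Nakayama's lemma an odd integer `r` annihilates the group, which is torsion-free and
  -- therefore zero.
  obtain ⟨r, hr, hr0⟩ :=
    Submodule.exists_sub_one_mem_and_smul_eq_zero_of_fg_of_le_smul _ _ hfg hrange
  have hr1 : r ≠ 0 := by
    rintro rfl
    rw [Ideal.mem_span_singleton] at hr
    omega
  obtain ⟨c, hc0, hc⟩ := intPol_monomial s
  have h := hr0 (ζ (MvPolynomial.monomial s 1)) ⟨_, rfl⟩
  rw [smul_eq_zero, hζ, hc, map_smul, smul_eq_mul, mul_eq_zero] at h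
  exact (h.resolve_left hr1).resolve_left hc0

end

/-! ### The sum of the untwisted Fock modules -/

lemma onSectors_apply (T : ℤ → Module.End ℂ Pol) (v : FockSum) (k : ℤ) :
    onSectors T v k = T k (v k) := by
  have : Finsupp.lapply k ∘ₗ onSectors T = T k ∘ₗ Finsupp.lapply (R := ℂ) k := by
    refine Finsupp.lhom_ext fun j f => ?_
    simp only [onSectors, LinearMap.comp_apply, Finsupp.lsum_single, Finsupp.lsingle_apply,
      Finsupp.lapply_apply]
    by_cases h : k = j
    · subst h; simp
    · rw [Finsupp.single_eq_of_ne h, Finsupp.single_eq_of_ne h, map_zero]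
  exact congrArg (fun S : FockSum →ₗ[ℂ] Pol => S v) this

lemma onSectors_single (T : ℤ → Module.End ℂ Pol) (k : ℤ) (f : Pol) :
    onSectors T (Finsupp.single k f) = Finsupp.single k (T k f) := by
  simp only [onSectors, Finsupp.lsum_single, LinearMap.comp_apply, Finsupp.lsingle_apply]

/-- The inner product on a direct sum. -/
def sumIp (U : ℤ → UnitaryVir Pol) (x y : FockSum) : ℂ := x.sum fun k f => (U k).ip f (y k)

lemma sumIp_eq_sum (U : ℤ → UnitaryVir Pol) (x y : FockSum) {S : Finset ℤ} (hS : x.support ⊆ S) :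
    sumIp U x y = ∑ k ∈ S, (U k).ip (x k) (y k) :=
  Finsupp.sum_of_support_subset _ hS _ fun k _ => (U k).zero_ip _

/-- The direct sum of representations. -/
def sumVir (U : ℤ → UnitaryVir Pol) : UnitaryVir FockSum where
  L n := onSectors fun k => (U k).L n
  ip := sumIp U
  comm m n h := by
    refine LinearMap.ext fun x => Finsupp.ext fun k => ?_
    have := congrArg (fun T : Module.End ℂ Pol => T (x k)) ((U k).comm m n h)
    simpa only [LinearMap.sub_apply, Module.End.mul_apply, LinearMap.smul_apply, Finsupp.sub_apply,
      Finsupp.smul_apply, onSectors_apply] using this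
  comm_one := by
    refine LinearMap.ext fun x => Finsupp.ext fun k => ?_
    have := congrArg (fun T : Module.End ℂ Pol => T (x k)) (U k).comm_one
    simpa only [LinearMap.sub_apply, Module.End.mul_apply, LinearMap.smul_apply, Finsupp.sub_apply,
      Finsupp.smul_apply, onSectors_apply] using this
  comm_two := by
    refine LinearMap.ext fun x => Finsupp.ext fun k => ?_
    have := congrArg (fun T : Module.End ℂ Pol => T (x k)) (U k).comm_two
    simpa only [LinearMap.sub_apply, Module.End.mul_apply, LinearMap.smul_apply, Finsupp.sub_apply,
      Finsupp.smul_apply, onSectors_apply, LinearMap.add_apply, Finsupp.add_apply,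
      Module.End.one_apply] using this
  ip_add x y z := by
    simp only [sumIp, Finsupp.add_apply, (U _).ip_add]
    exact Finset.sum_add_distrib
  ip_smul c x y := by
    simp only [sumIp, Finsupp.smul_apply, (U _).ip_smul]
    exact (Finset.mul_sum _ _ _).symm
  ip_conj x y := by
    classical
    rw [sumIp_eq_sum U x y Finset.subset_union_left,
      sumIp_eq_sum U y x (Finset.subset_union_right (s₁ := x.support)), map_sum]
    exact Finset.sum_congr rfl fun k _ => (U k).ip_conj _ _
  ip_nonneg x := by
    rw [sumIp_eq_sum U x x (Finset.Subset.refl _), Complex.re_sum]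
    exact Finset.sum_nonneg fun k _ => (U k).ip_nonneg _
  ip_definite x h := by
    rw [sumIp_eq_sum U x x (Finset.Subset.refl _)] at h
    have h' := congrArg Complex.re h
    rw [Complex.re_sum, Complex.zero_re,
      Finset.sum_eq_zero_iff_of_nonneg fun k _ => (U k).ip_nonneg _] at h'
    ext1 k
    by_contra hk
    refine hk ((U k).ip_definite _ (Complex.ext ?_ ?_))
    · exact h' k (Finsupp.mem_support_iff.2 hk)
    · exact Complex.conj_eq_iff_im.1 ((U k).ip_conj _ _)
  ip_L n x y := by
    classical
    rw [sumIp_eq_sum U _ _ (S := x.support), sumIp_eq_sum U x _ (Finset.Subset.refl _)]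
    · refine Finset.sum_congr rfl fun k _ => ?_
      rw [onSectors_apply, onSectors_apply, (U k).ip_L]
    · intro k hk
      rw [Finsupp.mem_support_iff, onSectors_apply] at hk
      exact Finsupp.mem_support_iff.2 fun h0 => hk (by rw [h0, map_zero])

lemma sumVir_word_single (U : ℤ → UnitaryVir Pol) (w : List ℕ) (k : ℤ) (f : Pol) :
    (sumVir U).word w (Finsupp.single k f) = Finsupp.single k ((U k).word w f) := by
  induction w with
  | nil => rfl
  | cons j w ih =>
    rw [UnitaryVir.word_cons, UnitaryVir.word_cons, Module.End.mul_apply, ih]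
    exact onSectors_single _ _ _

/-- The value of the zero mode on the `n`-th sector. -/
def zeroMode (n : ℤ) : ℝ := Real.sqrt 2 * (n + 1 / 4)

lemma zeroMode_sq (n : ℤ) : ((zeroMode n : ℝ) : ℂ) ^ 2 / 2 = ((n : ℂ) + 1 / 4) ^ 2 := by
  unfold zeroMode
  push_cast
  rw [mul_pow, pow_two ((Real.sqrt 2 : ℝ) : ℂ), sqrt_two_mul_self]
  ring

/-- The number `4 * n + 1` is odd, as the argument modulo `2` requires. -/
lemma zeroMode_mul (n : ℤ) :
    ((zeroMode n : ℝ) : ℂ) * ((Real.sqrt 2 : ℝ) : ℂ) * 2 = ((4 * n + 1 : ℤ) : ℂ) := by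
  unfold zeroMode
  push_cast
  linear_combination (2 * (n + 1 / 4) : ℂ) * sqrt_two_mul_self

/-- The sum of the untwisted Fock modules with vacuum weights `(n + 1/4)²`. -/
def allVir : UnitaryVir FockSum := sumVir fun n => untwisted (zeroMode n)

/-- The monomial basis of `⊕ F̄(k)`. -/
def fockBasis : Module.Basis (Σ _ : ℤ, ℕ →₀ ℕ) ℂ FockSum :=
  Finsupp.basis fun _ => MvPolynomial.basisMonomials ℕ ℂ

lemma fockBasis_apply (x : Σ _ : ℤ, ℕ →₀ ℕ) :
    fockBasis x = Finsupp.single x.1 (MvPolynomial.monomial x.2 1) := by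
  simp [fockBasis, Finsupp.coe_basis]

/-- The `L 0`-eigenvalues on the monomial basis. -/
def allWt (x : Σ _ : ℤ, ℕ →₀ ℕ) : ℂ := (oscWt 1 x.2 : ℂ) / 2 + ((x.1 : ℂ) + 1 / 4) ^ 2

lemma allVir_L_zero (x : Σ _ : ℤ, ℕ →₀ ℕ) : allVir.L 0 (fockBasis x) = allWt x • fockBasis x := by
  rw [fockBasis_apply, allVir]
  change onSectors (fun k => (untwisted (zeroMode k)).L 0) _ = _
  rw [onSectors_single, untwisted_L, vir_zero_monomial, zeroMode_sq, add_zero, Finsupp.smul_single]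
  rfl

lemma allVir_isSing (n : ℤ) : allVir.IsSing (((n : ℂ) + 1 / 4) ^ 2) (vac n) := by
  constructor
  · intro k hk
    change onSectors (fun j => (untwisted (zeroMode j)).L k) _ = _
    rw [vac, onSectors_single, untwisted_L, vir_one_of_pos _ _ _ hk, Finsupp.single_zero]
  · change onSectors (fun j => (untwisted (zeroMode j)).L 0) _ = _
    rw [vac, onSectors_single, untwisted_L, vir_zero_one, zeroMode_sq, add_zero,
      Finsupp.smul_single]

lemma allVir_ip_vac (n m : ℤ) : allVir.ip (vac n) (vac m) = if n = m then 1 else 0 := by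
  have h1 : (untwisted (zeroMode n)).ip 1 1 = 1 :=
    (oscIp_one_left 1 1).trans (map_one _)
  change sumIp _ _ _ = _
  rw [sumIp, vac, vac, Finsupp.sum_single_index (h := fun k f =>
    (untwisted (zeroMode k)).ip f ((Finsupp.single m 1 : FockSum) k)) (UnitaryVir.zero_ip _ _)]
  split_ifs with h
  · rw [h, Finsupp.single_eq_same, ← h, h1]
  · rw [Finsupp.single_eq_of_ne h, UnitaryVir.ip_zero]

/-- The vacuum weights grow quadratically with the sector, so only finitely many sectors, and
finitely many monomials in each, reach a given weight. -/
lemma allWt_finite (c : ℂ) : {x | allWt x = c}.Finite := by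
  have hinj : ∀ x : Σ _ : ℤ, ℕ →₀ ℕ, (allWt x).re =
      (oscWt 1 x.2 : ℝ) / 2 + ((x.1 : ℝ) + 1 / 4) ^ 2 := by
    intro x
    have : allWt x = (((oscWt 1 x.2 : ℝ) / 2 + ((x.1 : ℝ) + 1 / 4) ^ 2 : ℝ) : ℂ) := by
      unfold allWt; push_cast; ring
    rw [this, Complex.ofReal_re]
  obtain ⟨N, hN⟩ := exists_nat_gt (2 * |c.re| + 2)
  have hf : ((Set.Icc (-(N : ℤ)) N).prod {s | oscWt 1 s ≤ N}).Finite :=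
    (Set.finite_Icc _ _).prod (oscWt_finite 1 N)
  refine (hf.image fun p : ℤ × (ℕ →₀ ℕ) => (⟨p.1, p.2⟩ : Σ _ : ℤ, ℕ →₀ ℕ)).subset fun x hx => ?_
  refine ⟨(x.1, x.2), ?_, rfl⟩
  have h := hinj x
  rw [show allWt x = c from hx] at h
  have h1 := le_abs_self c.re
  have h0 : (0 : ℝ) ≤ oscWt 1 x.2 := Nat.cast_nonneg _
  refine Set.mem_prod.2 ⟨Set.mem_Icc.2 ⟨?_, ?_⟩, ?_⟩
  · have : (-(N : ℝ)) ≤ (x.1 : ℝ) := by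
      by_contra hc; push Not at hc
      nlinarith
    exact_mod_cast this
  · have : (x.1 : ℝ) ≤ N := by
      by_contra hc; push Not at hc
      nlinarith
    exact_mod_cast this
  · have : (oscWt 1 x.2 : ℝ) ≤ N := by nlinarith [sq_nonneg ((x.1 : ℝ) + 1 / 4)]
    exact_mod_cast this

/-- The sum of the untwisted Fock modules is generated by the vacua. -/
lemma allVir_eigenspace_le (c : ℂ) : Module.End.eigenspace (allVir.L 0) c ≤
    Submodule.span ℂ {x | ∃ (n : ℤ) (w : List ℕ),
      ((n : ℂ) + 1 / 4) ^ 2 + wordDeg w = c ∧ x = allVir.word w (vac n)} := by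
  intro x hx
  by_contra hcon
  obtain ⟨η, hη, hker⟩ := Submodule.exists_le_ker_of_notMem hcon
  obtain ⟨π, hπ0, hπ1, hπ2⟩ := exists_eigenspace_projection fockBasis allVir_L_zero c
  -- Words of weight `c` lie in the span killed by `η`; words of any other weight are killed by `π`.
  have hword : ∀ (n : ℤ) w, η (π (allVir.word w (vac n))) = 0 := by
    intro n w
    have hw := allVir.L_zero_word (allVir_isSing n).2 w
    by_cases h : ((n : ℂ) + 1 / 4) ^ 2 + wordDeg w = c
    · rw [hπ1 _ (by rw [hw, h])]
      exact hker (Submodule.subset_span ⟨n, w, h, rfl⟩)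
    · rw [hπ2 _ _ h hw, map_zero]
  have hzero : η ∘ₗ π = 0 := by
    refine fockBasis.ext fun ⟨n, s⟩ => ?_
    rw [fockBasis_apply, LinearMap.zero_apply]
    refine functional_eq_zero (b := 4 * n + 1) (by omega) (zeroMode_mul n)
      (ξ := (η ∘ₗ π) ∘ₗ Finsupp.lsingle n) ?_ (fun w => ?_) s
    · refine ((allWt_finite c).preimage (f := fun s : ℕ →₀ ℕ => (⟨n, s⟩ : Σ _ : ℤ, ℕ →₀ ℕ))
        fun s _ t _ h => by simpa using h).subset fun t ht => ?_
      by_contra hc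
      apply ht
      have := hπ0 ⟨n, t⟩ hc
      rw [fockBasis_apply] at this
      simp only [LinearMap.comp_apply, Finsupp.lsingle_apply, this, map_zero]
    · have := hword n w
      rw [allVir, vac, sumVir_word_single] at this
      exact this
  have hx' : η (π x) = 0 := congrArg (fun S : FockSum →ₗ[ℂ] ℂ => S x) hzero
  rw [hπ1 x (Module.End.mem_eigenspace_iff.1 hx)] at hx'
  exact hη hx'

/-! ### Gauss' identity for triangular numbers -/

/-- The geometric series `1 / (1 - X ^ w)`. -/
def geo (w : ℕ) : PowerSeries ℤ := PowerSeries.mk fun m => if w ∣ m then 1 else 0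

lemma geo_mul {w : ℕ} (hw : 0 < w) : geo w * (1 - PowerSeries.X ^ w) = 1 := by
  ext m
  rw [mul_sub, mul_one, map_sub, PowerSeries.coeff_mul_X_pow', PowerSeries.coeff_one, geo,
    PowerSeries.coeff_mk, PowerSeries.coeff_mk]
  by_cases h : w ≤ m
  · rw [if_pos h, if_neg (by omega : m ≠ 0)]
    have hd : w ∣ m - w ↔ w ∣ m := (Nat.dvd_sub_iff_left h dvd_rfl)
    simp only [hd, sub_self]
  · rw [if_neg h, sub_zero]
    by_cases hm : m = 0
    · simp [hm]
    · rw [if_neg hm, if_neg fun hd => h (Nat.le_of_dvd (by omega) hd)]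

/-- The product `∏_{s ≤ k < n} (1 - X ^ (2 k + 2)) / (1 - X ^ (2 k + 1))`. -/
def shanks (s n : ℕ) : PowerSeries ℤ :=
  ∏ k ∈ Finset.Ico s n, ((1 - PowerSeries.X ^ (2 * k + 2)) * geo (2 * k + 1))

/-- Removing the bottom factor of the product exchanges the two kinds of binomials; this is what
makes the sum in `sum_shanks` telescope. -/
lemma shanks_succ_left {s n : ℕ} (h : s < n) :
    shanks (s + 1) n * (1 - PowerSeries.X ^ (2 * s + 2)) =
      shanks s n * (1 - PowerSeries.X ^ (2 * s + 1)) := by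
  have h1 := geo_mul (w := 2 * s + 1) (by omega)
  unfold shanks
  rw [Finset.prod_eq_prod_Ico_succ_bot h]
  linear_combination (-(1 - PowerSeries.X ^ (2 * s + 2)) *
    ∏ k ∈ Finset.Ico (s + 1) n, ((1 - PowerSeries.X ^ (2 * k + 2)) * geo (2 * k + 1))) * h1

/-- The finite form of Gauss' identity due to Shanks. -/
lemma sum_shanks (n : ℕ) :
    ∑ s ∈ Finset.range n, shanks s n * PowerSeries.X ^ (s * (2 * n + 1)) =
      ∑ t ∈ Finset.range (2 * n), (PowerSeries.X : PowerSeries ℤ) ^ (t * (t + 1) / 2) := by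
  induction n with
  | zero => simp
  | succ n ih =>
    have hg := geo_mul (w := 2 * n + 1) (by omega)
    have hr : ∀ s ≤ n, shanks s (n + 1) =
        shanks s n * ((1 - PowerSeries.X ^ (2 * n + 2)) * geo (2 * n + 1)) := fun s hs =>
      Finset.prod_Ico_succ_top hs _
    -- Passing from `n` to `n + 1` changes each term by a difference of consecutive values of one
    -- expression. That expression vanishes at `s = 0`; its value at `s = n`, with the new term,
    -- gives the two new triangular powers.
    have htel : ∀ s ∈ Finset.range n,
        shanks s (n + 1) * PowerSeries.X ^ (s * (2 * (n + 1) + 1)) =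
        shanks s n * PowerSeries.X ^ (s * (2 * n + 1)) + geo (2 * n + 1) *
          (shanks (s + 1) n * PowerSeries.X ^ ((s + 1) * (2 * n + 1)) *
              (1 - PowerSeries.X ^ (2 * (s + 1))) -
            shanks s n * PowerSeries.X ^ (s * (2 * n + 1)) * (1 - PowerSeries.X ^ (2 * s))) := by
      intro s hs
      have hs' := Finset.mem_range.1 hs
      have h1 := shanks_succ_left hs'
      rw [hr s hs'.le]
      linear_combination (-(geo (2 * n + 1)) * PowerSeries.X ^ ((s + 1) * (2 * n + 1))) * h1
        + shanks s n * PowerSeries.X ^ (s * (2 * n + 1)) * hg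
    rw [Finset.sum_range_succ, Finset.sum_congr rfl htel, Finset.sum_add_distrib, ← Finset.mul_sum,
      Finset.sum_range_sub fun s => shanks s n * PowerSeries.X ^ (s * (2 * n + 1)) *
        (1 - PowerSeries.X ^ (2 * s)), ih, show 2 * (n + 1) = 2 * n + 1 + 1 by ring,
      Finset.sum_range_succ, Finset.sum_range_succ, hr n le_rfl]
    have e1 : 2 * n * (2 * n + 1) / 2 = n * (2 * n + 1) := by
      rw [mul_assoc]; exact Nat.mul_div_cancel_left _ two_pos
    have e2 : (2 * n + 1) * (2 * n + 1 + 1) / 2 = (2 * n + 1) * (n + 1) := by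
      rw [show (2 * n + 1) * (2 * n + 1 + 1) = 2 * ((2 * n + 1) * (n + 1)) by ring]
      exact Nat.mul_div_cancel_left _ two_pos
    have e3 : shanks n n = 1 := by simp [shanks]
    rw [e1, e2, e3]
    linear_combination (PowerSeries.X ^ (n * (2 * n + 1)) * (1 + PowerSeries.X ^ (2 * n + 1))) * hg

/-- An exponent vector `s` corresponds to the tuple of the degrees that its variables contribute,
each divisible by the weight of its variable. Since `d < n`, only the first `n` variables can occur.
-/
lemma coeff_prod_geo (ε : Fin 2) {d n : ℕ} (h : d < n) :
    PowerSeries.coeff d (∏ i ∈ Finset.range n, geo (2 * i + 1 + (ε : ℕ))) =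
      (Nat.card {s | oscWt ε s = d} : ℤ) := by
  classical
  have hfin : {s | oscWt ε s = d}.Finite := (oscWt_finite ε d).subset fun s hs => le_of_eq hs
  have hlt : ∀ s, oscWt ε s = d → ∀ i, s i ≠ 0 → i < n := by
    intro s hs i hi
    have h1 : s i * (2 * i + 1 + (ε : ℕ)) ≤ oscWt ε s :=
      Finset.single_le_sum (f := fun i => s i * (2 * i + 1 + (ε : ℕ))) (fun _ _ => Nat.zero_le _)
        (Finsupp.mem_support_iff.2 hi)
    have := Nat.le_mul_of_pos_left (2 * i + 1 + (ε : ℕ)) (Nat.pos_of_ne_zero hi)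
    omega
  rw [PowerSeries.coeff_prod]
  simp only [geo, PowerSeries.coeff_mk, Finset.prod_ite_zero, Finset.prod_const_one]
  rw [Finset.sum_boole, Nat.card_coe_set_eq, Set.ncard_eq_toFinset_card _ hfin]
  congr 1
  refine Finset.card_bij'
    (fun l _ => Finsupp.onFinset (Finset.range n)
      (fun i => if i < n then l i / (2 * i + 1 + (ε : ℕ)) else 0) fun i hi => by
        rw [Finset.mem_range]; by_contra hc; exact hi (if_neg hc))
    (fun s _ => Finsupp.onFinset (Finset.range n)
      (fun i => if i < n then s i * (2 * i + 1 + (ε : ℕ)) else 0) fun i hi => by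
        rw [Finset.mem_range]; by_contra hc; exact hi (if_neg hc)) ?_ ?_ ?_ ?_
  · intro l hl
    rw [Finset.mem_filter, Finset.mem_finsuppAntidiag] at hl
    rw [Set.Finite.mem_toFinset]
    change oscWt ε _ = d
    rw [oscWt, Finsupp.onFinset_sum _ (by simp), ← hl.1.1]
    refine Finset.sum_congr rfl fun i hi => ?_
    rw [if_pos (Finset.mem_range.1 hi), Nat.div_mul_cancel (hl.2 i hi)]
  · intro s hs
    rw [Set.Finite.mem_toFinset] at hs
    rw [Finset.mem_filter, Finset.mem_finsuppAntidiag]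
    refine ⟨⟨?_, Finsupp.support_onFinset_subset⟩, fun i hi => ?_⟩
    · rw [← show oscWt ε s = d from hs, oscWt, Finsupp.sum_of_support_subset s (s := Finset.range n)]
      · refine Finset.sum_congr rfl fun i hi => ?_
        rw [Finsupp.onFinset_apply, if_pos (Finset.mem_range.1 hi)]
      · intro i hi
        exact Finset.mem_range.2 (hlt s hs i (Finsupp.mem_support_iff.1 hi))
      · simp
    · rw [Finsupp.onFinset_apply, if_pos (Finset.mem_range.1 hi)]
      exact dvd_mul_left _ _
  · intro l hl
    rw [Finset.mem_filter, Finset.mem_finsuppAntidiag] at hl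
    ext i
    rw [Finsupp.onFinset_apply, Finsupp.onFinset_apply]
    by_cases hi : i < n
    · rw [if_pos hi, if_pos hi, Nat.div_mul_cancel (hl.2 i (Finset.mem_range.2 hi))]
    · rw [if_neg hi]
      by_contra hc
      exact hi (Finset.mem_range.1 (hl.1.2 (Finsupp.mem_support_iff.2 (Ne.symm hc))))
  · intro s hs
    rw [Set.Finite.mem_toFinset] at hs
    ext i
    rw [Finsupp.onFinset_apply, Finsupp.onFinset_apply]
    by_cases hi : i < n
    · rw [if_pos hi, if_pos hi, Nat.mul_div_cancel _ (by omega)]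
    · rw [if_neg hi]
      by_contra hc
      exact hi (hlt s hs i (Ne.symm hc))

lemma prod_geo_one_mul (d : ℕ) : ∃ r : PowerSeries ℤ,
    ∏ i ∈ Finset.range (d + 1), geo (2 * i + 1 + ((0 : Fin 2) : ℕ)) =
      (∏ i ∈ Finset.range (d + 1), geo (2 * i + 1 + ((1 : Fin 2) : ℕ))) *
        ∑ t ∈ Finset.range (2 * (d + 1)), PowerSeries.X ^ (t * (t + 1) / 2) +
      PowerSeries.X ^ (d + 1) * r := by
  have h1 : (∏ i ∈ Finset.range (d + 1), geo (2 * i + 1 + ((1 : Fin 2) : ℕ))) *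
      shanks 0 (d + 1) = ∏ i ∈ Finset.range (d + 1), geo (2 * i + 1 + ((0 : Fin 2) : ℕ)) := by
    rw [shanks, ← Finset.range_eq_Ico, ← Finset.prod_mul_distrib]
    refine Finset.prod_congr rfl fun i _ => ?_
    have := geo_mul (w := 2 * i + 1 + 1) (by omega)
    change geo (2 * i + 1 + 1) * _ = geo (2 * i + 1)
    linear_combination geo (2 * i + 1) * this
  -- The terms of Shanks' sum beyond the first have degree at least `2 * d + 3`, so they do not
  -- affect the coefficient of degree `d`.
  have h2 : ∑ s ∈ Finset.range d, shanks (s + 1) (d + 1) *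
      PowerSeries.X ^ ((s + 1) * (2 * (d + 1) + 1)) = PowerSeries.X ^ (d + 1) *
      ∑ s ∈ Finset.range d, shanks (s + 1) (d + 1) *
        PowerSeries.X ^ (s * (2 * (d + 1) + 1) + (d + 2)) := by
    rw [Finset.mul_sum]
    refine Finset.sum_congr rfl fun s _ => ?_
    ring
  rw [← sum_shanks, Finset.sum_range_succ', h2, zero_mul, pow_zero, mul_one, mul_add, h1]
  exact ⟨-(∏ i ∈ Finset.range (d + 1), geo (2 * i + 1 + ((1 : Fin 2) : ℕ))) *
    ∑ s ∈ Finset.range d, shanks (s + 1) (d + 1) *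
        PowerSeries.X ^ (s * (2 * (d + 1) + 1) + (d + 2)), by ring⟩

/-- The integer `n` with `n (2 n + 1)` equal to the `t`-th triangular number. -/
def triIndex (t : ℕ) : ℤ := if t % 2 = 0 then (t / 2 : ℕ) else -((t / 2 : ℕ) + 1 : ℤ)

lemma triIndex_mul (t : ℕ) : triIndex t * (2 * triIndex t + 1) = (t * (t + 1) / 2 : ℕ) := by
  unfold triIndex
  rcases Nat.even_or_odd' t with ⟨m, rfl | rfl⟩
  · rw [if_pos (by omega), mul_assoc, Nat.mul_div_cancel_left _ two_pos,
      Nat.mul_div_cancel_left _ two_pos]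
    push_cast; ring
  · rw [if_neg (by omega), show (2 * m + 1) * (2 * m + 1 + 1) = 2 * ((2 * m + 1) * (m + 1)) by ring,
      Nat.mul_div_cancel_left _ two_pos, show (2 * m + 1) / 2 = m by omega]
    push_cast; ring

lemma triIndex_injective : Function.Injective triIndex := by
  intro s t h
  unfold triIndex at h
  split_ifs at h <;> omega

/-- The dimensions of the eigenspaces of `L 0` in the twisted Fock module are bounded by those in
the sum of the untwisted ones. -/
lemma card_oscWt_le (d : ℕ) :
    Nat.card {s | oscWt 0 s = d} ≤ Nat.card {x | allWt x = (d : ℂ) / 2 + 1 / 16} := by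
  classical
  obtain ⟨r, hr⟩ := prod_geo_one_mul d
  have h := congrArg (PowerSeries.coeff d) hr
  rw [coeff_prod_geo 0 (Nat.lt_succ_self d), map_add, PowerSeries.coeff_X_pow_mul',
    if_neg (by omega), add_zero, Finset.mul_sum, map_sum] at h
  have hfin : ∀ e, {s | oscWt 1 s = e}.Finite := fun e =>
    (oscWt_finite 1 e).subset fun s hs => le_of_eq hs
  have h2 : ∀ t ∈ Finset.range (2 * (d + 1)),
      PowerSeries.coeff d ((∏ i ∈ Finset.range (d + 1), geo (2 * i + 1 + ((1 : Fin 2) : ℕ))) *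
        PowerSeries.X ^ (t * (t + 1) / 2)) =
      ((if t * (t + 1) / 2 ≤ d then (hfin (d - t * (t + 1) / 2)).toFinset else ∅).card : ℤ) := by
    intro t _
    rw [PowerSeries.coeff_mul_X_pow']
    split_ifs
    · rw [coeff_prod_geo 1 (by omega), Nat.card_coe_set_eq, Set.ncard_eq_toFinset_card _ (hfin _)]
    · simp
  rw [Finset.sum_congr rfl h2, ← Nat.cast_sum, Nat.cast_inj, ← Finset.card_sigma] at h
  rw [h, Nat.card_coe_set_eq, Set.ncard_eq_toFinset_card _ (allWt_finite _)]
  refine Finset.card_le_card_of_injOn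
    (fun y => (⟨triIndex y.1, y.2⟩ : Σ _ : ℤ, ℕ →₀ ℕ)) (fun y hy => ?_) fun y _ z _ hyz => ?_
  · have hy2 := (Finset.mem_sigma.1 hy).2
    split_ifs at hy2 with hle
    · rw [Set.Finite.mem_toFinset, Set.mem_ofPred_eq] at hy2
      rw [Finset.mem_coe, Set.Finite.mem_toFinset, Set.mem_ofPred_eq]
      -- Half of `n * (2 * n + 1)` equals `(n + 1/4) ^ 2 - 1/16`, so each triangular number accounts
      -- for one vacuum weight.
      have h3 : (oscWt 1 y.2 : ℤ) + triIndex y.1 * (2 * triIndex y.1 + 1) = d := by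
        rw [triIndex_mul, hy2]; omega
      have h4 := congrArg (Int.cast : ℤ → ℂ) h3
      push_cast at h4
      unfold allWt
      linear_combination h4 / 2
    · simp at hy2
  · obtain ⟨a, s⟩ := y
    obtain ⟨b, t⟩ := z
    simp only [Sigma.mk.injEq, heq_eq_eq] at hyz ⊢
    exact ⟨triIndex_injective hyz.1, hyz.2⟩

/-! ### Formal exponentials -/

section Exp

variable {V : Type*} [AddCommGroup V] [Module ℂ V]

/-- The formal series in the exponent. -/
def expSeries {R : Type*} [Semiring R] (B : ℕ → R) : PowerSeries R :=
  PowerSeries.mk fun p => if p = 0 then 0 else B p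

lemma coeff_expSeries {R : Type*} [Semiring R] (B : ℕ → R) (p : ℕ) :
    PowerSeries.coeff p (expSeries B) = if p = 0 then 0 else B p := PowerSeries.coeff_mk _ _

lemma coeff_expSeries_pow_eq_zero {R : Type*} [Semiring R] (B : ℕ → R) {N k : ℕ} (h : N < k) :
    PowerSeries.coeff N (expSeries B ^ k) = 0 := by
  induction k generalizing N with
  | zero => omega
  | succ k ih =>
    rw [pow_succ, PowerSeries.coeff_mul]
    refine Finset.sum_eq_zero fun x hx => ?_
    rw [Finset.HasAntidiagonal.mem_antidiagonal] at hx
    by_cases h2 : x.2 = 0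
    · rw [coeff_expSeries, if_pos h2, mul_zero]
    · rw [ih (by omega), zero_mul]

lemma expCoeff_eq_sum (B : ℕ → Module.End ℂ V) {N K : ℕ} (h : N < K) :
    expCoeff B N = ∑ k ∈ Finset.range K, (k.factorial : ℂ)⁻¹ •
      PowerSeries.coeff N (expSeries B ^ k) := by
  refine Finset.sum_subset (Finset.range_subset_range.2 h) fun k _ hk => ?_
  rw [Finset.mem_range, not_lt] at hk
  change (k.factorial : ℂ)⁻¹ • PowerSeries.coeff N (expSeries B ^ k) = 0
  rw [coeff_expSeries_pow_eq_zero B (by omega), smul_zero]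

lemma expCoeff_zero (B : ℕ → Module.End ℂ V) : expCoeff B 0 = 1 := by
  rw [expCoeff_eq_sum B zero_lt_one]
  simp

/-- The coefficients of a formal exponential, extended by zero to negative indices. -/
def expZ (B : ℕ → Module.End ℂ V) (N : ℤ) : Module.End ℂ V :=
  if 0 ≤ N then expCoeff B N.toNat else 0

lemma expZ_natCast (B : ℕ → Module.End ℂ V) (N : ℕ) : expZ B N = expCoeff B N := by
  rw [expZ, if_pos (Int.natCast_nonneg N), Int.toNat_natCast]

lemma expZ_of_neg (B : ℕ → Module.End ℂ V) {N : ℤ} (h : N < 0) : expZ B N = 0 :=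
  if_neg (by omega)

lemma expZ_zero (B : ℕ → Module.End ℂ V) : expZ B 0 = 1 := expCoeff_zero B

/-- Since `X` commutes with the exponent series up to the central term `c t ^ q`, it acts on powers
of the series as a derivation. -/
lemma comm_expSeries_pow {X : Module.End ℂ V} {B : ℕ → Module.End ℂ V} {q : ℕ} {c : ℂ} (hq : q ≠ 0)
    (h : ∀ p, p ≠ 0 → X * B p - B p * X = if p = q then c • 1 else 0) (k N : ℕ) :
    X * PowerSeries.coeff N (expSeries B ^ (k + 1)) - PowerSeries.coeff N (expSeries B ^ (k + 1)) * X
      = ((k + 1 : ℂ) * c) • if q ≤ N then PowerSeries.coeff (N - q) (expSeries B ^ k) else 0 := by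
  have h1 : PowerSeries.C X * expSeries B = expSeries B * PowerSeries.C X +
      c • PowerSeries.X ^ q := by
    ext1 p
    rw [map_add, PowerSeries.coeff_C_mul, PowerSeries.coeff_mul_C, PowerSeries.coeff_smul,
      PowerSeries.coeff_X_pow, coeff_expSeries]
    by_cases hp : p = 0
    · rw [if_pos hp, if_neg (by omega)]; simp
    · rw [if_neg hp, ← sub_eq_iff_eq_add', h p hp, smul_ite, smul_zero]
  have h2 : ∀ k : ℕ, PowerSeries.C X * expSeries B ^ (k + 1) =
      expSeries B ^ (k + 1) * PowerSeries.C X +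
      ((k + 1 : ℂ) * c) • (expSeries B ^ k * PowerSeries.X ^ q) := by
    intro k
    induction k with
    | zero => rw [zero_add, pow_one, h1]; simp
    | succ k ih =>
      rw [pow_succ _ (k + 1), ← mul_assoc, ih, add_mul, mul_assoc, h1, mul_add, smul_mul_assoc,
        mul_assoc (expSeries B ^ k), PowerSeries.X_pow_mul, ← mul_assoc (expSeries B ^ k),
        ← pow_succ, mul_smul_comm, ← mul_assoc]
      push_cast
      module
  have h3 := congrArg (PowerSeries.coeff N) (h2 k)
  rw [map_add, PowerSeries.coeff_C_mul, PowerSeries.coeff_mul_C, PowerSeries.coeff_smul,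
    PowerSeries.coeff_mul_X_pow'] at h3
  rw [h3, add_sub_cancel_left]

lemma comm_expZ {X : Module.End ℂ V} {B : ℕ → Module.End ℂ V} {q : ℕ} {c : ℂ} (hq : q ≠ 0)
    (h : ∀ p, p ≠ 0 → X * B p - B p * X = if p = q then c • 1 else 0) (N : ℤ) :
    X * expZ B N - expZ B N * X = c • expZ B (N - q) := by
  by_cases hN : 0 ≤ N
  · lift N to ℕ using hN
    rw [expZ_natCast, expCoeff_eq_sum B (K := N + 1 + 1) (by omega), Finset.sum_range_succ',
      pow_zero, PowerSeries.coeff_one, mul_add, add_mul, add_sub_add_comm, Finset.mul_sum,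
      Finset.sum_mul, ← Finset.sum_sub_distrib]
    have h0 : X * (((Nat.factorial 0 : ℕ) : ℂ)⁻¹ • if N = 0 then (1 : Module.End ℂ V) else 0) -
        (((Nat.factorial 0 : ℕ) : ℂ)⁻¹ • if N = 0 then (1 : Module.End ℂ V) else 0) * X = 0 := by
      split_ifs <;> simp
    rw [h0, add_zero]
    have h1 : ∀ k ∈ Finset.range (N + 1),
        X * (((k + 1).factorial : ℂ)⁻¹ • PowerSeries.coeff N (expSeries B ^ (k + 1))) -
        (((k + 1).factorial : ℂ)⁻¹ • PowerSeries.coeff N (expSeries B ^ (k + 1))) * X =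
        c • ((k.factorial : ℂ)⁻¹ •
          if q ≤ N then PowerSeries.coeff (N - q) (expSeries B ^ k) else 0) := by
      intro k _
      rw [mul_smul_comm, smul_mul_assoc, ← smul_sub, comm_expSeries_pow hq h, smul_smul, smul_smul,
        Nat.factorial_succ]
      congr 1
      have : (k : ℂ) + 1 ≠ 0 := by exact_mod_cast Nat.succ_ne_zero k
      push_cast
      field_simp
    rw [Finset.sum_congr rfl h1, ← Finset.smul_sum]
    congr 1
    by_cases hqN : q ≤ N
    · simp only [if_pos hqN]
      rw [← expCoeff_eq_sum B (by omega), ← expZ_natCast, Nat.cast_sub hqN]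
    · simp only [if_neg hqN, smul_zero, Finset.sum_const_zero]
      rw [expZ_of_neg B (by omega)]
  · rw [expZ_of_neg B (by omega), expZ_of_neg B (by omega)]; simp

lemma comm_expZ_eq_zero {X : Module.End ℂ V} {B : ℕ → Module.End ℂ V}
    (h : ∀ p, p ≠ 0 → X * B p - B p * X = 0) (N : ℤ) :
    X * expZ B N - expZ B N * X = 0 := by
  have := comm_expZ (X := X) (B := B) (q := 1) (c := 0) one_ne_zero (fun p hp => by
    rw [h p hp, zero_smul, ite_self]) N
  rwa [zero_smul] at this

/-- The coefficients of the exponential of a scalar series. -/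
def sexp (f : ℕ → ℂ) (N : ℕ) : ℂ :=
  ∑ k ∈ Finset.range (N + 1), (k.factorial : ℂ)⁻¹ * PowerSeries.coeff N (expSeries f ^ k)

lemma sexp_eq_sum (f : ℕ → ℂ) {N K : ℕ} (h : N < K) :
    sexp f N = ∑ k ∈ Finset.range K, (k.factorial : ℂ)⁻¹ * PowerSeries.coeff N (expSeries f ^ k) := by
  refine Finset.sum_subset (Finset.range_subset_range.2 h) fun k _ hk => ?_
  rw [Finset.mem_range, not_lt] at hk
  rw [coeff_expSeries_pow_eq_zero f (by omega), mul_zero]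

/-- The action of an exponential on a coherent family. -/
lemma expCoeff_coherent {B : ℕ → Module.End ℂ V} {f : ℕ → ℂ} {E : ℤ → V}
    (h : ∀ p M, p ≠ 0 → B p (E M) = f p • E (M - p)) (N : ℕ) (M : ℤ) :
    expCoeff B N (E M) = sexp f N • E (M - N) := by
  have key : ∀ (k N : ℕ) (M : ℤ), PowerSeries.coeff N (expSeries B ^ k) (E M) =
      PowerSeries.coeff N (expSeries f ^ k) • E (M - N) := by
    intro k
    induction k with
    | zero =>
      intro N M
      rw [pow_zero, pow_zero, PowerSeries.coeff_one, PowerSeries.coeff_one]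
      split_ifs with hN
      · subst hN; simp
      · simp
    | succ k ih =>
      intro N M
      rw [pow_succ, pow_succ, PowerSeries.coeff_mul, PowerSeries.coeff_mul, LinearMap.sum_apply,
        Finset.sum_smul]
      refine Finset.sum_congr rfl fun x hx => ?_
      rw [Finset.HasAntidiagonal.mem_antidiagonal] at hx
      rw [Module.End.mul_apply, coeff_expSeries, coeff_expSeries]
      split_ifs with h0
      · simp
      · rw [h _ _ h0, map_smul, ih, smul_smul, mul_comm (f x.2)]
        congr 2
        rw [← hx]; push_cast; ring
  rw [expCoeff_eq_sum B (Nat.lt_succ_self N), LinearMap.sum_apply, sexp, Finset.sum_smul]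
  refine Finset.sum_congr rfl fun k _ => ?_
  rw [LinearMap.smul_apply, key, smul_smul]

/-- The exponential series satisfies the differential equation `c' = c f'`. -/
lemma sexp_deriv (f : ℕ → ℂ) :
    PowerSeries.derivative (R := ℂ) (PowerSeries.mk (sexp f)) =
      PowerSeries.mk (sexp f) * PowerSeries.derivative (R := ℂ) (expSeries f) := by
  ext N
  rw [PowerSeries.coeff_derivative, PowerSeries.coeff_mk,
    sexp_eq_sum f (K := N + 1 + 1) (by omega), Finset.sum_range_succ', add_mul, Finset.sum_mul,
    pow_zero, PowerSeries.coeff_one, if_neg (Nat.succ_ne_zero N), mul_zero, zero_mul, add_zero,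
    PowerSeries.coeff_mul]
  have h1 : ∀ k ∈ Finset.range (N + 1), ((k + 1).factorial : ℂ)⁻¹ *
      PowerSeries.coeff (N + 1) (expSeries f ^ (k + 1)) * ((N : ℂ) + 1) =
      ∑ x ∈ Finset.HasAntidiagonal.antidiagonal N, (k.factorial : ℂ)⁻¹ *
        PowerSeries.coeff x.1 (expSeries f ^ k) *
        PowerSeries.coeff x.2 (PowerSeries.derivative (R := ℂ) (expSeries f)) := by
    intro k _
    have h2 := PowerSeries.coeff_derivative (expSeries f ^ (k + 1)) N
    rw [PowerSeries.derivative_pow, Nat.add_sub_cancel, mul_assoc,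
      ← map_natCast (PowerSeries.C (R := ℂ)), PowerSeries.coeff_C_mul, PowerSeries.coeff_mul] at h2
    rw [mul_assoc, ← h2, Nat.factorial_succ, Finset.mul_sum, Finset.mul_sum]
    refine Finset.sum_congr rfl fun x _ => ?_
    have : (k : ℂ) + 1 ≠ 0 := by exact_mod_cast Nat.succ_ne_zero k
    push_cast
    field_simp
  rw [Finset.sum_congr rfl h1, Finset.sum_comm]
  refine Finset.sum_congr rfl fun x hx => ?_
  rw [Finset.HasAntidiagonal.mem_antidiagonal] at hx
  rw [PowerSeries.coeff_mk, sexp_eq_sum f (K := N + 1) (by omega), Finset.sum_mul]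

lemma sexp_zero (f : ℕ → ℂ) : sexp f 0 = 1 := by simp [sexp]

/-- The exponent is `-c log (1 - t)`, so these are the coefficients of `(1 - t) ^ (-c)`. The
recursion is the equation `(1 - t) g' = c g`. -/
lemma sexp_succ_mul {f : ℕ → ℂ} {c : ℂ} (h : ∀ p, p ≠ 0 → f p * p = c) (N : ℕ) :
    sexp f (N + 1) * (N + 1) = (c + N) * sexp f N := by
  have hd : PowerSeries.derivative (R := ℂ) (expSeries f) * (1 - PowerSeries.X) =
      PowerSeries.C c := by
    ext1 p
    rw [mul_sub, mul_one, map_sub, PowerSeries.coeff_C]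
    rcases p with _ | p
    · rw [PowerSeries.coeff_zero_mul_X, PowerSeries.coeff_derivative, if_pos rfl,
        coeff_expSeries, if_neg (by omega), ← h 1 one_ne_zero]
      simp
    · rw [PowerSeries.coeff_succ_mul_X, PowerSeries.coeff_derivative, PowerSeries.coeff_derivative,
        coeff_expSeries, coeff_expSeries, if_neg (by omega), if_neg (by omega),
        if_neg (by omega)]
      have := h (p + 1 + 1) (by omega)
      have h2 := h (p + 1) (by omega)
      push_cast at this h2 ⊢
      linear_combination this - h2
  have h1 := congrArg (fun g => PowerSeries.coeff N (g * (1 - PowerSeries.X))) (sexp_deriv f)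
  simp only [mul_assoc, hd] at h1
  rw [PowerSeries.coeff_mul_C, PowerSeries.coeff_mk, mul_sub, mul_one, map_sub] at h1
  rcases N with _ | N
  · rw [PowerSeries.coeff_zero_mul_X, PowerSeries.coeff_derivative, PowerSeries.coeff_mk] at h1
    push_cast at h1 ⊢
    linear_combination h1
  · rw [PowerSeries.coeff_succ_mul_X, PowerSeries.coeff_derivative, PowerSeries.coeff_derivative,
      PowerSeries.coeff_mk, PowerSeries.coeff_mk] at h1
    push_cast at h1 ⊢
    linear_combination h1

end Exp

lemma comm_smul {V : Type*} [AddCommGroup V] [Module ℂ V] (X Y : Module.End ℂ V) (c : ℂ) :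
    X * (c • Y) - (c • Y) * X = c • (X * Y - Y * X) := by
  refine LinearMap.ext fun v => ?_
  simp only [LinearMap.sub_apply, Module.End.mul_apply, LinearMap.smul_apply, map_smul, smul_sub]

/-! ### The Heisenberg algebra on the sum of Fock modules -/

lemma bos_zero (k : ℤ) : bos k 0 = ((k : ℂ) / ((Real.sqrt 2 : ℝ) : ℂ)) • 1 := rfl

lemma bos_pos (k : ℤ) (i : ℕ) :
    bos k (i + 1 : ℕ) = (((i : ℂ) + 1) / 2) • (MvPolynomial.pderiv i).toLinearMap := rfl

lemma bos_neg (k : ℤ) (i : ℕ) :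
    bos k (-((i + 1 : ℕ) : ℤ)) = LinearMap.mulLeft ℂ (MvPolynomial.X i) := rfl

lemma int_cases (p : ℤ) : p = 0 ∨ (∃ i : ℕ, p = (i + 1 : ℕ)) ∨ ∃ i : ℕ, p = -((i + 1 : ℕ) : ℤ) := by
  rcases lt_trichotomy p 0 with h | h | h
  · exact Or.inr (Or.inr ⟨(-p - 1).toNat, by omega⟩)
  · exact Or.inl h
  · exact Or.inr (Or.inl ⟨(p - 1).toNat, by omega⟩)

lemma bos_eq {p : ℤ} (hp : p ≠ 0) (k l : ℤ) : bos k p = bos l p := by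
  rcases int_cases p with rfl | ⟨i, rfl⟩ | ⟨i, rfl⟩
  · exact absurd rfl hp
  · rfl
  · rfl

lemma bos_comm_pos (k : ℤ) (i : ℕ) (q : ℤ) :
    bos k (i + 1 : ℕ) * bos k q - bos k q * bos k (i + 1 : ℕ) =
      if ((i + 1 : ℕ) : ℤ) + q = 0 then ((((i + 1 : ℕ) : ℤ) : ℂ) / 2) • 1 else 0 := by
  rcases int_cases q with rfl | ⟨j, rfl⟩ | ⟨j, rfl⟩
  · rw [bos_zero, if_neg (by omega)]; simp
  · rw [if_neg (by omega), bos_pos, bos_pos]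
    refine LinearMap.ext fun f => ?_
    simp only [LinearMap.sub_apply, Module.End.mul_apply, LinearMap.smul_apply,
      Derivation.coeFn_coe, map_smul, pderiv_comm i j, LinearMap.zero_apply]
    rw [smul_comm, sub_self]
  · rw [bos_pos, bos_neg]
    refine LinearMap.ext fun f => ?_
    by_cases hij : i = j
    · subst hij
      rw [if_pos (by omega)]
      simp only [LinearMap.sub_apply, Module.End.mul_apply, LinearMap.smul_apply,
        LinearMap.mulLeft_apply, Derivation.coeFn_coe, MvPolynomial.pderiv_mul,
        MvPolynomial.pderiv_X_self, Module.End.one_apply, mul_smul_comm]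
      rw [← smul_sub]; push_cast; congr 1; ring
    · rw [if_neg (by omega)]
      simp only [LinearMap.sub_apply, Module.End.mul_apply, LinearMap.smul_apply,
        LinearMap.mulLeft_apply, Derivation.coeFn_coe, MvPolynomial.pderiv_mul,
        MvPolynomial.pderiv_X_of_ne (Ne.symm hij), LinearMap.zero_apply, mul_smul_comm]
      rw [← smul_sub, zero_mul, zero_add, sub_self, smul_zero]

lemma bos_comm (k p q : ℤ) : bos k p * bos k q - bos k q * bos k p =
    if p + q = 0 then ((p : ℂ) / 2) • 1 else 0 := by
  rcases int_cases p with rfl | ⟨i, rfl⟩ | ⟨i, rfl⟩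
  · rw [bos_zero]; simp
  · exact bos_comm_pos k i q
  · rcases int_cases q with rfl | ⟨j, rfl⟩ | ⟨j, rfl⟩
    · rw [bos_zero, if_neg (by omega)]; simp
    · rw [← neg_sub, bos_comm_pos]
      by_cases hij : i = j
      · subst hij
        rw [if_pos (by omega), if_pos (by omega)]; push_cast; module
      · rw [if_neg (by omega), if_neg (by omega), neg_zero]
    · rw [if_neg (by omega), bos_neg, bos_neg]
      refine LinearMap.ext fun f => ?_
      simp [mul_left_comm]

lemma heis_apply (m : ℤ) (v : FockSum) (k : ℤ) : heis m v k = bos k m (v k) :=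
  onSectors_apply _ _ _

lemma heis_single (m k : ℤ) (f : Pol) :
    heis m (Finsupp.single k f) = Finsupp.single k (bos k m f) := onSectors_single _ _ _

/-- The Heisenberg algebra acting on `⊕ F̄(k)`. -/
def fockOsc : Oscillators FockSum where
  a := heis
  ω p := (p : ℂ) / 2
  comm p q := by
    refine LinearMap.ext fun v => Finsupp.ext fun k => ?_
    have := congrArg (fun T : Module.End ℂ Pol => T (v k)) (bos_comm k p q)
    simp only [LinearMap.sub_apply, Module.End.mul_apply, Finsupp.sub_apply, heis_apply] at this ⊢
    rw [this]
    split_ifs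
    · rfl
    · rfl
  fin := exists_heis_eq_zero
  ω_neg p := by push_cast; ring

lemma fockOsc_a (p : ℤ) : fockOsc.a p = heis p := rfl

/-! ### Vertex operators -/

/-- The vertex operator with shift `e`; `e = 1` gives `psi`, `e = -1` gives `psiStar`. -/
def vertexOp (e m : ℤ) : Module.End ℂ FockSum :=
  (Finsupp.domLCongr (Equiv.addRight e)).toLinearMap ∘ₗ onSectors fun k => vertexCoeff e k (-(m + 1))

lemma psi_eq (m : ℤ) : psi m = vertexOp 1 m := rfl

lemma psiStar_eq (m : ℤ) : psiStar m = vertexOp (-1) m := by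
  unfold psiStar vertexOp shiftS
  rw [Finsupp.domLCongr_symm, Equiv.addRight_symm]

lemma vertexOp_apply (e m : ℤ) (v : FockSum) (k : ℤ) :
    vertexOp e m v k = vertexCoeff e (k - e) (-(m + 1)) (v (k - e)) := by
  unfold vertexOp
  rw [LinearMap.comp_apply, LinearEquiv.coe_coe, Finsupp.domLCongr_apply, Finsupp.domCongr_apply,
    Finsupp.equivMapDomain_apply, onSectors_apply, Equiv.addRight_symm, sub_eq_add_neg]
  rfl

lemma vertexOp_single (e m k : ℤ) (f : Pol) : vertexOp e m (Finsupp.single k f) =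
    Finsupp.single (k + e) (vertexCoeff e k (-(m + 1)) f) := by
  unfold vertexOp
  rw [LinearMap.comp_apply, onSectors_single, LinearEquiv.coe_coe, Finsupp.domLCongr_single]
  rfl

/-- The creation part of the vertex operator. -/
def cre (e M : ℤ) : Module.End ℂ Pol :=
  expZ (fun p => ((e : ℂ) * (((p : ℂ) / 2) * ((Real.sqrt 2 : ℝ) : ℂ))⁻¹) • bos 0 (-(p : ℤ))) M

/-- The annihilation part of the vertex operator. -/
def ann (e N : ℤ) : Module.End ℂ Pol :=
  expZ (fun p => ((e : ℂ) * (-((p : ℂ) / 2) * ((Real.sqrt 2 : ℝ) : ℂ))⁻¹) • bos 0 (p : ℤ)) N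

lemma expSeries_congr {R : Type*} [Semiring R] {B B' : ℕ → R} (h : ∀ p, p ≠ 0 → B p = B' p) :
    expSeries B = expSeries B' := by
  ext1 p
  rw [coeff_expSeries, coeff_expSeries]
  split_ifs with hp
  · rfl
  · exact h p hp

lemma expCoeff_congr {V : Type*} [AddCommGroup V] [Module ℂ V] {B B' : ℕ → Module.End ℂ V}
    (h : ∀ p, p ≠ 0 → B p = B' p) (N : ℕ) : expCoeff B N = expCoeff B' N := by
  rw [expCoeff_eq_sum B (Nat.lt_succ_self N), expSeries_congr h, ← expCoeff_eq_sum B'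
    (Nat.lt_succ_self N)]

lemma creExp_eq (e k : ℤ) (M : ℕ) : creExp e k M = cre e M := by
  rw [cre, expZ_natCast]
  exact expCoeff_congr (fun p hp => by rw [bos_eq (by omega) k 0]) M

lemma annExp_eq (e k : ℤ) (N : ℕ) : annExp e k N = ann e N := by
  rw [ann, expZ_natCast]
  exact expCoeff_congr (fun p hp => by rw [bos_eq (by omega) k 0]) N

lemma ann_eventually_zero (e : ℤ) (f : Pol) : ∃ D : ℤ, ∀ N, D ≤ N → ann e N f = 0 := by
  obtain ⟨D, hD⟩ := exists_mem_lowWeight f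
  refine ⟨D, fun N hN => ?_⟩
  lift N to ℕ using by omega
  have hm := annExp_mem_lowWeight e 0 N D hD
  rwa [Nat.sub_eq_zero_of_le (by omega), lowWeight_zero, Submodule.mem_bot, annExp_eq] at hm

lemma cre_of_neg (e : ℤ) {M : ℤ} (h : M < 0) : cre e M = 0 := expZ_of_neg _ h

lemma ann_of_neg (e : ℤ) {N : ℤ} (h : N < 0) : ann e N = 0 := expZ_of_neg _ h

lemma cre_ann_finite (e C : ℤ) (f : Pol) :
    (Function.support fun N : ℤ => cre e (C + N) (ann e N f)).Finite := by
  obtain ⟨D, hD⟩ := ann_eventually_zero e f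
  refine (Set.finite_Icc 0 D).subset fun N hN => ?_
  by_contra hc
  rw [Set.mem_Icc, not_and_or] at hc
  apply hN
  rcases hc with hc | hc
  · simp only [ann_of_neg e (not_le.1 hc), LinearMap.zero_apply, map_zero]
  · simp only [hD N (by omega), map_zero]

/-- The index `M` of the creation part is determined by `N`. Letting `N` run over all integers, with
zero coefficients at negative indices, allows the summation index to be shifted freely. -/
lemma vertexCoeff_apply (e k E : ℤ) (f : Pol) :
    vertexCoeff e k E f = ∑ᶠ N : ℤ, cre e (E - e * k + N) (ann e N f) := by
  change ∑ᶠ x : ℕ × ℕ, vertexTerm e k E x f = _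
  have h1 : ∑ᶠ x : ℕ × ℕ, vertexTerm e k E x f =
      ∑ᶠ x ∈ {x : ℕ × ℕ | e * k + x.1 - x.2 = E}, vertexTerm e k E x f := by
    rw [finsum_mem_def]
    refine finsum_congr fun x => ?_
    by_cases h : e * k + x.1 - x.2 = E
    · exact (Set.indicator_of_mem (s := {x : ℕ × ℕ | e * k + x.1 - x.2 = E}) h
        fun x => vertexTerm e k E x f).symm
    · rw [Set.indicator_of_notMem (s := {x : ℕ × ℕ | e * k + x.1 - x.2 = E}) h, vertexTerm,
        if_neg h, LinearMap.zero_apply]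
  have h2 : ∑ᶠ N : ℤ, cre e (E - e * k + N) (ann e N f) =
      ∑ᶠ N ∈ {N : ℤ | 0 ≤ N ∧ 0 ≤ E - e * k + N}, cre e (E - e * k + N) (ann e N f) := by
    rw [finsum_mem_def]
    refine finsum_congr fun N => ?_
    by_cases h : 0 ≤ N ∧ 0 ≤ E - e * k + N
    · exact (Set.indicator_of_mem (s := {N : ℤ | 0 ≤ N ∧ 0 ≤ E - e * k + N}) h
        fun N => cre e (E - e * k + N) (ann e N f)).symm
    · rw [Set.indicator_of_notMem (s := {N : ℤ | 0 ≤ N ∧ 0 ≤ E - e * k + N}) h]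
      rcases not_and_or.1 h with h | h
      · rw [ann_of_neg e (not_le.1 h), LinearMap.zero_apply, map_zero]
      · rw [cre_of_neg e (not_le.1 h), LinearMap.zero_apply]
  rw [h1, h2]
  refine finsum_mem_eq_of_bijOn (fun x => (x.2 : ℤ)) ⟨?_, ?_, ?_⟩ ?_
  · intro x hx
    have : e * k + x.1 - x.2 = E := hx
    refine ⟨Int.natCast_nonneg _, ?_⟩
    change 0 ≤ E - e * k + (x.2 : ℤ)
    omega
  · intro x hx y hy hxy
    have h3 : e * k + x.1 - x.2 = E := hx
    have h4 : e * k + y.1 - y.2 = E := hy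
    have h5 : (x.2 : ℤ) = y.2 := hxy
    refine Prod.ext ?_ ?_ <;> omega
  · intro N hN
    obtain ⟨h3, h4⟩ : 0 ≤ N ∧ 0 ≤ E - e * k + N := hN
    refine ⟨((E - e * k + N).toNat, N.toNat), ?_, ?_⟩
    · change e * k + ((E - e * k + N).toNat : ℤ) - (N.toNat : ℤ) = E
      omega
    · change (N.toNat : ℤ) = N
      omega
  · intro x hx
    have h3 : e * k + x.1 - x.2 = E := hx
    rw [vertexTerm, if_pos h3, Module.End.mul_apply, creExp_eq, annExp_eq,
      show E - e * k + (x.2 : ℤ) = x.1 by omega]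

/-- The charge of the vertex operator with shift `e`. -/
def vcharge (e : ℤ) : ℂ := (e : ℂ) / ((Real.sqrt 2 : ℝ) : ℂ)

lemma bos_cre_comm (e : ℤ) {q : ℤ} (hq : 0 < q) (M : ℤ) :
    bos 0 q * cre e M - cre e M * bos 0 q = vcharge e • cre e (M - q) := by
  lift q to ℕ using hq.le
  have hq0 : q ≠ 0 := by omega
  refine comm_expZ hq0 (fun p hp => ?_) M
  rw [comm_smul, bos_comm]
  by_cases h : p = q
  · subst h
    rw [if_pos (by omega), if_pos rfl, smul_smul]
    congr 1
    have : (p : ℂ) ≠ 0 := by exact_mod_cast hp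
    have h2 := sqrt_two_ne_zero
    rw [vcharge]; push_cast; field_simp
  · rw [if_neg (by omega), if_neg h, smul_zero]

lemma bos_cre_comm_neg (e : ℤ) {q : ℤ} (hq : q < 0) (M : ℤ) :
    bos 0 q * cre e M = cre e M * bos 0 q := by
  rw [← sub_eq_zero]
  refine comm_expZ_eq_zero (fun p hp => ?_) M
  rw [comm_smul, bos_comm, if_neg (by omega), smul_zero]

lemma bos_ann_comm (e : ℤ) {q : ℤ} (hq : 0 < q) (N : ℤ) :
    bos 0 (-q) * ann e N - ann e N * bos 0 (-q) = vcharge e • ann e (N - q) := by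
  lift q to ℕ using hq.le
  have hq0 : q ≠ 0 := by omega
  refine comm_expZ hq0 (fun p hp => ?_) N
  rw [comm_smul, bos_comm]
  by_cases h : p = q
  · subst h
    rw [if_pos (by omega), if_pos rfl, smul_smul]
    congr 1
    have : (p : ℂ) ≠ 0 := by exact_mod_cast hp
    have h2 := sqrt_two_ne_zero
    rw [vcharge]; push_cast; field_simp
  · rw [if_neg (by omega), if_neg h, smul_zero]

lemma bos_ann_comm_pos (e : ℤ) {q : ℤ} (hq : 0 < q) (N : ℤ) :
    bos 0 q * ann e N = ann e N * bos 0 q := by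
  rw [← sub_eq_zero]
  refine comm_expZ_eq_zero (fun p hp => ?_) N
  rw [comm_smul, bos_comm, if_neg (by omega), smul_zero]

/-- A creation mode fails to commute only with the annihilation exponential, and conversely. In the
first case the shift of `E` appears after a change of the summation index. -/
lemma bos_vertexCoeff_comm (e k E : ℤ) {q : ℤ} (hq : q ≠ 0) :
    bos 0 q * vertexCoeff e k E - vertexCoeff e k E * bos 0 q =
      vcharge e • vertexCoeff e k (E - q) := by
  refine LinearMap.ext fun f => ?_
  have hfin : (Function.support fun N : ℤ =>
      bos 0 q (cre e (E - e * k + N) (ann e N f))).Finite :=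
    (cre_ann_finite e (E - e * k) f).subset (Function.support_comp_subset (map_zero (bos 0 q)) _)
  simp only [LinearMap.sub_apply, Module.End.mul_apply, LinearMap.smul_apply, vertexCoeff_apply]
  rw [map_finsum (bos 0 q) (cre_ann_finite e (E - e * k) f),
    ← finsum_sub_distrib hfin (cre_ann_finite e (E - e * k) _)]
  rcases lt_or_gt_of_ne hq with h | h
  · have h1 : ∀ N : ℤ, bos 0 q (cre e (E - e * k + N) (ann e N f)) -
        cre e (E - e * k + N) (ann e N (bos 0 q f)) =
        vcharge e • cre e (E - e * k + N) (ann e (N - -q) f) := by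
      intro N
      have h2 := congrArg (fun T : Module.End ℂ Pol => T (ann e N f))
        (bos_cre_comm_neg e h (E - e * k + N))
      have h3 := congrArg (fun T : Module.End ℂ Pol => T f)
        (bos_ann_comm e (q := -q) (by omega) N)
      simp only [Module.End.mul_apply, LinearMap.sub_apply, neg_neg, LinearMap.smul_apply] at h2 h3
      rw [h2, ← map_sub, h3, map_smul]
    simp only [h1]
    rw [← smul_finsum' _ (by
        have := (cre_ann_finite e (E - e * k - q) f).preimage
          (f := fun N : ℤ => N - -q) (fun a _ b _ hab => by simpa using hab)
        refine this.subset fun N hN => ?_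
        rw [Set.mem_preimage, Function.mem_support,
          show E - e * k - q + (N - -q) = E - e * k + N by ring]
        exact hN),
      ← finsum_comp_equiv (Equiv.addRight (-q))]
    congr 1
    refine finsum_congr fun N => ?_
    rw [Equiv.coe_addRight, add_sub_cancel_right]
    congr 2; ring
  · have h1 : ∀ N : ℤ, bos 0 q (cre e (E - e * k + N) (ann e N f)) -
        cre e (E - e * k + N) (ann e N (bos 0 q f)) =
        vcharge e • cre e (E - q - e * k + N) (ann e N f) := by
      intro N
      have h2 := congrArg (fun T : Module.End ℂ Pol => T (ann e N f))
        (bos_cre_comm e h (E - e * k + N))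
      have h3 := congrArg (fun T : Module.End ℂ Pol => T f) (bos_ann_comm_pos e h N)
      simp only [Module.End.mul_apply, LinearMap.sub_apply, LinearMap.smul_apply] at h2 h3
      rw [← h3, h2]
      congr 3; ring
    simp only [h1]
    rw [← smul_finsum' _ (cre_ann_finite e (E - q - e * k) f)]

lemma heis_vertexOp_comm (e m q : ℤ) :
    heis q * vertexOp e m - vertexOp e m * heis q = vcharge e • vertexOp e (m + q) := by
  refine LinearMap.ext fun v => Finsupp.ext fun k => ?_
  simp only [LinearMap.sub_apply, Module.End.mul_apply, LinearMap.smul_apply, Finsupp.sub_apply,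
    Finsupp.smul_apply, heis_apply, vertexOp_apply]
  -- The zero mode sees only the difference of charges between source and target sector.
  by_cases hq : q = 0
  · subst hq
    rw [bos_zero, bos_zero, LinearMap.smul_apply, LinearMap.smul_apply, map_smul,
      Module.End.one_apply, Module.End.one_apply, ← sub_smul, add_zero, vcharge]
    congr 1
    push_cast; ring
  · have := congrArg (fun T : Module.End ℂ Pol => T (v (k - e)))
      (bos_vertexCoeff_comm e (k - e) (-(m + 1)) hq)
    simp only [LinearMap.sub_apply, Module.End.mul_apply, LinearMap.smul_apply] at this
    rw [bos_eq hq k 0, bos_eq hq (k - e) 0, this]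
    congr 3; ring

/-! ### Vacuum coefficients of vertex operators -/

lemma expZ_apply_of_kill {V : Type*} [AddCommGroup V] [Module ℂ V] {B : ℕ → Module.End ℂ V} {v : V}
    (h : ∀ p, p ≠ 0 → B p v = 0) {N : ℤ} (hN : N ≠ 0) : expZ B N v = 0 := by
  rcases lt_or_gt_of_ne hN with h0 | h0
  · rw [expZ_of_neg B h0, LinearMap.zero_apply]
  lift N to ℕ using h0.le
  rw [expZ_natCast, expCoeff_eq_sum B (Nat.lt_succ_self N), LinearMap.sum_apply]
  refine Finset.sum_eq_zero fun k _ => ?_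
  rw [LinearMap.smul_apply]
  rcases k with _ | k
  · rw [pow_zero, PowerSeries.coeff_one, if_neg (by omega), LinearMap.zero_apply, smul_zero]
  · rw [pow_succ, PowerSeries.coeff_mul, LinearMap.sum_apply, Finset.sum_eq_zero, smul_zero]
    intro x _
    rw [Module.End.mul_apply, coeff_expSeries]
    split_ifs with h2
    · rw [LinearMap.zero_apply, map_zero]
    · rw [h _ h2, map_zero]

lemma apply_expZ_of_kill {V : Type*} [AddCommGroup V] [Module ℂ V] {B : ℕ → Module.End ℂ V}
    {φ : V →ₗ[ℂ] ℂ} (h : ∀ p v, p ≠ 0 → φ (B p v) = 0) {N : ℤ} (hN : N ≠ 0) (v : V) :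
    φ (expZ B N v) = 0 := by
  rcases lt_or_gt_of_ne hN with h0 | h0
  · rw [expZ_of_neg B h0, LinearMap.zero_apply, map_zero]
  lift N to ℕ using h0.le
  rw [expZ_natCast, expCoeff_eq_sum B (Nat.lt_succ_self N), LinearMap.sum_apply, map_sum]
  refine Finset.sum_eq_zero fun k _ => ?_
  rw [LinearMap.smul_apply, map_smul]
  rcases k with _ | k
  · rw [pow_zero, PowerSeries.coeff_one, if_neg (by omega), LinearMap.zero_apply, map_zero,
      smul_zero]
  · rw [pow_succ', PowerSeries.coeff_mul, LinearMap.sum_apply, map_sum, Finset.sum_eq_zero,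
      smul_zero]
    intro x _
    rw [Module.End.mul_apply, coeff_expSeries]
    split_ifs with h2
    · rw [LinearMap.zero_apply, map_zero]
    · rw [h _ _ h2]

lemma bos_one_of_pos (k : ℤ) {p : ℤ} (hp : 0 < p) : bos k p 1 = 0 := by
  rcases int_cases p with rfl | ⟨i, rfl⟩ | ⟨i, rfl⟩
  · omega
  · rw [bos_pos]; simp
  · omega

lemma constantCoeff_bos_of_neg (k : ℤ) {p : ℤ} (hp : p < 0) (f : Pol) :
    MvPolynomial.constantCoeff (bos k p f) = 0 := by
  rcases int_cases p with rfl | ⟨i, rfl⟩ | ⟨i, rfl⟩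
  · omega
  · omega
  · rw [bos_neg]; simp

lemma ann_one (e : ℤ) {N : ℤ} (hN : N ≠ 0) : ann e N 1 = 0 :=
  expZ_apply_of_kill (fun p hp => by
    rw [LinearMap.smul_apply, bos_one_of_pos 0 (by omega), smul_zero]) hN

lemma constantCoeff_cre (e : ℤ) {M : ℤ} (hM : M ≠ 0) (f : Pol) :
    MvPolynomial.constantCoeff (cre e M f) = 0 :=
  apply_expZ_of_kill (φ := MvPolynomial.lcoeff ℂ 0) (fun p v hp => by
    rw [LinearMap.smul_apply, map_smul]
    exact (congrArg _ (constantCoeff_bos_of_neg 0 (by omega) v)).trans (smul_zero _)) hM f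

lemma cre_zero (e : ℤ) : cre e 0 = 1 := expZ_zero _

lemma ann_zero (e : ℤ) : ann e 0 = 1 := expZ_zero _

lemma vertexCoeff_one (e k E : ℤ) : vertexCoeff e k E 1 = cre e (E - e * k) 1 := by
  rw [vertexCoeff_apply, finsum_eq_single _ 0 fun N hN => by rw [ann_one e hN, map_zero], ann_zero,
    add_zero, Module.End.one_apply]

lemma bos_cre_one (e : ℤ) {q : ℤ} (hq : 0 < q) (M : ℤ) :
    bos 0 q (cre e M 1) = vcharge e • cre e (M - q) 1 := by
  have := congrArg (fun T : Module.End ℂ Pol => T 1) (bos_cre_comm e hq M)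
  simpa only [LinearMap.sub_apply, Module.End.mul_apply, LinearMap.smul_apply,
    bos_one_of_pos 0 hq, map_zero, sub_zero] using this

/-- The scalar exponent obtained by moving annihilation operators through creation operators. -/
def contraction (e e' : ℤ) (p : ℕ) : ℂ :=
  ((e : ℂ) * (-((p : ℂ) / 2) * ((Real.sqrt 2 : ℝ) : ℂ))⁻¹) * vcharge e'

lemma contraction_mul (e e' : ℤ) (p : ℕ) (hp : p ≠ 0) :
    contraction e e' p * p = -((e * e' : ℤ) : ℂ) := by
  have h1 : (p : ℂ) ≠ 0 := by exact_mod_cast hp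
  have h2 := sqrt_two_ne_zero
  have h3 := sqrt_two_mul_self
  rw [contraction, vcharge]
  push_cast
  field_simp
  linear_combination ((e : ℂ) * e') * h3

/-- The generating series of the vectors `cre e' M 1` is a coherent state, a common eigenvector of
the annihilation operators, so the exponential acts on it by a scalar series. -/
lemma ann_cre_one (e e' : ℤ) (N : ℕ) (M : ℤ) :
    ann e N (cre e' M 1) = sexp (contraction e e') N • cre e' (M - N) 1 := by
  rw [ann, expZ_natCast]
  refine expCoeff_coherent (E := fun M => cre e' M 1) (fun p M hp => ?_) N M
  rw [LinearMap.smul_apply, bos_cre_one e' (by omega), smul_smul, contraction]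

/-- The scalar series is `(1 - t) ^ (e * e')`, here `1 - t`. -/
lemma sexp_same {e e' : ℤ} (h : e * e' = 1) (N : ℕ) :
    sexp (contraction e e') N = if N = 0 then 1 else if N = 1 then -1 else 0 := by
  have hs := sexp_succ_mul (contraction_mul e e')
  rw [h] at hs
  induction N with
  | zero => rw [sexp_zero, if_pos rfl]
  | succ N ih =>
    have h1 : (N : ℂ) + 1 ≠ 0 := by exact_mod_cast Nat.succ_ne_zero N
    refine mul_right_cancel₀ h1 ?_
    rw [hs, ih, if_neg (Nat.succ_ne_zero N)]
    rcases N with _ | _ | N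
    · norm_num
    · norm_num
    · rw [if_neg (by omega), if_neg (by omega), if_neg (by omega), mul_zero, zero_mul]

/-- Here the scalar series is the geometric series `1 / (1 - t)`. -/
lemma sexp_opposite {e e' : ℤ} (h : e * e' = -1) (N : ℕ) : sexp (contraction e e') N = 1 := by
  have hs := sexp_succ_mul (contraction_mul e e')
  rw [h] at hs
  induction N with
  | zero => rw [sexp_zero]
  | succ N ih =>
    have h1 : (N : ℂ) + 1 ≠ 0 := by exact_mod_cast Nat.succ_ne_zero N
    refine mul_right_cancel₀ h1 ?_
    rw [hs, ih]
    push_cast; ring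

lemma constantCoeff_cre_one (e M : ℤ) :
    MvPolynomial.constantCoeff (cre e M 1) = if M = 0 then 1 else 0 := by
  split_ifs with h
  · subst h; rw [cre_zero, Module.End.one_apply, map_one]
  · exact constantCoeff_cre e h 1

lemma constantCoeff_vertexCoeff (e k E : ℤ) (f : Pol) :
    MvPolynomial.constantCoeff (vertexCoeff e k E f) =
      MvPolynomial.constantCoeff (ann e (e * k - E) f) := by
  rw [vertexCoeff_apply]
  change (MvPolynomial.constantCoeff : Pol →+* ℂ).toAddMonoidHom _ = _
  rw [AddMonoidHom.map_finsum _ (cre_ann_finite e (E - e * k) f), finsum_eq_single _ (e * k - E)]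
  · rw [show E - e * k + (e * k - E) = 0 by ring, cre_zero]; rfl
  · intro N hN
    exact constantCoeff_cre e (by omega) _

lemma constantCoeff_vertexCoeff_cre (e e' k E M : ℤ) :
    MvPolynomial.constantCoeff (vertexCoeff e k E (cre e' M 1)) =
      if M = e * k - E ∧ 0 ≤ M then sexp (contraction e e') M.toNat else 0 := by
  rw [constantCoeff_vertexCoeff]
  by_cases hb : 0 ≤ e * k - E
  · obtain ⟨b, hb'⟩ := Int.eq_ofNat_of_zero_le hb
    rw [hb', ann_cre_one, MvPolynomial.constantCoeff_smul, constantCoeff_cre_one, smul_eq_mul]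
    by_cases hM : M = b
    · rw [if_pos (by omega), if_pos (by omega), mul_one]
      congr 1; omega
    · rw [if_neg (by omega), if_neg (by omega), mul_zero]
  · rw [ann_of_neg e (by omega), if_neg (by omega), LinearMap.zero_apply, map_zero]

/-! ### Operators determined by their vacuum coefficients -/

/-- Annihilation operators kill the vacuum, so a derivative of `T (vac k)` is, up to a nonzero
factor, a commutator applied to `vac k`. Every coefficient is thus reduced to a constant coefficient
for another member of the family. -/
lemma fockSum_eq_zero_of_coeff {S : Submodule ℂ (Module.End ℂ FockSum)}
    (hS : ∀ T ∈ S, ∀ q : ℤ, q ≠ 0 → heis q * T - T * heis q ∈ S)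
    (h0 : ∀ T ∈ S, ∀ k j, MvPolynomial.constantCoeff (T (vac k) j) = 0) :
    ∀ T ∈ S, ∀ k, T (vac k) = 0 := by
  have key : ∀ (n : ℕ) (s : ℕ →₀ ℕ), s.degree = n → ∀ T ∈ S, ∀ k j,
      MvPolynomial.coeff s (T (vac k) j) = 0 := by
    intro n
    induction n with
    | zero =>
      intro s hs T hT k j
      rw [Finsupp.degree_eq_zero_iff] at hs
      subst hs
      exact h0 T hT k j
    | succ n ih =>
      intro s hs T hT k j
      obtain ⟨i, hi⟩ : ∃ i, s i ≠ 0 := by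
        by_contra hc
        push Not at hc
        rw [show s = 0 from Finsupp.ext hc, map_zero] at hs
        omega
      have hle : Finsupp.single i 1 ≤ s := by
        rw [Finsupp.single_le_iff]; omega
      have hdeg : (s - Finsupp.single i 1).degree = n := by
        have := congrArg Finsupp.degree (tsub_add_cancel_of_le hle)
        rw [map_add, Finsupp.degree_single] at this
        omega
      have h1 := ih _ hdeg _ (hS T hT (i + 1 : ℕ) (by omega)) k j
      have h2 : heis (i + 1 : ℕ) (vac k) = 0 := by
        rw [vac, heis_single, bos_one_of_pos k (by omega), Finsupp.single_zero]
      rw [LinearMap.sub_apply, Module.End.mul_apply, Module.End.mul_apply, h2, map_zero, sub_zero,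
        heis_apply, bos_pos, LinearMap.smul_apply, MvPolynomial.coeff_smul, smul_eq_mul] at h1
      have h3 : ((i : ℂ) + 1) / 2 ≠ 0 :=
        div_ne_zero (by exact_mod_cast Nat.succ_ne_zero i) two_ne_zero
      have h4 := (mul_eq_zero.mp h1).resolve_left h3
      rw [Derivation.coeFn_coe, MvPolynomial.coeff_pderiv, tsub_add_cancel_of_le hle] at h4
      refine (mul_eq_zero.mp h4).resolve_right ?_
      exact_mod_cast Nat.succ_ne_zero ((s - Finsupp.single i 1 : ℕ →₀ ℕ) i)
  intro T hT k
  ext j s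
  exact key _ s rfl T hT k j

lemma comm_mem_span {V : Type*} [AddCommGroup V] [Module ℂ V] {H : Module.End ℂ V}
    {𝒯 : Set (Module.End ℂ V)} (h : ∀ T ∈ 𝒯, H * T - T * H ∈ Submodule.span ℂ 𝒯)
    {T : Module.End ℂ V} (hT : T ∈ Submodule.span ℂ 𝒯) :
    H * T - T * H ∈ Submodule.span ℂ 𝒯 := by
  induction hT using Submodule.span_induction with
  | zero => simp
  | mem T hT => exact h T hT
  | add T T' _ _ h h' => rw [mul_add, add_mul, add_sub_add_comm]; exact add_mem h h'
  | smul c T _ h => rw [comm_smul]; exact Submodule.smul_mem _ c h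

/-- A family of operators that is stable under commutators with the nonzero modes and has
vanishing vacuum coefficients vanishes. -/
lemma eq_zero_of_vacuum {𝒯 : Set (Module.End ℂ FockSum)}
    (hS : ∀ T ∈ 𝒯, ∀ q : ℤ, q ≠ 0 → heis q * T - T * heis q ∈ Submodule.span ℂ 𝒯)
    (h0 : ∀ T ∈ 𝒯, ∀ k j, MvPolynomial.constantCoeff (T (vac k) j) = 0)
    {T : Module.End ℂ FockSum} (hT : T ∈ 𝒯) : T = 0 := by
  have hS' : ∀ T ∈ Submodule.span ℂ 𝒯, ∀ q : ℤ, q ≠ 0 →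
      heis q * T - T * heis q ∈ Submodule.span ℂ 𝒯 := by
    intro T hT q hq
    exact comm_mem_span (fun T hT => hS T hT q hq) hT
  have h0' : ∀ T ∈ Submodule.span ℂ 𝒯, ∀ k j,
      MvPolynomial.constantCoeff (T (vac k) j) = 0 := by
    intro T hT k j
    induction hT using Submodule.span_induction with
    | zero => simp
    | mem T hT => exact h0 T hT k j
    | add T T' _ _ h h' => rw [LinearMap.add_apply, Finsupp.add_apply, map_add, h, h', add_zero]
    | smul c T _ h =>
      rw [LinearMap.smul_apply, Finsupp.smul_apply, MvPolynomial.constantCoeff_smul, h, smul_zero]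
  have hvac := fockSum_eq_zero_of_coeff hS' h0'
  have key : ∀ (k : ℤ) (f : Pol), ∀ T ∈ Submodule.span ℂ 𝒯, T (Finsupp.single k f) = 0 := by
    intro k f
    induction f using MvPolynomial.induction_on with
    | C a =>
      intro T hT
      rw [← mul_one (MvPolynomial.C a), ← MvPolynomial.smul_eq_C_mul, ← Finsupp.smul_single,
        map_smul]
      have := hvac T hT k
      rw [vac] at this
      rw [this, smul_zero]
    | add f g hf hg => intro T hT; rw [Finsupp.single_add, map_add, hf T hT, hg T hT, add_zero]
    | mul_X f i hf =>
      intro T hT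
      -- A commutator with a creation operator stays in the family, so vanishing on `f` gives
      -- vanishing on the product of `f` with a variable.
      have h1 := hf _ (hS' T hT (-((i + 1 : ℕ) : ℤ)) (by omega))
      rw [LinearMap.sub_apply, Module.End.mul_apply, Module.End.mul_apply, hf T hT, map_zero,
        zero_sub, neg_eq_zero, heis_single, bos_neg, LinearMap.mulLeft_apply] at h1
      rw [mul_comm]
      exact h1
  refine Finsupp.lhom_ext fun k f => ?_
  exact key k f T (Submodule.subset_span hT)

/-! ### Anticommutation relations -/

/-- The defect of the anticommutation relations. -/
def anticommDefect (e e' m n : ℤ) : Module.End ℂ FockSum :=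
  vertexOp e m * vertexOp e' n + vertexOp e' n * vertexOp e m -
    (if e + e' = 0 ∧ m + n + 1 = 0 then (1 : ℂ) else 0) • 1

lemma vertexOp_vac (e m k : ℤ) :
    vertexOp e m (vac k) = Finsupp.single (k + e) (cre e (-(m + 1) - e * k) 1) := by
  rw [vac, vertexOp_single, vertexCoeff_one]

lemma comm_anticomm {V : Type*} [AddCommGroup V] [Module ℂ V] {H A A' B B' : Module.End ℂ V}
    {a b x y z : ℂ} (hA : H * A - A * H = a • A') (hB : H * B - B * H = b • B')
    (h : b * z = -(a * y)) :
    H * (A * B + B * A - x • 1) - (A * B + B * A - x • 1) * H =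
      a • (A' * B + B * A' - y • 1) + b • (A * B' + B' * A - z • 1) := by
  have hA' : H * A = A * H + a • A' := by rw [← hA]; abel
  have hB' : H * B = B * H + b • B' := by rw [← hB]; abel
  have h2 : H * (A * B) = A * B * H + a • (A' * B) + b • (A * B') := by
    rw [← mul_assoc, hA', add_mul, mul_assoc, hB', mul_add, smul_mul_assoc, mul_smul_comm,
      ← mul_assoc]
    abel
  have h3 : H * (B * A) = B * A * H + a • (B * A') + b • (B' * A) := by
    rw [← mul_assoc, hB', add_mul, mul_assoc, hA', mul_add, smul_mul_assoc, mul_smul_comm,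
      ← mul_assoc]
  rw [mul_sub, mul_add, h2, h3, sub_mul, add_mul, mul_smul_comm, smul_mul_assoc, one_mul, mul_one,
    smul_sub, smul_sub, smul_smul, smul_smul, h]
  module

lemma heis_anticommDefect (e e' m n q : ℤ) :
    heis q * anticommDefect e e' m n - anticommDefect e e' m n * heis q =
      vcharge e • anticommDefect e e' (m + q) n + vcharge e' • anticommDefect e e' m (n + q) := by
  refine comm_anticomm (heis_vertexOp_comm e m q) (heis_vertexOp_comm e' n q) ?_
  rw [show m + (n + q) = m + q + n by ring]
  split_ifs with h
  · rw [vcharge, vcharge, show e' = -e by omega]; push_cast; ring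
  · simp

lemma constantCoeff_vertexOp_vertexOp_vac (e e' m n k j : ℤ) :
    MvPolynomial.constantCoeff (vertexOp e m (vertexOp e' n (vac k)) j) =
      if j = k + e' + e then
        if -(n + 1) - e' * k = e * (k + e') + (m + 1) ∧ 0 ≤ -(n + 1) - e' * k then
          sexp (contraction e e') (-(n + 1) - e' * k).toNat else 0
      else 0 := by
  rw [vertexOp_vac, vertexOp_single]
  by_cases h : j = k + e' + e
  · rw [if_pos h, h, Finsupp.single_eq_same, constantCoeff_vertexCoeff_cre, sub_neg_eq_add]
  · rw [if_neg h, Finsupp.single_eq_of_ne h, map_zero]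

/-- By `eq_zero_of_vacuum` it suffices to compare vacuum coefficients, which are read off from the
contractions `(1 - t) ^ (e * e')`. -/
lemma vertexOp_anticomm {e e' : ℤ} (he : e = 1 ∨ e = -1) (he' : e' = 1 ∨ e' = -1) (m n : ℤ) :
    vertexOp e m * vertexOp e' n + vertexOp e' n * vertexOp e m =
      (if e + e' = 0 ∧ m + n + 1 = 0 then (1 : ℂ) else 0) • 1 := by
  rw [← sub_eq_zero]
  refine eq_zero_of_vacuum (𝒯 := {T | ∃ m n, T = anticommDefect e e' m n}) ?_ ?_ ⟨m, n, rfl⟩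
  · rintro T ⟨m, n, rfl⟩ q -
    rw [heis_anticommDefect]
    exact add_mem (Submodule.smul_mem _ _ (Submodule.subset_span ⟨_, _, rfl⟩))
      (Submodule.smul_mem _ _ (Submodule.subset_span ⟨_, _, rfl⟩))
  · rintro T ⟨m, n, rfl⟩ k j
    rw [anticommDefect, LinearMap.sub_apply, LinearMap.add_apply, Module.End.mul_apply,
      Module.End.mul_apply, Finsupp.sub_apply, Finsupp.add_apply, map_sub, map_add,
      constantCoeff_vertexOp_vertexOp_vac, constantCoeff_vertexOp_vertexOp_vac,
      LinearMap.smul_apply, Finsupp.smul_apply, MvPolynomial.constantCoeff_smul,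
      Module.End.one_apply, vac, show k + e + e' = k + e' + e by ring]
    by_cases hj : j = k + e' + e
    · rw [if_pos hj, if_pos hj]
      have hcase : (e * e' = 1 ∧ e = e') ∨ (e * e' = -1 ∧ e' = -e) := by
        rcases he with rfl | rfl <;> rcases he' with rfl | rfl <;> simp
      rcases hcase with ⟨hee, rfl⟩ | ⟨hee, rfl⟩
      · rw [sexp_same hee, sexp_same hee, mul_add, hee, if_neg (c := e + e = 0 ∧ _) (by omega)]
        simp only [zero_smul, sub_zero]
        generalize e * k = x
        split_ifs <;> first | omega | norm_num
      · have hee' : -e * e = -1 := by rw [mul_comm]; exact hee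
        rw [sexp_opposite hee, sexp_opposite hee', hj, show k + -e + e = k by ring,
          Finsupp.single_eq_same, map_one, mul_add, mul_add, hee, hee', neg_mul]
        generalize e * k = x
        split_ifs <;> first | omega | norm_num
    · rw [if_neg hj, if_neg hj, zero_add, zero_sub, neg_eq_zero]
      split_ifs with h
      · rw [Finsupp.single_eq_of_ne (by omega), map_zero, smul_zero]
      · rw [zero_smul]

/-! ### Vertex operators are Virasoro primary fields -/

lemma Oscillators.a_sug_comm {V : Type*} [AddCommGroup V] [Module ℂ V] (A : Oscillators V)
    (p n : ℤ) : A.a p * A.sug n - A.sug n * A.a p = A.ω p • A.a (p + 2 * n) := by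
  rw [← neg_sub, A.sug_comm, neg_smul, neg_neg]

lemma heis_sug_comm (q k : ℤ) :
    heis q * fockOsc.sug k - fockOsc.sug k * heis q = ((q : ℂ) / 2) • heis (q + 2 * k) :=
  fockOsc.a_sug_comm q k

/-- The defect of the commutation relation between Virasoro and vertex operators. -/
def primaryDefect (e k m : ℤ) : Module.End ℂ FockSum :=
  fockOsc.sug k * vertexOp e m - vertexOp e m * fockOsc.sug k -
    (-(m : ℂ) / 2 - (k : ℂ) / 2 - 1 / 4) • vertexOp e (m + 2 * k)

lemma comm_primary {V : Type*} [AddCommGroup V] [Module ℂ V]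
    {H L A A' B B' K : Module.End ℂ V} {a q x y : ℂ} (hA : H * A - A * H = a • A')
    (hB : H * B - B * H = a • B') (hL : H * L - L * H = q • K) (hK : K * A - A * K = a • B')
    (h : y = x - q) :
    H * (L * A - A * L - x • B) - (L * A - A * L - x • B) * H =
      a • (L * A' - A' * L - y • B') := by
  have hA' : H * A = A * H + a • A' := by rw [← hA]; abel
  have hB' : H * B = B * H + a • B' := by rw [← hB]; abel
  have hL' : H * L = L * H + q • K := by rw [← hL]; abel
  have h2 : H * (L * A) = L * A * H + a • (L * A') + q • (K * A) := by
    rw [← mul_assoc, hL', add_mul, mul_assoc, hA', mul_add, smul_mul_assoc, mul_smul_comm,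
      ← mul_assoc]
  have h3 : H * (A * L) = A * L * H + a • (A' * L) + q • (A * K) := by
    rw [← mul_assoc, hA', add_mul, mul_assoc, hL', mul_add, smul_mul_assoc, mul_smul_comm,
      ← mul_assoc]
    abel
  have h4 : K * A = A * K + a • B' := by rw [← hK]; abel
  rw [mul_sub, mul_sub, h2, h3, h4, sub_mul, sub_mul, mul_smul_comm, hB', smul_mul_assoc, h]
  module

lemma heis_primaryDefect (e k m q : ℤ) :
    heis q * primaryDefect e k m - primaryDefect e k m * heis q =
      vcharge e • primaryDefect e k (m + q) := by
  have h := heis_vertexOp_comm e (m + 2 * k) q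
  have h2 := heis_vertexOp_comm e m (q + 2 * k)
  rw [show m + 2 * k + q = m + q + 2 * k by ring] at h
  rw [show m + (q + 2 * k) = m + q + 2 * k by ring] at h2
  refine comm_primary (heis_vertexOp_comm e m q) h (heis_sug_comm q k) h2 ?_
  push_cast; ring

lemma vcharge_sq {e : ℤ} (he : e = 1 ∨ e = -1) : vcharge e * vcharge e = 1 / 2 := by
  have h2 := sqrt_two_ne_zero
  have h3 := sqrt_two_mul_self
  unfold vcharge
  rcases he with rfl | rfl <;> push_cast <;> field_simp <;> linear_combination -h3

/-- The eigenvalues of the annihilation operators on coherent vectors. -/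
def modeCharge (e κ p : ℤ) : ℂ := if p = 0 then vcharge κ else vcharge e

lemma bos_cre_one_of_nonneg (e κ : ℤ) {p : ℤ} (hp : 0 ≤ p) (M : ℤ) :
    bos κ p (cre e M 1) = modeCharge e κ p • cre e (M - p) 1 := by
  unfold modeCharge
  split_ifs with h
  · subst h
    rw [bos_zero, LinearMap.smul_apply, Module.End.one_apply, sub_zero, vcharge]
  · rw [bos_eq h κ 0, bos_cre_one e (by omega)]

/-- The constant coefficient of a normally ordered product on a coherent vector. -/
lemma constantCoeff_no_cre (e κ : ℤ) (p q M : ℤ) :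
    MvPolynomial.constantCoeff (fockOsc.no p q (Finsupp.single κ (cre e M 1)) κ) =
      if 0 ≤ p ∧ 0 ≤ q ∧ M = p + q then modeCharge e κ p * modeCharge e κ q else 0 := by
  have key : ∀ p q : ℤ, p ≤ q → MvPolynomial.constantCoeff (bos κ p (bos κ q (cre e M 1))) =
      if 0 ≤ p ∧ 0 ≤ q ∧ M = p + q then modeCharge e κ p * modeCharge e κ q else 0 := by
    intro p q hpq
    by_cases hp : 0 ≤ p
    · rw [bos_cre_one_of_nonneg e κ (hp.trans hpq), map_smul, bos_cre_one_of_nonneg e κ hp,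
        smul_smul, MvPolynomial.constantCoeff_smul, constantCoeff_cre_one, smul_eq_mul]
      by_cases h : M = p + q
      · rw [if_pos (by omega), if_pos ⟨hp, hp.trans hpq, h⟩, mul_one, mul_comm]
      · rw [if_neg (by omega), if_neg (by omega), mul_zero]
    · rw [constantCoeff_bos_of_neg κ (by omega), if_neg (by omega)]
  unfold Oscillators.no
  by_cases h : p ≤ q
  · rw [if_pos h, Module.End.mul_apply, fockOsc_a, fockOsc_a, heis_single, heis_single,
      Finsupp.single_eq_same, key _ _ h]
  · rw [if_neg h, Module.End.mul_apply, fockOsc_a, fockOsc_a, heis_single, heis_single,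
      Finsupp.single_eq_same, key _ _ (by omega)]
    by_cases h2 : 0 ≤ p ∧ 0 ≤ q ∧ M = p + q
    · rw [if_pos h2, if_pos (by omega), mul_comm]
    · rw [if_neg h2, if_neg (by omega)]

lemma fockOsc_no_apply (p q : ℤ) (v : FockSum) (j : ℤ) :
    fockOsc.no p q v j = if p ≤ q then bos j p (bos j q (v j)) else bos j q (bos j p (v j)) := by
  unfold Oscillators.no
  split_ifs
  · rw [Module.End.mul_apply, fockOsc_a, fockOsc_a, heis_apply, heis_apply]
  · rw [Module.End.mul_apply, fockOsc_a, fockOsc_a, heis_apply, heis_apply]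

lemma sug_apply_sector (k : ℤ) (v : FockSum) (j : ℤ) :
    fockOsc.sug k v j = (1 / 2 : ℂ) • ∑ᶠ p : ℤ, fockOsc.no (2 * k - p) p v j := by
  rw [fockOsc.sug_apply, Finsupp.smul_apply]
  congr 1
  exact AddMonoidHom.map_finsum (Finsupp.applyAddHom j) (fockOsc.no_finite k v)

lemma sug_apply_eq_zero (k : ℤ) {v : FockSum} {j : ℤ} (h : v j = 0) : fockOsc.sug k v j = 0 := by
  rw [sug_apply_sector, finsum_eq_zero_of_forall_eq_zero, smul_zero]
  intro p
  rw [fockOsc_no_apply, h]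
  simp

/-- Nonnegative modes act on the coherent vectors by charges, and a negative mode on the left has no
constant term. Only a finite sum of products of charges remains. -/
lemma constantCoeff_sug_cre {e : ℤ} (he : e = 1 ∨ e = -1) (κ k M : ℤ) (hk : 0 ≤ k) :
    MvPolynomial.constantCoeff (fockOsc.sug k (Finsupp.single κ (cre e M 1)) κ) =
      if M = 2 * k then (if k = 0 then (κ : ℂ) ^ 2 / 4 else (2 * (k : ℂ) - 1 + 2 * e * κ) / 4)
      else 0 := by
  have h2 := sqrt_two_ne_zero
  have h3 := sqrt_two_mul_self
  have hfin : (Function.support fun p : ℤ =>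
      fockOsc.no (2 * k - p) p (Finsupp.single κ (cre e M 1)) κ).Finite :=
    (fockOsc.no_finite k _).subset (Function.support_comp_subset (g := fun v : FockSum => v κ) rfl _)
  have h1 : MvPolynomial.constantCoeff (fockOsc.sug k (Finsupp.single κ (cre e M 1)) κ) =
      1 / 2 * ∑ᶠ p : ℤ, if 0 ≤ 2 * k - p ∧ 0 ≤ p ∧ M = 2 * k - p + p then
        modeCharge e κ (2 * k - p) * modeCharge e κ p else 0 := by
    rw [sug_apply_sector, MvPolynomial.constantCoeff_smul, smul_eq_mul]
    congr 1
    refine (AddMonoidHom.map_finsum (MvPolynomial.constantCoeff : Pol →+* ℂ).toAddMonoidHom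
      hfin).trans (finsum_congr fun p => ?_)
    exact constantCoeff_no_cre e κ _ _ M
  rw [h1]
  by_cases hM : M = 2 * k
  · rw [if_pos hM, finsum_eq_sum_of_support_subset (s := Finset.Icc 0 (2 * k))]
    · split_ifs with hk0
      · subst hk0
        simp [hM, modeCharge, vcharge]
        field_simp
        linear_combination -2 * (κ : ℂ) ^ 2 * h3
      · have h4 : ∀ p ∈ Finset.Icc 0 (2 * k), (if 0 ≤ 2 * k - p ∧ 0 ≤ p ∧ M = 2 * k - p + p then
            modeCharge e κ (2 * k - p) * modeCharge e κ p else 0) = 1 / 2 +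
            ((if p = 0 then vcharge κ * vcharge e - 1 / 2 else 0) +
            if p = 2 * k then vcharge κ * vcharge e - 1 / 2 else 0) := by
          intro p hp
          rw [Finset.mem_Icc] at hp
          have h5 := vcharge_sq he
          rw [if_pos (by omega)]
          unfold modeCharge
          by_cases hp0 : p = 0
          · rw [if_neg (by omega), if_pos hp0, if_pos hp0, if_neg (by omega)]; ring
          · by_cases hp1 : p = 2 * k
            · rw [if_pos (by omega), if_neg hp0, if_neg hp0, if_pos hp1]; ring
            · rw [if_neg (by omega), if_neg hp0, if_neg hp0, if_neg hp1, h5]; ring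
        rw [Finset.sum_congr rfl h4, Finset.sum_add_distrib, Finset.sum_add_distrib,
          Finset.sum_ite_eq' _ _ fun _ => vcharge κ * vcharge e - 1 / 2,
          Finset.sum_ite_eq' _ _ fun _ => vcharge κ * vcharge e - 1 / 2,
          if_pos (Finset.mem_Icc.2 (by omega)), if_pos (Finset.mem_Icc.2 (by omega)),
          Finset.sum_const, Int.card_Icc, nsmul_eq_mul]
        have h6 : (((2 * k + 1 - 0).toNat : ℕ) : ℂ) = 2 * k + 1 := by
          rw [← Int.cast_natCast, Int.toNat_of_nonneg (by omega)]; push_cast; ring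
        have h7 : vcharge κ * vcharge e = κ * e / 2 := by
          unfold vcharge
          field_simp
          linear_combination -h3 * (κ * e)
        rw [h6, h7]
        ring
    · intro p hp
      rw [Finset.coe_Icc, Set.mem_Icc]
      by_contra hc
      exact hp (if_neg (by omega))
  · rw [if_neg hM, finsum_eq_zero_of_forall_eq_zero fun p => if_neg (by omega), mul_zero]

lemma heis_vac_of_pos (k : ℤ) {p : ℤ} (hp : 0 < p) : heis p (vac k) = 0 := by
  rw [vac, heis_single, bos_one_of_pos k hp, Finsupp.single_zero]

lemma sug_vac (k κ : ℤ) (hk : 0 ≤ k) :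
    fockOsc.sug k (vac κ) = (if k = 0 then (κ : ℂ) ^ 2 / 4 else 0) • vac κ := by
  have h2 := sqrt_two_ne_zero
  have h3 := sqrt_two_mul_self
  have h1 : ∀ p : ℤ, p ≠ 0 ∨ k ≠ 0 → fockOsc.no (2 * k - p) p (vac κ) = 0 := fun p hp =>
    fockOsc.no_apply_eq_zero (b := 1) (fun m hm => heis_vac_of_pos κ (by omega)) (by omega)
  rw [fockOsc.sug_apply]
  split_ifs with h
  · rw [finsum_eq_single _ 0 fun p hp => h1 p (Or.inl hp), h]
    have h4 : heis 0 (vac κ) = vcharge κ • vac κ := by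
      rw [vac, heis_single, bos_zero, LinearMap.smul_apply, Module.End.one_apply,
        Finsupp.smul_single, vcharge]
    have h5 : fockOsc.no (2 * 0 - 0) 0 (vac κ) = heis 0 (heis 0 (vac κ)) := by
      rw [Oscillators.no, if_pos (by norm_num)]; rfl
    rw [h5, h4, map_smul, h4, smul_smul, smul_smul]
    congr 1
    unfold vcharge
    field_simp
    linear_combination -2 * (κ : ℂ) ^ 2 * h3
  · rw [finsum_eq_zero_of_forall_eq_zero fun p => h1 p (Or.inr h), smul_zero, zero_smul]

/-- The defects for fixed `k` form a family closed under commutators with the modes, so again vacuum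
coefficients decide. For `k ≥ 0` the vacuum is an eigenvector of the Sugawara operator, which makes
them explicit. -/
lemma sug_vertexOp_comm {e : ℤ} (he : e = 1 ∨ e = -1) {k : ℤ} (hk : 0 ≤ k) (m : ℤ) :
    fockOsc.sug k * vertexOp e m - vertexOp e m * fockOsc.sug k =
      (-(m : ℂ) / 2 - (k : ℂ) / 2 - 1 / 4) • vertexOp e (m + 2 * k) := by
  rw [← sub_eq_zero]
  refine eq_zero_of_vacuum (𝒯 := {T | ∃ m, T = primaryDefect e k m}) ?_ ?_ ⟨m, rfl⟩
  · rintro T ⟨m, rfl⟩ q -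
    rw [heis_primaryDefect]
    exact Submodule.smul_mem _ _ (Submodule.subset_span ⟨_, rfl⟩)
  · rintro T ⟨m, rfl⟩ κ j
    have hee : (e : ℂ) * e = 1 := by rcases he with rfl | rfl <;> norm_num
    rw [primaryDefect, LinearMap.sub_apply, LinearMap.sub_apply, Module.End.mul_apply,
      Module.End.mul_apply, sug_vac k κ hk, map_smul, LinearMap.smul_apply, vertexOp_vac,
      vertexOp_vac, Finsupp.sub_apply, Finsupp.sub_apply, Finsupp.smul_apply, Finsupp.smul_apply]
    by_cases hj : j = κ + e
    · subst hj
      rw [map_sub, map_sub, MvPolynomial.constantCoeff_smul, MvPolynomial.constantCoeff_smul,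
        constantCoeff_sug_cre he _ _ _ hk, Finsupp.single_eq_same, Finsupp.single_eq_same,
        constantCoeff_cre_one, constantCoeff_cre_one]
      by_cases hm : -(m + 1) - e * κ = 2 * k
      · have hm' : (m : ℂ) = -2 * k - 1 - e * κ := by
          have := congrArg (Int.cast : ℤ → ℂ) hm
          push_cast at this
          linear_combination -this
        rw [if_pos hm, if_pos (c := -(m + 2 * k + 1) - e * κ = 0) (by omega)]
        by_cases hk0 : k = 0
        · rw [if_pos hk0, if_pos hk0, if_pos (by omega), hm', hk0]
          push_cast
          simp only [smul_eq_mul]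
          linear_combination hee / 4
        · rw [if_neg hk0, if_neg hk0, if_neg (by omega), hm']
          push_cast
          simp only [smul_eq_mul]
          linear_combination hee / 2
      · rw [if_neg hm, if_neg (c := -(m + 2 * k + 1) - e * κ = 0) (by omega)]
        by_cases hk0 : k = 0
        · rw [if_pos hk0, if_neg (by omega)]; simp
        · rw [if_neg hk0]; simp
    · rw [sug_apply_eq_zero k (Finsupp.single_eq_of_ne hj), Finsupp.single_eq_of_ne hj,
        Finsupp.single_eq_of_ne hj]
      simp

/-! ### The fermionic vectors -/

lemma comm_apply {V : Type*} [AddCommGroup V] [Module ℂ V] {D A B : Module.End ℂ V} {c : ℂ}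
    (h : D * A - A * D = c • B) (v : V) : D (A v) = A (D v) + c • B v := by
  have := congrArg (fun T : Module.End ℂ V => T v) h
  simp only [LinearMap.sub_apply, Module.End.mul_apply, LinearMap.smul_apply] at this
  rw [← this]; abel

lemma vertexOp_swap {e e' : ℤ} (he : e = 1 ∨ e = -1) (he' : e' = 1 ∨ e' = -1) {m n : ℤ}
    (h : m + n + 1 ≠ 0) (v : FockSum) :
    vertexOp e m (vertexOp e' n v) = -vertexOp e' n (vertexOp e m v) := by
  have := congrArg (fun T : Module.End ℂ FockSum => T v) (vertexOp_anticomm he he' m n)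
  rw [if_neg fun hc => h hc.2] at this
  simp only [LinearMap.add_apply, Module.End.mul_apply, zero_smul, LinearMap.zero_apply] at this
  exact eq_neg_of_add_eq_zero_left this

lemma vertexOp_swap_same {e : ℤ} (he : e = 1 ∨ e = -1) (m n : ℤ) (v : FockSum) :
    vertexOp e m (vertexOp e n v) = -vertexOp e n (vertexOp e m v) := by
  have := congrArg (fun T : Module.End ℂ FockSum => T v) (vertexOp_anticomm he he m n)
  rw [if_neg (by omega)] at this
  simp only [LinearMap.add_apply, Module.End.mul_apply, zero_smul, LinearMap.zero_apply] at this
  exact eq_neg_of_add_eq_zero_left this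

lemma vertexOp_contract {e : ℤ} (he : e = 1 ∨ e = -1) {m n : ℤ} (h : m + n + 1 = 0)
    (v : FockSum) : vertexOp e m (vertexOp (-e) n v) = v - vertexOp (-e) n (vertexOp e m v) := by
  have := congrArg (fun T : Module.End ℂ FockSum => T v)
    (vertexOp_anticomm he (e' := -e) (by omega) m n)
  rw [if_pos ⟨add_neg_cancel e, h⟩] at this
  simp only [LinearMap.add_apply, Module.End.mul_apply, one_smul, Module.End.one_apply] at this
  exact eq_sub_of_add_eq this

lemma vertexOp_vac_of_nonneg (e : ℤ) {m : ℤ} (h : 0 ≤ m) : vertexOp e m (vac 0) = 0 := by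
  rw [vertexOp_vac, cre_of_neg e (by omega), LinearMap.zero_apply, Finsupp.single_zero]

/-- The modes that occur in the fermionic vectors. -/
def fermMode (ε : Fin 2) (i : ℕ) : ℤ := -2 * ((i : ℤ) + 1) + (ε : ℕ)

/-- The products of pairs of fermions applied to the vacuum. -/
def fermProd (ε : Fin 2) (n : ℕ) : FockSum :=
  ((List.range n).map fun i => psi (fermMode ε i) * psiStar (fermMode ε i)).prod (vac 0)

lemma fermProd_zero (ε : Fin 2) : fermProd ε 0 = vac 0 := rfl

lemma psi_pair_commute {m n : ℤ} (h : m + n + 1 ≠ 0) :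
    Commute (psi m * psiStar m) (psi n * psiStar n) := by
  refine LinearMap.ext fun v => ?_
  have h' : n + m + 1 ≠ 0 := by omega
  simp only [Module.End.mul_apply, psi_eq, psiStar_eq]
  rw [vertexOp_swap (e := -1) (e' := 1) (by omega) (by omega) h, map_neg,
    vertexOp_swap (e := 1) (e' := 1) (by omega) (by omega) h, neg_neg,
    vertexOp_swap (e := -1) (e' := -1) (by omega) (by omega) h, map_neg, map_neg,
    vertexOp_swap (e := 1) (e' := -1) (by omega) (by omega) h, map_neg, neg_neg]

/-- In the definition the newest pair stands next to the vacuum. Pairs commute because their modes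
have equal parity and are never dual, so it may be moved to the left for inductions. -/
lemma fermProd_succ (ε : Fin 2) (n : ℕ) : fermProd ε (n + 1) =
    vertexOp 1 (fermMode ε n) (vertexOp (-1) (fermMode ε n) (fermProd ε n)) := by
  have h : Commute (psi (fermMode ε n) * psiStar (fermMode ε n))
      ((List.range n).map fun i => psi (fermMode ε i) * psiStar (fermMode ε i)).prod := by
    refine Commute.list_prod_right _ _ fun x hx => ?_
    obtain ⟨i, -, rfl⟩ := List.mem_map.1 hx
    exact psi_pair_commute (by unfold fermMode; omega)
  rw [fermProd, List.range_succ, List.map_append, List.prod_append, List.map_singleton,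
    List.prod_singleton, ← h.eq, Module.End.mul_apply, Module.End.mul_apply, psi_eq, psiStar_eq]
  rfl

lemma vertexOp_pair {e : ℤ} (he : e = 1 ∨ e = -1) {m μ : ℤ} (h : m + μ + 1 ≠ 0) (v : FockSum) :
    vertexOp e m (vertexOp 1 μ (vertexOp (-1) μ v)) =
      vertexOp 1 μ (vertexOp (-1) μ (vertexOp e m v)) := by
  rw [vertexOp_swap he (by omega) h, vertexOp_swap he (by omega) h, map_neg, neg_neg]

lemma vertexOp_self {e : ℤ} (he : e = 1 ∨ e = -1) (m : ℤ) (v : FockSum) :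
    vertexOp e m (vertexOp e m v) = 0 :=
  self_eq_neg.1 (vertexOp_swap_same he m m v)

/-- The modes in question either occur in the product, where repeating a fermion gives zero, or are
nonnegative and kill the vacuum. -/
lemma vertexOp_fermProd {e : ℤ} (he : e = 1 ∨ e = -1) (ε : Fin 2) (n : ℕ) (j : ℕ) :
    vertexOp e (-2 * (n : ℤ) + (ε : ℕ) + 2 * j) (fermProd ε n) = 0 := by
  induction n generalizing j with
  | zero => exact vertexOp_vac_of_nonneg e (by push_cast; omega)
  | succ n ih =>
    rw [fermProd_succ]
    rcases j with _ | j
    · have hm : -2 * ((n + 1 : ℕ) : ℤ) + (ε : ℕ) + 2 * ((0 : ℕ) : ℤ) = fermMode ε n := by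
        unfold fermMode; push_cast; ring
      rw [hm]
      rcases he with rfl | rfl
      · exact vertexOp_self (Or.inl rfl) _ _
      · rw [vertexOp_swap (by omega) (by omega) (by unfold fermMode; omega),
          vertexOp_self (Or.inr rfl), map_zero, neg_zero]
    · have := ih j
      rw [show -2 * ((n + 1 : ℕ) : ℤ) + (ε : ℕ) + 2 * ((j + 1 : ℕ) : ℤ) =
        -2 * (n : ℤ) + (ε : ℕ) + 2 * j by push_cast; ring,
        vertexOp_pair he (by unfold fermMode; omega), this, map_zero, map_zero]

/-- The mode dual to a fermion not yet in the product is nonnegative and anticommutes with every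
fermion that is, so it reaches the vacuum. -/
lemma vertexOp_dual_fermProd {e : ℤ} (he : e = 1 ∨ e = -1) (ε : Fin 2) {n j : ℕ} (hj : n ≤ j) :
    vertexOp e (-1 - fermMode ε j) (fermProd ε n) = 0 := by
  induction n with
  | zero => exact vertexOp_vac_of_nonneg e (by unfold fermMode; omega)
  | succ n ih =>
    rw [fermProd_succ, vertexOp_pair he (by unfold fermMode; omega), ih (by omega), map_zero,
      map_zero]

lemma fermProd_ne_zero (ε : Fin 2) (n : ℕ) : fermProd ε n ≠ 0 := by
  induction n with
  | zero =>
    rw [fermProd_zero, vac]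
    exact Finsupp.single_ne_zero.2 one_ne_zero
  | succ n ih =>
    intro h
    apply ih
    set μ := fermMode ε n
    have h1 : ∀ e, e = 1 ∨ e = -1 → vertexOp e (-1 - μ) (fermProd ε n) = 0 := fun e he =>
      vertexOp_dual_fermProd he ε le_rfl
    -- The dual modes contract the outermost pair and recover the previous vector.
    have h2 : vertexOp 1 (-1 - μ) (vertexOp (-1) (-1 - μ) (fermProd ε (n + 1))) =
        fermProd ε n := by
      have h3 := vertexOp_contract (e := -1) (m := -1 - μ) (n := μ) (by omega) (by ring)
        (vertexOp (-1) μ (fermProd ε n))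
      rw [neg_neg, vertexOp_swap_same (e := -1) (by omega), h1 (-1) (by omega), map_zero,
        neg_zero, map_zero, sub_zero] at h3
      rw [fermProd_succ, h3, vertexOp_contract (e := 1) (by omega) (by ring), h1 1 (by omega),
        map_zero, sub_zero]
    rw [← h2, h, map_zero, map_zero]

/-- Derivations of even positive degree kill the fermionic vectors. -/
lemma fermProd_killed {D : Module.End ℂ FockSum} {c : ℤ → ℤ → ℂ} {s : ℕ} (hs : s ≠ 0)
    (hD : ∀ e m v, e = 1 ∨ e = -1 →
      D (vertexOp e m v) = vertexOp e m (D v) + c e m • vertexOp e (m + 2 * s) v)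
    (h0 : D (vac 0) = 0) (ε : Fin 2) (n : ℕ) : D (fermProd ε n) = 0 := by
  induction n with
  | zero => exact h0
  | succ n ih =>
    -- Raising the newest mode by an even positive amount gives a mode that is already filled or
    -- kills the vacuum.
    have h1 : ∀ e, e = 1 ∨ e = -1 → vertexOp e (fermMode ε n + 2 * s) (fermProd ε n) = 0 := by
      intro e he
      have := vertexOp_fermProd he ε n (s - 1)
      rwa [show -2 * (n : ℤ) + (ε : ℕ) + 2 * ((s - 1 : ℕ) : ℤ) = fermMode ε n + 2 * s by
        unfold fermMode; omega] at this
    rw [fermProd_succ, hD _ _ _ (by omega), hD _ _ _ (by omega), ih, map_zero, h1 _ (by omega),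
      vertexOp_swap (e := 1) (e' := -1) (by omega) (by omega) (by unfold fermMode; omega),
      h1 _ (by omega)]
    simp only [smul_zero, add_zero, map_zero, neg_zero]

lemma fermProd_eigen {D : Module.End ℂ FockSum} {c : ℤ → ℤ → ℂ}
    (hD : ∀ e m v, e = 1 ∨ e = -1 → D (vertexOp e m v) = vertexOp e m (D v) + c e m • vertexOp e m v)
    (h0 : D (vac 0) = 0) (ε : Fin 2) (n : ℕ) :
    D (fermProd ε n) =
      (∑ i ∈ Finset.range n, (c 1 (fermMode ε i) + c (-1) (fermMode ε i))) • fermProd ε n := by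
  induction n with
  | zero => rw [Finset.sum_range_zero, zero_smul]; exact h0
  | succ n ih =>
    rw [fermProd_succ, hD _ _ _ (by omega), hD _ _ _ (by omega), ih, Finset.sum_range_succ, map_smul,
      map_add, map_smul, map_smul]
    module

/-- Positive even labels fall under `fermProd_killed`; for the zero mode the charges of the two
fermions in each pair cancel. -/
lemma heis_even_fermProd (ε : Fin 2) (n j : ℕ) : heis (2 * j) (fermProd ε n) = 0 := by
  rcases j with _ | j
  · have h0 : heis 0 (vac 0) = 0 := by
      rw [vac, heis_single, bos_zero]; simp
    rw [show (2 : ℤ) * ((0 : ℕ) : ℤ) = 0 by norm_num,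
      fermProd_eigen (c := fun e _ => vcharge e) (fun e m v _ => by
        have := comm_apply (heis_vertexOp_comm e m 0) v
        rwa [add_zero] at this) h0]
    have : vcharge 1 + vcharge (-1) = 0 := by unfold vcharge; push_cast; ring
    simp only [this, Finset.sum_const_zero, zero_smul]
  · exact fermProd_killed (s := j + 1) (Nat.succ_ne_zero j) (c := fun e _ => vcharge e)
      (fun e m v _ => comm_apply (heis_vertexOp_comm e m _) v) (heis_vac_of_pos 0 (by omega)) ε n

lemma sug_fermProd_of_pos (ε : Fin 2) (n : ℕ) {k : ℤ} (hk : 0 < k) :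
    fockOsc.sug k (fermProd ε n) = 0 := by
  lift k to ℕ using hk.le
  refine fermProd_killed (s := k) (by omega)
    (fun e m v he => comm_apply (sug_vertexOp_comm he hk.le m) v) ?_ ε n
  rw [sug_vac _ _ hk.le, if_neg hk.ne', zero_smul]

lemma sug_zero_fermProd (ε : Fin 2) (n : ℕ) :
    fockOsc.sug 0 (fermProd ε n) = ((n : ℂ) ^ 2 + n / 2 - (ε : ℕ) * n) • fermProd ε n := by
  have h0 : fockOsc.sug 0 (vac 0) = 0 := by
    rw [sug_vac _ _ le_rfl]; simp
  rw [fermProd_eigen (c := fun _ m => -(m : ℂ) / 2 - ((0 : ℤ) : ℂ) / 2 - 1 / 4) (fun e m v he => by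
        have := comm_apply (sug_vertexOp_comm he le_rfl m) v
        rwa [mul_zero, add_zero] at this) h0]
  congr 1
  induction n with
  | zero => simp
  | succ n ih =>
    rw [Finset.sum_range_succ, ih, fermMode]
    push_cast; ring

/-- For negative `n` the product has `j = -n` pairs with the odd modes, and `j ^ 2 - j / 2` is again
`n ^ 2 + n / 2`. -/
lemma fermVec_eq (n : ℤ) : ∃ (ε : Fin 2) (j : ℕ), fermVec n = fermProd ε j ∧
    (n : ℂ) ^ 2 + n / 2 = (j : ℂ) ^ 2 + j / 2 - (ε : ℕ) * j := by
  unfold fermVec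
  split_ifs with h
  · refine ⟨0, n.toNat, ?_, ?_⟩
    · simp [fermProd, fermMode]
    · have : ((n.toNat : ℕ) : ℂ) = n := by
        rw [← Int.cast_natCast, Int.toNat_of_nonneg h]
      rw [this]; simp
  · refine ⟨1, (-n).toNat, ?_, ?_⟩
    · simp [fermProd, fermMode]
    · have : (((-n).toNat : ℕ) : ℂ) = -n := by
        rw [← Int.cast_natCast, Int.toNat_of_nonneg (by omega)]; push_cast; ring
      rw [this]; simp; ring

lemma fermVec_ne_zero (n : ℤ) : fermVec n ≠ 0 := by
  obtain ⟨ε, j, h, -⟩ := fermVec_eq n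
  rw [h]; exact fermProd_ne_zero ε j

lemma heis_even_fermVec (n : ℤ) (j : ℕ) : heis (2 * j) (fermVec n) = 0 := by
  obtain ⟨ε, i, h, -⟩ := fermVec_eq n
  rw [h]; exact heis_even_fermProd ε i j

lemma sug_fermVec (n : ℤ) {k : ℤ} (hk : 0 ≤ k) :
    fockOsc.sug k (fermVec n) = (if k = 0 then (n : ℂ) ^ 2 + n / 2 else 0) • fermVec n := by
  obtain ⟨ε, i, h, h'⟩ := fermVec_eq n
  rw [h]
  split_ifs with hk0
  · rw [hk0, sug_zero_fermProd, h']
  · rw [sug_fermProd_of_pos ε i (by omega), zero_smul]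

/-- The Fock module `F` consists of the vectors killed by the even nonnegative modes. -/
lemma mem_fockF_of_heis {v : FockSum} (h : ∀ j : ℕ, heis (2 * j) v = 0) : v ∈ fockF := by
  have h0 : ∀ k : ℤ, k ≠ 0 → v k = 0 := by
    intro k hk
    have := congrArg (fun u : FockSum => u k) (h 0)
    simp only [Nat.cast_zero, mul_zero, heis_apply, bos_zero, LinearMap.smul_apply,
      Module.End.one_apply, Finsupp.zero_apply] at this
    refine (smul_eq_zero.1 this).resolve_left (div_ne_zero ?_ sqrt_two_ne_zero)
    exact_mod_cast hk
  refine Submodule.mem_map.2 ⟨v 0, ?_, ?_⟩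
  · rw [Subalgebra.mem_toSubmodule, MvPolynomial.mem_supported]
    intro i hi
    by_contra hodd
    rw [Set.mem_ofPred_eq, Nat.not_even_iff_odd] at hodd
    obtain ⟨l, rfl⟩ := hodd
    obtain ⟨s, hs, hsi⟩ := (MvPolynomial.mem_vars_iff_mem_support _).1 hi
    have h1 := congrArg (fun u : FockSum => u 0) (h (l + 1))
    rw [show (2 : ℤ) * ((l + 1 : ℕ) : ℤ) = ((2 * l + 1 + 1 : ℕ) : ℤ) by push_cast; ring] at h1
    simp only [heis_apply, bos_pos, LinearMap.smul_apply, Finsupp.zero_apply] at h1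
    have h3 : (((2 * l + 1 : ℕ) : ℂ) + 1) / 2 ≠ 0 :=
      div_ne_zero (by exact_mod_cast Nat.succ_ne_zero (2 * l + 1)) two_ne_zero
    have h4 := congrArg (MvPolynomial.coeff (s - Finsupp.single (2 * l + 1) 1))
      ((smul_eq_zero.1 h1).resolve_left h3)
    have hle : Finsupp.single (2 * l + 1) 1 ≤ s := by
      rw [Finsupp.single_le_iff]
      have := Finsupp.mem_support_iff.1 hsi
      omega
    rw [Derivation.coeFn_coe, MvPolynomial.coeff_pderiv, tsub_add_cancel_of_le hle,
      MvPolynomial.coeff_zero] at h4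
    refine MvPolynomial.mem_support_iff.1 hs ((mul_eq_zero.mp h4).resolve_right ?_)
    exact_mod_cast Nat.succ_ne_zero ((s - Finsupp.single (2 * l + 1) 1 : ℕ →₀ ℕ) (2 * l + 1))
  · ext1 k
    by_cases hk : k = 0
    · subst hk; rw [Finsupp.lsingle_apply, Finsupp.single_eq_same]
    · rw [Finsupp.lsingle_apply, Finsupp.single_eq_of_ne hk, h0 k hk]

lemma fermVec_mem_fockF (n : ℤ) : fermVec n ∈ fockF := mem_fockF_of_heis (heis_even_fermVec n)

/-! ### The twisted Fock module inside `F̄(0)` -/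

/-- The identification of the twisted Fock module with `F`. -/
def doubling : Pol →ₗ[ℂ] FockSum :=
  Finsupp.lsingle 0 ∘ₗ (MvPolynomial.rename fun i : ℕ => 2 * i).toLinearMap

lemma doubling_apply (g : Pol) :
    doubling g = Finsupp.single 0 (MvPolynomial.rename (fun i : ℕ => 2 * i) g) := rfl

lemma two_mul_injective : Function.Injective fun i : ℕ => 2 * i := fun i j h => by
  simpa using h

lemma doubling_injective : Function.Injective doubling := fun _ _ h =>
  MvPolynomial.rename_injective _ two_mul_injective (Finsupp.single_injective 0 h)

lemma exists_doubling_eq {v : FockSum} (hv : v ∈ fockF) : ∃ g, doubling g = v := by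
  obtain ⟨f, hf, rfl⟩ := Submodule.mem_map.1 hv
  obtain ⟨g, rfl⟩ := MvPolynomial.exists_rename_eq_of_vars_subset_range f (fun i : ℕ => 2 * i)
    two_mul_injective fun i hi => by
      obtain ⟨j, hj⟩ := MvPolynomial.mem_supported.1 hf hi
      exact ⟨j, by change 2 * j = i; omega⟩
  exact ⟨g, rfl⟩

lemma oscPos_zero (i : ℕ) : oscPos 0 i = ((2 * i + 1 : ℕ) : ℤ) := by simp [oscPos]

lemma heis_doubling (s : ℤ) (g : Pol) :
    heis (2 * s + 1) (doubling g) = doubling (oscA 0 ((0 : ℝ) : ℂ) (2 * s + 1) g) := by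
  rw [doubling_apply, doubling_apply, heis_single]
  congr 1
  rcases lt_or_ge s 0 with hs | hs
  · obtain ⟨i, rfl⟩ : ∃ i : ℕ, s = -(i : ℤ) - 1 := ⟨(-s - 1).toNat, by omega⟩
    rw [show 2 * (-(i : ℤ) - 1) + 1 = -oscPos 0 i by rw [oscPos_zero]; push_cast; ring, oscA_neg,
      oscPos_zero, bos_neg]
    simp
  · lift s to ℕ using hs
    rw [show 2 * (s : ℤ) + 1 = oscPos 0 s by rw [oscPos_zero]; push_cast; rfl, oscA_pos,
      oscPos_zero, bos_pos]
    simp only [LinearMap.smul_apply, Derivation.coeFn_coe, map_smul]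
    rw [MvPolynomial.pderiv_rename two_mul_injective]
    push_cast
    rfl

lemma oscA_even (p : ℤ) : oscA 0 ((0 : ℝ) : ℂ) (2 * p) = 0 := by
  unfold oscA
  split_ifs with h h1
  · rw [Complex.ofReal_zero, zero_smul]
  · change (2 * p - 1 - 0) % 2 = 0 at h1
    omega
  · change (2 * p - 1 - 0) % 2 = 0 at h1
    omega
  · rfl

lemma odd_injective : Function.Injective fun s : ℤ => 2 * s + 1 := fun i j h => by
  simpa using h

lemma even_of_notMem_range {p : ℤ} (hp : p ∉ Set.range fun s : ℤ => 2 * s + 1) :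
    ∃ s, p = 2 * s := by
  refine ⟨p / 2, ?_⟩
  by_contra hc
  exact hp ⟨p / 2, by change 2 * (p / 2) + 1 = p; omega⟩

lemma virL_apply (n : ℤ) (v : FockSum) : virL n v =
    (1 / 2 : ℂ) • (∑ᶠ s : ℤ, fockOsc.no (2 * n - (2 * s + 1)) (2 * s + 1) v) +
      (if n = 0 then (1 / 16 : ℂ) else 0) • v := rfl

lemma twisted_L_apply (n : ℤ) (g : Pol) : twisted.L n g =
    (1 / 2 : ℂ) • (∑ᶠ p : ℤ, (osc 0 ((0 : ℝ) : ℂ)).no (2 * n - p) p g) +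
      (if n = 0 then (1 / 16 : ℂ) else 0) • g := by
  have : (((1 / 16 : ℝ)) : ℂ) = 1 / 16 := by push_cast; rfl
  change (osc 0 ((0 : ℝ) : ℂ)).vir (((1 / 16 : ℝ)) : ℂ) n g = _
  rw [this]
  rfl

/-- The twisted sum runs over all integers, the original one over odd labels only. The even terms
vanish since the twisted module has no oscillators of even label and its zero mode is zero. -/
lemma virL_doubling (n : ℤ) (g : Pol) : virL n (doubling g) = doubling (twisted.L n g) := by
  rw [virL_apply, twisted_L_apply, map_add, map_smul, map_smul]
  congr 2
  rw [map_finsum doubling ((osc 0 ((0 : ℝ) : ℂ)).no_finite n g)]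
  refine Eq.trans ?_ (finsum_eq_finsum_comp
    (f := fun p => doubling ((osc 0 ((0 : ℝ) : ℂ)).no (2 * n - p) p g)) odd_injective ?_).symm
  · refine finsum_congr fun s => ?_
    have h : 2 * n - (2 * s + 1) = 2 * (n - s - 1) + 1 := by ring
    simp only [Oscillators.no]
    split_ifs
    · rw [Module.End.mul_apply, Module.End.mul_apply, fockOsc_a, fockOsc_a, osc_a, osc_a, h,
        heis_doubling, heis_doubling]
    · rw [Module.End.mul_apply, Module.End.mul_apply, fockOsc_a, fockOsc_a, osc_a, osc_a, h,
        heis_doubling, heis_doubling]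
  · intro p hp
    obtain ⟨s, rfl⟩ := even_of_notMem_range hp
    simp only [Oscillators.no, osc_a, oscA_even, mul_zero, zero_mul, ite_self,
      LinearMap.zero_apply, map_zero]

/-- For `k ≥ 0`, normal ordering puts an index at least `k` on the right. In an even term this is a
nonnegative even mode, which kills `u`; only odd terms remain. -/
lemma virL_eq_sug {u : FockSum} (h : ∀ j : ℕ, heis (2 * j) u = 0) {k : ℤ} (hk : 0 ≤ k) :
    virL k u = fockOsc.sug k u + (if k = 0 then (1 / 16 : ℂ) else 0) • u := by
  rw [virL_apply, Oscillators.sug_apply]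
  congr 2
  refine (finsum_eq_finsum_comp (f := fun p => fockOsc.no (2 * k - p) p u) odd_injective
    fun p hp => ?_).symm
  obtain ⟨s, rfl⟩ := even_of_notMem_range hp
  unfold Oscillators.no
  split_ifs with hs
  · have := h s.toNat
    rw [Int.toNat_of_nonneg (by omega)] at this
    rw [Module.End.mul_apply, fockOsc_a, fockOsc_a, this, map_zero]
  · have := h (k - s).toNat
    rw [Int.toNat_of_nonneg (by omega)] at this
    rw [Module.End.mul_apply, fockOsc_a, fockOsc_a, ← mul_sub, this, map_zero]

lemma virL_fermVec (n : ℤ) {k : ℤ} (hk : 0 ≤ k) : virL k (fermVec n) =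
    (if k = 0 then ((n : ℂ) + 1 / 4) ^ 2 else 0) • fermVec n := by
  rw [virL_eq_sug (heis_even_fermVec n) hk, sug_fermVec n hk, ← add_smul]
  congr 1
  split_ifs
  · ring
  · ring

lemma fermVec_isVirHighestWeight (n : ℤ) :
    IsVirHighestWeight (((n : ℂ) + 1 / 4) ^ 2) (fermVec n) :=
  ⟨fermVec_ne_zero n, fun k hk => by rw [virL_fermVec n hk.le, if_neg hk.ne', zero_smul],
    by rw [virL_fermVec n le_rfl, if_pos rfl]⟩

lemma twisted_isSing_iff (c : ℂ) (g : Pol) : twisted.IsSing c g ↔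
    (∀ k : ℤ, 0 < k → virL k (doubling g) = 0) ∧ virL 0 (doubling g) = c • doubling g := by
  simp only [UnitaryVir.IsSing, virL_doubling, ← map_smul, doubling_injective.eq_iff,
    map_eq_zero_iff doubling doubling_injective]

/-! ### The classification -/

/-- Singular vectors of different real weights are orthogonal. -/
lemma UnitaryVir.ip_eq_zero_of_ne {V : Type*} [AddCommGroup V] [Module ℂ V] (U : UnitaryVir V)
    {a b : ℂ} {x y : V} (hx : U.L 0 x = a • x) (hy : U.L 0 y = b • y) (h : conj a ≠ b) :
    U.ip x y = 0 := by
  have h1 := U.ip_L 0 x y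
  rw [neg_zero, hx, hy, U.ip_smul_left, U.ip_smul] at h1
  by_contra h0
  exact h (mul_right_cancel₀ h0 h1)

lemma UnitaryVir.exists_normalize {V : Type*} [AddCommGroup V] [Module ℂ V] (U : UnitaryVir V)
    {x : V} (hx : x ≠ 0) : ∃ a : ℂ, U.ip (a • x) (a • x) = 1 := by
  have him : (U.ip x x).im = 0 := Complex.conj_eq_iff_im.1 (U.ip_conj x x)
  have hre : (U.ip x x).re ≠ 0 := fun h => hx (U.ip_definite x (Complex.ext h him))
  have hpos : 0 < (U.ip x x).re := lt_of_le_of_ne (U.ip_nonneg x) (Ne.symm hre)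
  refine ⟨((Real.sqrt (U.ip x x).re)⁻¹ : ℝ), ?_⟩
  have h1 : U.ip x x = (((U.ip x x).re : ℝ) : ℂ) := Complex.ext rfl (by rw [him, Complex.ofReal_im])
  rw [U.ip_smul_left, U.ip_smul, Complex.conj_ofReal, h1, ← Complex.ofReal_mul, ← Complex.ofReal_mul,
    Complex.ofReal_re, ← Complex.ofReal_one]
  congr 1
  have h2 := Real.mul_self_sqrt hpos.le
  have h3 : Real.sqrt (U.ip x x).re ≠ 0 := (Real.sqrt_pos.2 hpos).ne'
  field_simp
  rw [pow_two, h2]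

/-- The difference of two weights factors as `(m - n) * (2 * (m + n) + 1)` up to a constant, and the
second factor is odd. -/
lemma conformalWeight_injective : Function.Injective fun n : ℤ => ((n : ℂ) + 1 / 4) ^ 2 := by
  intro m n h
  have h1 : ((m : ℂ) - n) * (2 * (m + n) + 1) = 0 := by
    have h' : ((m : ℂ) + 1 / 4) ^ 2 = ((n : ℂ) + 1 / 4) ^ 2 := h
    linear_combination 2 * h'
  have h2 : (m - n) * (2 * (m + n) + 1) = 0 := by exact_mod_cast h1
  rcases mul_eq_zero.1 h2 with h3 | h3 <;> omega

lemma conj_conformalWeight (n : ℤ) : conj (((n : ℂ) + 1 / 4) ^ 2) = ((n : ℂ) + 1 / 4) ^ 2 := by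
  simp [Complex.conj_ofNat]

/-- The eigenvalues of `L 0` in the twisted Fock module. -/
lemma twisted_L_zero (s : ℕ →₀ ℕ) : twisted.L 0 (MvPolynomial.basisMonomials ℕ ℂ s) =
    ((oscWt 0 s : ℂ) / 2 + 1 / 16) • MvPolynomial.basisMonomials ℕ ℂ s := by
  rw [MvPolynomial.coe_basisMonomials]
  have := vir_zero_monomial 0 ((0 : ℝ) : ℂ) (((1 / 16 : ℝ)) : ℂ) s
  refine Eq.trans this ?_
  congr 1
  push_cast; ring

lemma finrank_twisted_le (c : ℂ) :
    FiniteDimensional ℂ (Module.End.eigenspace (twisted.L 0) c) ∧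
    FiniteDimensional ℂ (Module.End.eigenspace (allVir.L 0) c) ∧
    Module.finrank ℂ (Module.End.eigenspace (twisted.L 0) c) ≤
      Module.finrank ℂ (Module.End.eigenspace (allVir.L 0) c) := by
  have h2 := finrank_eigenspace_diagonal fockBasis allVir_L_zero c (allWt_finite c)
  by_cases hex : ∃ s, (oscWt 0 s : ℂ) / 2 + 1 / 16 = c
  · obtain ⟨t, rfl⟩ := hex
    have hset : {s | (oscWt 0 s : ℂ) / 2 + 1 / 16 = (oscWt 0 t : ℂ) / 2 + 1 / 16} =
        {s | oscWt 0 s = oscWt 0 t} := by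
      ext s
      change (oscWt 0 s : ℂ) / 2 + 1 / 16 = (oscWt 0 t : ℂ) / 2 + 1 / 16 ↔ oscWt 0 s = oscWt 0 t
      constructor
      · intro h
        have : (oscWt 0 s : ℂ) = oscWt 0 t := by linear_combination 2 * h
        exact_mod_cast this
      · intro h; rw [h]
    have h1 := finrank_eigenspace_diagonal _ twisted_L_zero
      ((oscWt 0 t : ℂ) / 2 + 1 / 16) (by
        rw [hset]; exact (oscWt_finite 0 (oscWt 0 t)).subset fun s hs => le_of_eq hs)
    refine ⟨h1.1, h2.1, ?_⟩
    rw [h1.2, h2.2, hset]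
    exact card_oscWt_le _
  · have hset : {s | (oscWt 0 s : ℂ) / 2 + 1 / 16 = c} = ∅ :=
      Set.eq_empty_of_forall_notMem fun s hs => hex ⟨s, hs⟩
    have h1 := finrank_eigenspace_diagonal _ twisted_L_zero c (by
      rw [hset]; exact Set.finite_empty)
    refine ⟨h1.1, h2.1, ?_⟩
    rw [h1.2, hset]
    simp

/-- Every singular vector of the twisted Fock module is a multiple of a fermionic vector. -/
lemma eq_smul_fermVec {c : ℂ} {v : FockSum} (hv : v ∈ fockF) (h : IsVirHighestWeight c v) :
    ∃ (n : ℤ) (a : ℂ), c = ((n : ℂ) + 1 / 4) ^ 2 ∧ v = a • fermVec n := by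
  choose g hg using fun n => exists_doubling_eq (fermVec_mem_fockF n)
  have hg0 : ∀ n, g n ≠ 0 := fun n h0 => fermVec_ne_zero n (by rw [← hg, h0, map_zero])
  choose a ha using fun n => twisted.exists_normalize (hg0 n)
  have hsing : ∀ n : ℤ, twisted.IsSing (((n : ℂ) + 1 / 4) ^ 2) (a n • g n) := by
    intro n
    have h1 : twisted.IsSing (((n : ℂ) + 1 / 4) ^ 2) (g n) := by
      rw [twisted_isSing_iff, hg]
      exact (fermVec_isVirHighestWeight n).2
    exact ⟨fun k hk => by rw [map_smul, h1.1 k hk, smul_zero], by rw [map_smul, h1.2, smul_comm]⟩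
  -- The fermionic vectors have distinct real weights and are thus automatically orthogonal, just
  -- like the vacua of the comparison module.
  have hip : ∀ m n : ℤ, twisted.ip (a m • g m) (a n • g n) = allVir.ip (vac m) (vac n) := by
    intro m n
    rw [allVir_ip_vac]
    split_ifs with hmn
    · rw [← hmn, ha]
    · refine twisted.ip_eq_zero_of_ne (hsing m).2 (hsing n).2 ?_
      rw [conj_conformalWeight]
      exact fun hc => hmn (conformalWeight_injective hc)
  obtain ⟨f, rfl⟩ := exists_doubling_eq hv
  have hf : twisted.IsSing c f := (twisted_isSing_iff c f).2 h.2
  have hf0 : f ≠ 0 := fun h0 => h.1 (by rw [h0, map_zero])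
  obtain ⟨hfin1, hfin2, hdim⟩ := finrank_twisted_le c
  have hspan := twisted.eigenspace_le_span allVir hsing allVir_isSing hip c hdim
    (allVir_eigenspace_le c)
  obtain ⟨n, hn, b, hb⟩ := UnitaryVir.IsSing.mem_span twisted ha conformalWeight_injective
    hsing hspan hf hf0
  refine ⟨n, b * a n, hn.symm, ?_⟩
  rw [hb, map_smul, map_smul, hg, smul_smul]

end VirFock

end

theorem mainTheorem8 :
    (∀ n : ℤ, VirFock.fermVec n ∈ VirFock.fockF ∧
      VirFock.IsVirHighestWeight (((n : ℂ) + 1 / 4) ^ 2) (VirFock.fermVec n)) ∧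
    (∀ (Δ : ℂ) (v : VirFock.FockSum), v ∈ VirFock.fockF → VirFock.IsVirHighestWeight Δ v →
      ∃ (n : ℤ) (c : ℂ), Δ = ((n : ℂ) + 1 / 4) ^ 2 ∧ v = c • VirFock.fermVec n) :=
  ⟨fun n => ⟨VirFock.fermVec_mem_fockF n, VirFock.fermVec_isVirHighestWeight n⟩,
    fun _ _ hv h => VirFock.eq_smul_fermVec hv h⟩
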